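/- Let $\Omega=(A,B)$ be a bounded interval and $T>0$. Let $a\in L^\infty(0,T;W^{1,\infty}(\Omega))$, $f\in L^2(\Omega\times(0,T))$ and $u_0\in L^2(\Omega)$. For $\mu>0$ and $N\ge 1$ put $\Delta t=T/N$, $t_n=n\Delta t$. Given velocities $w^n$ and sources $f^n\in L^2(\Omega)$, $n=1,\dots,N$, the implicit Euler scheme with velocity $w$ is: $u^0=u_0$ and, for $n=0,\dots,N-1$, find $u^{n+1}\in H^1_0(\Omega)$ with $$\Big(\frac{u^{n+1}-u^n}{\Delta t},v\Big)+(w^{n+1}\partial_x u^{n+1},v)+\mu(\partial_xu^{n+1},\partial_xv)=(f^{n+1},v)\qquad\forall v\in H^1_0(\Omega).$$ Consider a grid of $\overline\Omega$ with Lagrange finite elements of some degree $k\ge1$ and Lagrange interpolation nodes $A=\alpha_0<\dots<\alpha_I=B$ (the end points of each element and $k-1$ interior points of it), and let $X_h\subset H^1_0(\Omega)$ be the space of continuous functions that vanish at $A,B$ and are polynomials of degree at most $k$ on each element. Let $a_h^n$ be constant on the interior of each element. For a sequence $b=(b^n)_{n=1}^N$ in a normed space $Y$ put $\|b\|_{l^2(Y)}=(\Delta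 t\sum_{n=1}^N\|b^n\|_Y^2)^{1/2}$ and $\|b\|_{l^\infty(Y)}=\max_{1\le n\le N}\|b^n\|_Y$. **(1) Error estimate.** Assume $u_0\in H^1_0(\Omega)$, and let $\varepsilon\in(0,1)$, $D>0$, $S>0$, $\bar\mu>0$ and a number $L$ with $|\partial_xa|\le L$ a.e. be given. There is a constant $C>0$, depending only on $\Omega,T,a,f,u_0,\varepsilon,D,S,L,\bar\mu$ (hence independent of $h$, $\Delta t$ and of $\mu\in(0,\bar\mu]$), such that the following holds for all $0<\mu\le\bar\mu$, all $N\ge1$ with $\Delta t\,\|a\|_{L^\infty(\Omega\times(0,T))}^2\le(1-\varepsilon)\mu$, all grids, all elementwise constant $a_h^n$ with $\|a_h^n\|_{L^\infty(\Omega)}\le D\|a\|_{L^\infty(\Omega\times(0,T))}$, and all approximations $a^n$, $f^n$ of $a$, $f$ at $t_n$ that are stable, i.e. $\|a^n\|_{L^\infty(\Omega)}\le\|a\|_{L^\infty(\Omega\times(0,T))}$, $a^n$ is $L$-Lipschitz on $\Omega$, and $\|f^\cdot\|_{l^2(L^2(\Omega))}\le S\|f\|_{L^2(\Omega\times(0,T))}$.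 If $u^n$ solves the implicit Euler scheme with velocity $a^n$, $U^n$ solves it with velocity $a_h^n$ (same $f^n$, $u_0$), and $e^n=u^n-U^n$, then $$\mu\,\|e\|_{l^\infty(L^\infty(\Omega))}\le C\,\|a_h-a\|_{l^2(L^\infty(\Omega))},$$ where the right-hand norm is that of the sequence $a_h^n-a^n$. **(2) Nodal exactness.** Suppose $a$ is equal to a constant, and $a^n=a_h^n=a$. For $\omega_i=(\alpha_{i-1},\alpha_i)$, $h_i=\alpha_i-\alpha_{i-1}$ and $j\ge1$ set $$z_j^i(x)=\sqrt{\tfrac2{h_i}}\,e^{a(x-\alpha_{i-1})/(2\mu)}\sin\frac{j\pi(x-\alpha_{i-1})}{h_i},\quad p^i(x)=e^{-a(x-\alpha_{i-1})/\mu},\quad \beta_j^i=\Big(1+\Delta t\Big(\mu\frac{j^2\pi^2}{h_i^2}+\frac{a^2}{4\mu}\Big)\Big)^{-1},$$ and $b(w,v)=(a\,\partial_xw,v)+\mu(\partial_xw,\partial_xv)$. The spectral VMS method is: $U_h^0\in X_h$ is the Lagrange interpolate of $u_0$ (at the nodes $\alpha_1,\dots,\alpha_{I-1}$), $\tilde U_h^0=u_0-U_h^0$,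 and for $n=0,\dots,N-1$ find $U_h^{n+1}\in X_h$ such that for all $v_h\in X_h$ $$(U_h^{n+1},v_h)+\Delta t\,b(U_h^{n+1},v_h)+(\tilde U_h^{n+1},v_h)+\Delta t\,b(\tilde U_h^{n+1},v_h)=\Delta t(f^{n+1},v_h)+(U_h^n,v_h)+(\tilde U_h^n,v_h),$$ where $\tilde U_h^{n+1}\in\bigoplus_iH^1_0(\omega_i)$ is given on $\omega_i$ by $\sum_{j\ge1}\beta_j^i\langle R^{n+1},p^iz_j^i\rangle z_j^i$ with $\langle R^{n+1},v\rangle=(U_h^n+\tilde U_h^n,v)+\Delta t(f^{n+1},v)-(U_h^{n+1},v)-\Delta t\,b(U_h^{n+1},v)$, all products being taken over $\omega_i$. Then, for every $\mu>0$ and $N\ge1$, every solution of this method coincides at the Lagrange interpolation nodes with the solution $u^n$ of the implicit Euler scheme with velocity $a$: $U_h^n(\alpha_i)=u^n(\alpha_i)$ for $n=1,\dots,N$ and $0\le i\le I$, and for $n=0$ and $0<i<I$. -/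

import Mathlib

open MeasureTheory Set Filter Topology
open scoped NNReal ENNReal

noncomputable section

namespace SpectralVMS

/-- `u ∈ H¹₀(l, r)` in one space dimension, for the continuous representative `u`: `u` is absolutely
continuous on `[l, r]`, its derivative (which is then its weak derivative) is square integrable,
and `u` vanishes at the two end points. Only the values of `u` on `[l, r]` matter. -/
def MemH10 (l r : ℝ) (u : ℝ → ℝ) : Prop :=
  AbsolutelyContinuousOnInterval u l r ∧
    MemLp (deriv u) 2 (volume.restrict (Ioo l r)) ∧ u l = 0 ∧ u r = 0

/-- The `L²(l, r)` scalar product. -/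
def ip (l r : ℝ) (u v : ℝ → ℝ) : ℝ := ∫ x in l..r, u x * v x

/-- The advection-diffusion form `b(w, v) = (a ∂ₓw, v) + μ (∂ₓw, ∂ₓv)` on `(l, r)`. -/
def bForm (l r : ℝ) (a : ℝ → ℝ) (μ : ℝ) (w v : ℝ → ℝ) : ℝ :=
  ip l r (fun x => a x * deriv w x) v + μ * ip l r (deriv w) (deriv v)

/-- The norm of `L^∞(l, r)`. -/
def normLinf (l r : ℝ) (v : ℝ → ℝ) : ℝ := (eLpNorm v ∞ (volume.restrict (Ioo l r))).toReal

/-- The norm of `L²(l, r)`. -/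
def normL2 (l r : ℝ) (v : ℝ → ℝ) : ℝ := (eLpNorm v 2 (volume.restrict (Ioo l r))).toReal

/-- Lebesgue measure on the space-time cylinder; a point is `(t, x)`. -/
def cylinder (T l r : ℝ) : Measure (ℝ × ℝ) := volume.restrict (Ioo 0 T ×ˢ Ioo l r)

/-- The discrete norm `(Δt ∑_{n=1}^N (b n)²)^{1/2}` of a sequence of spatial norms. -/
def seqL2 (N : ℕ) (τ : ℝ) (b : ℕ → ℝ) : ℝ := Real.sqrt (τ * ∑ n ∈ Finset.Icc 1 N, b n ^ 2)

/-- The discrete norm `max_{n=1,…,N} b n` of a sequence of spatial norms. -/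
def seqLinf (N : ℕ) (b : ℕ → ℝ) : ℝ := ⨆ n : Set.Icc 1 N, b n

/-- A grid of `[A, B]` with `elems` elements carrying Lagrange finite elements of degree `deg`:
`node 0 < node 1 < …` are the Lagrange interpolation nodes, `deg + 1` of them in each element, end
points included. The `j`-th element is `[node (deg * j), node (deg * (j + 1))]`. -/
structure Grid (A B : ℝ) where
  deg : ℕ
  elems : ℕ
  deg_pos : 1 ≤ deg
  elems_pos : 1 ≤ elems
  node : ℕ → ℝ
  node_lt : ∀ i < deg * elems, node i < node (i + 1)
  node_first : node 0 = A
  node_last : node (deg * elems) = B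

namespace Grid

variable {A B : ℝ} (G : Grid A B)

/-- The index of the last Lagrange node. -/
def last : ℕ := G.deg * G.elems

/-- The function that equals `c j` on the interior of the `j`-th element. -/
def pcw (c : ℕ → ℝ) (x : ℝ) : ℝ :=
  ∑ j ∈ Finset.range G.elems,
    (Ioo (G.node (G.deg * j)) (G.node (G.deg * (j + 1)))).indicator (fun _ => c j) x

/-- The Lagrange finite element space `X_h ⊂ H¹₀(A, B)`: continuous functions that are polynomials of
degree at most `deg` on each element and vanish at the end points. -/
def MemXh (v : ℝ → ℝ) : Prop :=
  ContinuousOn v (Icc A B) ∧ v A = 0 ∧ v B = 0 ∧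
    ∀ j < G.elems, ∃ P : Polynomial ℝ, P.natDegree ≤ G.deg ∧
      ∀ x ∈ Icc (G.node (G.deg * j)) (G.node (G.deg * (j + 1))), v x = P.eval x

end Grid

/-- `u 0, …, u N` solves the implicit Euler semi-discretisation with velocities `w n`, sources `f n`
(at time `t_n`), time step `τ` and initial datum `u₀`. -/
structure IsEulerSolution (A B μ τ : ℝ) (N : ℕ) (w f : ℕ → ℝ → ℝ) (u₀ : ℝ → ℝ)
    (u : ℕ → ℝ → ℝ) : Prop where
  init : ∀ x ∈ Icc A B, u 0 x = u₀ x
  mem : ∀ n < N, MemH10 A B (u (n + 1))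
  eqn : ∀ n < N, ∀ v, MemH10 A B v →
    ip A B (fun x => (u (n + 1) x - u n x) / τ) v + bForm A B (w (n + 1)) μ (u (n + 1)) v
      = ip A B (f (n + 1)) v

/-- Eigenfunction `z_j`, `j ≥ 1`, of `w ↦ a w' - μ w''` in `H¹₀(l, r)`, for a constant velocity `a`,
normalised in `L²_p(l, r)`. -/
def eigFun (l r a μ : ℝ) (j : ℕ) (x : ℝ) : ℝ :=
  Real.sqrt (2 / (r - l)) * Real.exp (a * (x - l) / (2 * μ)) *
    Real.sin (j * Real.pi * (x - l) / (r - l))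

/-- The eigenvalue associated with `eigFun`. -/
def eigVal (l r a μ : ℝ) (j : ℕ) : ℝ :=
  μ * (j * Real.pi / (r - l)) ^ 2 + a ^ 2 / (4 * μ)

/-- The weight `p`. -/
def weight (l a μ : ℝ) (x : ℝ) : ℝ := Real.exp (-(a * (x - l) / μ))

/-- The residual `⟨R, v⟩` on `(l, r)`: `(old, v) + τ (f, v) - (U, v) - τ b(U, v)`, where `old` is the
sum of the resolved and sub-grid parts at the previous time step and `a` the constant velocity. -/
def residual (l r a μ τ : ℝ) (f old U v : ℝ → ℝ) : ℝ :=
  ip l r old v + τ * ip l r f v - ip l r U v - τ * bForm l r (fun _ => a) μ U v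

/-- The partial sum `∑_{j=1}^J β_j ⟨R, p z_j⟩ z_j` with `β_j = 1 / (1 + τ λ_j)`. -/
def subgridSum (l r a μ τ : ℝ) (f old U : ℝ → ℝ) (J : ℕ) (x : ℝ) : ℝ :=
  ∑ j ∈ Finset.Icc 1 J,
    (1 + τ * eigVal l r a μ j)⁻¹ *
      residual l r a μ τ f old U (fun y => weight l a μ y * eigFun l r a μ j y) *
        eigFun l r a μ j x

/-- `Uh 0, …, Uh N` (resolved scales) and `Ut 0, …, Ut N` (sub-grid scales) solve the spectral VMS
method for the velocity equal to `c n j` on the `j`-th element at time `t_n`. The sub-grid scales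
live on the intervals `(node i, node (i+1))`, the `i`-th of which lies in the element `i / deg`. -/
structure IsSpectralVMS {A B : ℝ} (G : Grid A B) (μ τ : ℝ) (N : ℕ) (c : ℕ → ℕ → ℝ)
    (f : ℕ → ℝ → ℝ) (u₀ : ℝ → ℝ) (Uh Ut : ℕ → ℝ → ℝ) : Prop where
  mem : ∀ n ≤ N, G.MemXh (Uh n)
  /-- `Uh 0` is the Lagrange interpolate of `u₀`. -/
  init : ∀ i, 0 < i → i < G.last → Uh 0 (G.node i) = u₀ (G.node i)
  sub_init : ∀ x ∈ Icc A B, Ut 0 x = u₀ x - Uh 0 x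
  sub_mem : ∀ n < N, ∀ i < G.last, MemH10 (G.node i) (G.node (i + 1)) (Ut (n + 1))
  /-- On each interval `Ut (n + 1)` is the sum of its spectral expansion (in `L²`). -/
  sub_series : ∀ n < N, ∀ i < G.last,
    Tendsto (fun J : ℕ => normL2 (G.node i) (G.node (i + 1)) (fun x => Ut (n + 1) x -
      subgridSum (G.node i) (G.node (i + 1)) (c (n + 1) (i / G.deg)) μ τ (f (n + 1))
        (fun y => Uh n y + Ut n y) (Uh (n + 1)) J x)) atTop (𝓝 0)
  eqn : ∀ n < N, ∀ v, G.MemXh v →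
    ip A B (Uh (n + 1)) v + τ * bForm A B (G.pcw (c (n + 1))) μ (Uh (n + 1)) v
        + ip A B (Ut (n + 1)) v + τ * bForm A B (G.pcw (c (n + 1))) μ (Ut (n + 1)) v
      = τ * ip A B (f (n + 1)) v + ip A B (Uh n) v + ip A B (Ut n) v

end SpectralVMS

end

/-! Error estimate. Let `Δ` be the square of the right-hand norm and `E = exp (3 L T)`; the constant
comes from two regimes. If `32 E² Δ ≤ μ`, the difference `e = u - U` is an Euler sequence with zero
initial value, driven by `(a_h - a) ∂U`. Testing with `e` and integrating the Lipschitz drift by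
parts gives `μ ‖e‖² ≲ Δ`; smallness of `Δ` lets diffusion absorb the part of the source that
contains `∂e`. Testing with the increment of `e` gives `μ³ ‖∂e‖² ≲ Δ`. Agmon's inequality combines
the two into `μ² |e|² ≲ Δ` (`abs_sub_le_of_close_velocities`). If `32 E² Δ > μ`, then `√μ ≲ √Δ`, and
it is enough that `|u|` and `|U|` are of order `μ^(-1/2)` (`sup_stability`). The velocity of `U` is
merely bounded, so Gronwall would cost a factor exponential in `1/μ`. Instead `u = Z + V`, where `Z`
solves the scheme with an extra damping `κ = K²/μ` that absorbs the drift and so has bounds without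
exponentials, while `V` has source `κ Z` and obeys a maximum principle (`le_of_resolvent`). The
damped scheme is solvable by Lax-Milgram (`exists_resolvent`). Nodal exactness. The functions `p
z_j` are eigenfunctions of the adjoint operator, biorthogonal to the `z_j`. Hence the spectral
series says exactly that the sub-grid equation holds when tested with every `p z_j`. Completeness of
the cosines extends this to all of `H¹₀` of the interval (`subgrid_equation`). In one dimension
nodal interpolation splits `H¹₀(A, B)` into `X_h` plus functions vanishing at the nodes, so the sum
of resolved and sub-grid parts satisfies the full Euler step. By uniqueness it equals `u^n`, and the
sub-grid part vanishes at the nodes (`nodal_exactness`). -/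

noncomputable section

namespace SpectralVMS

open scoped InnerProductSpace

/-! ### The Hilbert space `L²(l, r)` -/

/-- The class of `v` in `L²(l, r)`, and `0` if `v` is not square integrable. -/
def toL2 (l r : ℝ) (v : ℝ → ℝ) : Lp ℝ 2 (volume.restrict (Ioo l r)) :=
  open Classical in
  if h : MemLp v 2 (volume.restrict (Ioo l r)) then h.toLp v else 0

section L2
variable {l r : ℝ} {u v w : ℝ → ℝ}

theorem toL2_of_memLp (h : MemLp v 2 (volume.restrict (Ioo l r))) : toL2 l r v = h.toLp v := by
  simp [toL2, h]

theorem coeFn_toL2 (h : MemLp v 2 (volume.restrict (Ioo l r))) :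
    toL2 l r v =ᵐ[volume.restrict (Ioo l r)] v := by
  rw [toL2_of_memLp h]; exact h.coeFn_toLp

theorem toL2_congr (h : u =ᵐ[volume.restrict (Ioo l r)] v) : toL2 l r u = toL2 l r v := by
  by_cases hu : MemLp u 2 (volume.restrict (Ioo l r))
  · have hv := hu.ae_eq h
    rw [toL2_of_memLp hu, toL2_of_memLp hv]
    exact MemLp.toLp_congr _ _ h
  · have hv : ¬ MemLp v 2 (volume.restrict (Ioo l r)) := fun hv => hu (hv.ae_eq h.symm)
    simp [toL2, hu, hv]

theorem toL2_add (hu : MemLp u 2 (volume.restrict (Ioo l r)))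
    (hv : MemLp v 2 (volume.restrict (Ioo l r))) :
    toL2 l r (fun x => u x + v x) = toL2 l r u + toL2 l r v := by
  have h : MemLp (u + v) 2 (volume.restrict (Ioo l r)) := hu.add hv
  have : toL2 l r (fun x => u x + v x) = toL2 l r (u + v) := rfl
  rw [this, toL2_of_memLp hu, toL2_of_memLp hv, toL2_of_memLp h, MemLp.toLp_add]

theorem toL2_sub (hu : MemLp u 2 (volume.restrict (Ioo l r)))
    (hv : MemLp v 2 (volume.restrict (Ioo l r))) :
    toL2 l r (fun x => u x - v x) = toL2 l r u - toL2 l r v := by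
  have h : MemLp (u - v) 2 (volume.restrict (Ioo l r)) := hu.sub hv
  have : toL2 l r (fun x => u x - v x) = toL2 l r (u - v) := rfl
  rw [this, toL2_of_memLp hu, toL2_of_memLp hv, toL2_of_memLp h, MemLp.toLp_sub]

theorem toL2_const_mul (c : ℝ) (hu : MemLp u 2 (volume.restrict (Ioo l r))) :
    toL2 l r (fun x => c * u x) = c • toL2 l r u := by
  have h : MemLp (c • u) 2 (volume.restrict (Ioo l r)) := hu.const_smul c
  have : toL2 l r (fun x => c * u x) = toL2 l r (c • u) := rfl
  rw [this, toL2_of_memLp hu, toL2_of_memLp h, MemLp.toLp_const_smul]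

theorem toL2_coeFn (g : Lp ℝ 2 (volume.restrict (Ioo l r))) : toL2 l r g = g := by
  rw [toL2_of_memLp (Lp.memLp g)]; exact Lp.toLp_coeFn _ _

theorem ip_eq_setIntegral (h : l ≤ r) (u v : ℝ → ℝ) :
    ip l r u v = ∫ x in Ioo l r, u x * v x := by
  rw [ip, intervalIntegral.integral_of_le h, integral_Ioc_eq_integral_Ioo]

theorem inner_toL2 (h : l ≤ r) (hu : MemLp u 2 (volume.restrict (Ioo l r)))
    (hv : MemLp v 2 (volume.restrict (Ioo l r))) :
    ⟪toL2 l r u, toL2 l r v⟫_ℝ = ip l r u v := by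
  rw [ip_eq_setIntegral h, L2.inner_def]
  refine integral_congr_ae ?_
  filter_upwards [coeFn_toL2 hu, coeFn_toL2 hv] with x h1 h2
  rw [h1, h2]; simp [mul_comm]

theorem norm_toL2 (hv : MemLp v 2 (volume.restrict (Ioo l r))) : ‖toL2 l r v‖ = normL2 l r v := by
  rw [toL2_of_memLp hv, Lp.norm_toLp, normL2]

theorem memLp_of_continuousOn (hv : ContinuousOn v (Icc l r)) :
    MemLp v 2 (volume.restrict (Ioo l r)) := by
  have h1 : MemLp v 2 (volume.restrict (Icc l r)) := by
    obtain ⟨C, hC⟩ := isCompact_Icc.exists_bound_of_continuousOn hv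
    refine MemLp.of_bound (hv.aestronglyMeasurable measurableSet_Icc) C ?_
    exact (ae_restrict_iff' measurableSet_Icc).2 (Eventually.of_forall hC)
  exact h1.mono_measure (Measure.restrict_mono Ioo_subset_Icc_self le_rfl)

theorem memLp_bddMul {K : ℝ} (hw : AEStronglyMeasurable w (volume.restrict (Ioo l r)))
    (hK : ∀ᵐ x ∂(volume.restrict (Ioo l r)), |w x| ≤ K)
    (hu : MemLp u 2 (volume.restrict (Ioo l r))) :
    MemLp (fun x => w x * u x) 2 (volume.restrict (Ioo l r)) := by
  refine MemLp.of_le_mul (c := K) hu (hw.mul hu.1) ?_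
  filter_upwards [hK] with x hx
  rw [Real.norm_eq_abs, abs_mul, Real.norm_eq_abs]
  gcongr

theorem norm_toL2_bddMul_le {K : ℝ} (hw : AEStronglyMeasurable w (volume.restrict (Ioo l r)))
    (hK : ∀ᵐ x ∂(volume.restrict (Ioo l r)), |w x| ≤ K)
    (hu : MemLp u 2 (volume.restrict (Ioo l r))) :
    ‖toL2 l r (fun x => w x * u x)‖ ≤ K * ‖toL2 l r u‖ := by
  have h := memLp_bddMul hw hK hu
  apply Lp.norm_le_mul_norm_of_ae_le_mul
  filter_upwards [hK, coeFn_toL2 h, coeFn_toL2 hu] with x hx h1 h2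
  rw [h1, h2, Real.norm_eq_abs, abs_mul, Real.norm_eq_abs]
  gcongr

end L2

/-! ### The space `H¹₀(l, r)` -/

theorem absolutelyContinuousOnInterval_congr {l r : ℝ} {u v : ℝ → ℝ}
    (hu : AbsolutelyContinuousOnInterval u l r) (h : ∀ x ∈ uIcc l r, u x = v x) :
    AbsolutelyContinuousOnInterval v l r := by
  rw [absolutelyContinuousOnInterval_iff] at hu ⊢
  intro ε hε
  obtain ⟨δ, hδ, H⟩ := hu ε hε
  refine ⟨δ, hδ, fun E hE hl => ?_⟩
  convert! H E hE hl using 1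
  refine Finset.sum_congr rfl fun i hi => ?_
  rw [h _ (hE.1 i hi).1, h _ (hE.1 i hi).2]

/-- The same `δ` serves for both functions, since increments only shrink. The use is the truncation
`max (z - k) 0`. -/
theorem absolutelyContinuousOnInterval_of_abs_sub_le {l r : ℝ} {u v : ℝ → ℝ}
    (hu : AbsolutelyContinuousOnInterval u l r) (h : ∀ x y, |v x - v y| ≤ |u x - u y|) :
    AbsolutelyContinuousOnInterval v l r := by
  rw [absolutelyContinuousOnInterval_iff] at hu ⊢
  intro ε hε
  obtain ⟨δ, hδ, H⟩ := hu ε hε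
  refine ⟨δ, hδ, fun E hE hl => lt_of_le_of_lt ?_ (H E hE hl)⟩
  exact Finset.sum_le_sum fun i _ => h _ _

/-- On each piece `u` is the integral of `deriv u`, so on the union it is `u l` plus the integral of
a function integrable on `[l, r]`. The value of `deriv u` at the junction is irrelevant. -/
theorem absolutelyContinuousOnInterval_trans {l m r : ℝ} {u : ℝ → ℝ}
    (h₁ : AbsolutelyContinuousOnInterval u l m) (h₂ : AbsolutelyContinuousOnInterval u m r)
    (hlm : l ≤ m) (hmr : m ≤ r) : AbsolutelyContinuousOnInterval u l r := by
  have hi := h₁.intervalIntegrable_deriv.trans h₂.intervalIntegrable_deriv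
  have hac := hi.absolutelyContinuousOnInterval_intervalIntegral (c := l) (by simp)
  have hc : AbsolutelyContinuousOnInterval (fun _ : ℝ => u l) l r :=
    (LipschitzWith.const (u l)).lipschitzOnWith.absolutelyContinuousOnInterval
  refine absolutelyContinuousOnInterval_congr (hc.fun_add hac) fun x hx => ?_
  rw [uIcc_of_le (hlm.trans hmr)] at hx
  rcases le_total x m with hxm | hxm
  · have := (h₁.mono (c := l) (d := x) (by
      rw [uIcc_of_le hx.1, uIcc_of_le hlm]; exact Icc_subset_Icc le_rfl hxm)).integral_deriv_eq_sub
    rw [this]; ring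
  · have h3 := h₂.mono (c := m) (d := x) (by
      rw [uIcc_of_le hxm, uIcc_of_le hmr]; exact Icc_subset_Icc le_rfl hx.2)
    rw [← intervalIntegral.integral_add_adjacent_intervals h₁.intervalIntegrable_deriv
      h3.intervalIntegrable_deriv, h₁.integral_deriv_eq_sub, h3.integral_deriv_eq_sub]
    ring

theorem ae_differentiableAt_of_absolutelyContinuous {l r : ℝ} {u : ℝ → ℝ}
    (h : AbsolutelyContinuousOnInterval u l r) (hlr : l ≤ r) :
    ∀ᵐ x ∂(volume.restrict (Ioo l r)), DifferentiableAt ℝ u x := by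
  rw [ae_restrict_iff' measurableSet_Ioo]
  filter_upwards [h.boundedVariationOn.ae_differentiableAt_of_mem_uIcc] with x hx hx'
  exact hx (by rw [uIcc_of_le hlr]; exact Ioo_subset_Icc_self hx')

namespace MemH10
variable {l r : ℝ} {u v : ℝ → ℝ}

theorem continuousOn (h : MemH10 l r u) (hlr : l ≤ r) : ContinuousOn u (Icc l r) := by
  have := h.1.continuousOn
  rwa [uIcc_of_le hlr] at this

theorem memLp (h : MemH10 l r u) (hlr : l ≤ r) : MemLp u 2 (volume.restrict (Ioo l r)) :=
  memLp_of_continuousOn (h.continuousOn hlr)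

theorem deriv_add_ae (hu : AbsolutelyContinuousOnInterval u l r)
    (hv : AbsolutelyContinuousOnInterval v l r) (hlr : l ≤ r) :
    deriv (fun x => u x + v x) =ᵐ[volume.restrict (Ioo l r)] fun x => deriv u x + deriv v x := by
  filter_upwards [ae_differentiableAt_of_absolutelyContinuous hu hlr,
    ae_differentiableAt_of_absolutelyContinuous hv hlr] with x h1 h2
  exact deriv_fun_add h1 h2

theorem deriv_sub_ae (hu : AbsolutelyContinuousOnInterval u l r)
    (hv : AbsolutelyContinuousOnInterval v l r) (hlr : l ≤ r) :
    deriv (fun x => u x - v x) =ᵐ[volume.restrict (Ioo l r)] fun x => deriv u x - deriv v x := by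
  filter_upwards [ae_differentiableAt_of_absolutelyContinuous hu hlr,
    ae_differentiableAt_of_absolutelyContinuous hv hlr] with x h1 h2
  exact deriv_fun_sub h1 h2

theorem add (hu : MemH10 l r u) (hv : MemH10 l r v) (hlr : l ≤ r) :
    MemH10 l r (fun x => u x + v x) :=
  ⟨hu.1.fun_add hv.1, (hu.2.1.add hv.2.1).ae_eq (deriv_add_ae hu.1 hv.1 hlr).symm,
    by simp [hu.2.2.1, hv.2.2.1], by simp [hu.2.2.2, hv.2.2.2]⟩

theorem sub (hu : MemH10 l r u) (hv : MemH10 l r v) (hlr : l ≤ r) :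
    MemH10 l r (fun x => u x - v x) :=
  ⟨hu.1.fun_sub hv.1, (hu.2.1.sub hv.2.1).ae_eq (deriv_sub_ae hu.1 hv.1 hlr).symm,
    by simp [hu.2.2.1, hv.2.2.1], by simp [hu.2.2.2, hv.2.2.2]⟩

theorem const_mul (c : ℝ) (hu : MemH10 l r u) : MemH10 l r (fun x => c * u x) := by
  refine ⟨hu.1.const_mul c, ?_, by simp [hu.2.2.1], by simp [hu.2.2.2]⟩
  have : deriv (fun x => c * u x) = fun x => c * deriv u x := by
    funext x; exact deriv_const_mul_field c
  rw [this]; exact hu.2.1.const_mul c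

theorem zero : MemH10 l r (fun _ => 0) := by
  refine ⟨(LipschitzWith.const (0 : ℝ)).lipschitzOnWith.absolutelyContinuousOnInterval, ?_,
    rfl, rfl⟩
  simp

theorem deriv_congr_ae (h : ∀ x ∈ Icc l r, u x = v x) :
    deriv u =ᵐ[volume.restrict (Ioo l r)] deriv v := by
  refine (ae_restrict_iff' measurableSet_Ioo).2 (Eventually.of_forall fun x hx => ?_)
  refine Filter.EventuallyEq.deriv_eq ?_
  filter_upwards [Ioo_mem_nhds hx.1 hx.2] with y hy using h y (Ioo_subset_Icc_self hy)

theorem congr (hu : MemH10 l r u) (hlr : l ≤ r) (h : ∀ x ∈ Icc l r, u x = v x) : MemH10 l r v :=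
  ⟨absolutelyContinuousOnInterval_congr hu.1 (by rwa [uIcc_of_le hlr]),
    hu.2.1.ae_eq (deriv_congr_ae h),
    by rw [← h l (left_mem_Icc.2 hlr), hu.2.2.1], by rw [← h r (right_mem_Icc.2 hlr), hu.2.2.2]⟩

theorem toL2_deriv_sub (hu : MemH10 l r u) (hv : MemH10 l r v) (hlr : l ≤ r) :
    toL2 l r (deriv fun x => u x - v x) = toL2 l r (deriv u) - toL2 l r (deriv v) := by
  rw [toL2_congr (deriv_sub_ae hu.1 hv.1 hlr), toL2_sub hu.2.1 hv.2.1]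

/-- Agmon's inequality. -/
theorem sq_le (hu : MemH10 l r u) (hlr : l ≤ r) {x : ℝ} (hx : x ∈ Icc l r) :
    u x ^ 2 ≤ 2 * ‖toL2 l r u‖ * ‖toL2 l r (deriv u)‖ := by
  have hm := hu.1.mono (c := l) (d := x) (by
      rw [uIcc_of_le hx.1, uIcc_of_le hlr]; exact Icc_subset_Icc le_rfl hx.2)
  -- As `u l = 0`, the product rule yields `u x ^ 2 = 2 ∫ u u'` over `[l, x]`; Cauchy-Schwarz
  -- finishes.
  have h1 := hm.integral_deriv_mul_eq_sub hm
  rw [hu.2.2.1] at h1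
  have h2 : ∫ y in l..x, deriv u y * u y + u y * deriv u y
      = 2 * ∫ y in l..x, u y * deriv u y := by
    rw [← intervalIntegral.integral_const_mul]
    refine intervalIntegral.integral_congr fun y _ => ?_
    ring
  have hL := hu.memLp hlr
  have hint : Integrable (fun y => u y * deriv u y) (volume.restrict (Ioo l r)) :=
    hL.integrable_mul hu.2.1
  have h3 : ∫ y in l..x, u y * deriv u y ≤ ∫ y in Ioo l r, |u y| * |deriv u y| := by
    rw [intervalIntegral.integral_of_le hx.1, integral_Ioc_eq_integral_Ioo]
    have hi : Integrable (fun y => |u y| * |deriv u y|) (volume.restrict (Ioo l r)) := by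
      simpa only [abs_mul] using hint.abs
    have hs : Ioo l x ⊆ Ioo l r := Ioo_subset_Ioo le_rfl hx.2
    refine (integral_mono (hint.mono_measure (Measure.restrict_mono hs le_rfl))
      (hi.mono_measure (Measure.restrict_mono hs le_rfl)) fun y => ?_).trans
      (setIntegral_mono_set hi (Eventually.of_forall fun y => by positivity) hs.eventuallyLE)
    simpa only [abs_mul] using le_abs_self (u y * deriv u y)
  have hA : MemLp (fun y => |u y|) 2 (volume.restrict (Ioo l r)) := hL.abs
  have hB : MemLp (fun y => |deriv u y|) 2 (volume.restrict (Ioo l r)) := hu.2.1.abs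
  have h4 : ∫ y in Ioo l r, |u y| * |deriv u y| ≤ ‖toL2 l r u‖ * ‖toL2 l r (deriv u)‖ := by
    rw [← ip_eq_setIntegral hlr, ← inner_toL2 hlr hA hB]
    refine (real_inner_le_norm _ _).trans (le_of_eq ?_)
    rw [norm_toL2 hA, norm_toL2 hB, norm_toL2 hL, norm_toL2 hu.2.1]
    simp only [normL2]
    congr 2 <;> exact eLpNorm_congr_norm_ae (by simp)
  nlinarith

end MemH10

/-! ### Energy estimates for implicit Euler sequences in a Hilbert space -/

section Abstract
variable {H : Type*} [NormedAddCommGroup H] [InnerProductSpace ℝ H]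

theorem half_sq_sub_le_inner_sub (x y : H) : (‖x‖ ^ 2 - ‖y‖ ^ 2) / 2 ≤ ⟪x, x - y⟫_ℝ := by
  have := norm_sub_sq_real x y
  have h2 : ⟪x, x - y⟫_ℝ = ‖x‖ ^ 2 - ⟪x, y⟫_ℝ := by
    rw [inner_sub_right, real_inner_self_eq_norm_sq]
  nlinarith [sq_nonneg ‖x - y‖]

/-- Complete the square in `d + (τ / 2) p`. In the gradient estimate the squared increment thus pays
for the drift and the source. -/
theorem neg_sq_le_sq_add_inner (τ : ℝ) (p d : H) :
    -(τ ^ 2 / 4 * ‖p‖ ^ 2) ≤ ⟪d, d⟫_ℝ + τ * ⟪p, d⟫_ℝ := by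
  have h := norm_add_sq_real d ((τ / 2) • p)
  rw [inner_smul_right, norm_smul, mul_pow, Real.norm_eq_abs, sq_abs, real_inner_comm] at h
  rw [real_inner_self_eq_norm_sq]
  nlinarith [sq_nonneg ‖d + (τ / 2) • p‖]

/-- The scheme tested with the increment `e (n + 1) - e n`: the gradient and damping terms
telescope, and `p`, which collects drift minus source, enters only through its norm. Nothing beyond
boundedness of the velocity is needed to control it, and no exponential appears. -/
theorem gradient_estimate {e g p : ℕ → H} {τ μ κ : ℝ} {N : ℕ} (hτ : 0 < τ) (hμ : 0 ≤ μ)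
    (hκ : 0 ≤ κ)
    (h : ∀ n < N, ⟪e (n + 1) - e n, e (n + 1) - e n⟫_ℝ + τ * (⟪p (n + 1), e (n + 1) - e n⟫_ℝ
      + μ * ⟪g (n + 1), g (n + 1) - g n⟫_ℝ + κ * ⟪e (n + 1), e (n + 1) - e n⟫_ℝ) = 0) :
    ∀ n ≤ N, μ * ‖g n‖ ^ 2 + κ * ‖e n‖ ^ 2
      ≤ μ * ‖g 0‖ ^ 2 + κ * ‖e 0‖ ^ 2 + τ / 2 * ∑ k ∈ Finset.range n, ‖p (k + 1)‖ ^ 2 := by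
  intro n
  induction n with
  | zero => intro _; simp
  | succ n ih =>
    intro hn
    have ih := ih (by omega)
    have h0 := h n (by omega)
    have h1 := half_sq_sub_le_inner_sub (g (n + 1)) (g n)
    have h2 := half_sq_sub_le_inner_sub (e (n + 1)) (e n)
    have h3 := neg_sq_le_sq_add_inner τ (p (n + 1)) (e (n + 1) - e n)
    rw [Finset.sum_range_succ]
    have h4 : μ * ((‖g (n + 1)‖ ^ 2 - ‖g n‖ ^ 2) / 2) + κ * ((‖e (n + 1)‖ ^ 2 - ‖e n‖ ^ 2) / 2)
        ≤ τ / 4 * ‖p (n + 1)‖ ^ 2 := by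
      have h5 := mul_le_mul_of_nonneg_left h1 hμ
      have h6 := mul_le_mul_of_nonneg_left h2 hκ
      refine le_of_mul_le_mul_left ?_ hτ
      have h7 := mul_le_mul_of_nonneg_left (add_le_add h5 h6) hτ.le
      nlinarith
    linarith

/-- Induction on `n`; `1 ≤ q` permits the old sums to be multiplied by `q` or by `q ^ n` for free.
-/
theorem discrete_gronwall {y s r : ℕ → ℝ} {q : ℝ} {N : ℕ} (hq : 1 ≤ q) (hs : ∀ n, 0 ≤ s n)
    (hr : ∀ n, 0 ≤ r n) (h : ∀ n < N, y (n + 1) + s (n + 1) ≤ q * (y n + r (n + 1))) :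
    ∀ n ≤ N, y n + ∑ k ∈ Finset.range n, s (k + 1)
      ≤ q ^ n * (y 0 + ∑ k ∈ Finset.range n, r (k + 1)) := by
  intro n
  induction n with
  | zero => intro _; simp
  | succ n ih =>
    intro hn
    have ih := ih (by omega)
    have h0 := h n (by omega)
    rw [Finset.sum_range_succ, Finset.sum_range_succ]
    have hS : 0 ≤ ∑ k ∈ Finset.range n, s (k + 1) := Finset.sum_nonneg fun k _ => hs _
    have hqn : 1 ≤ q ^ n := one_le_pow₀ hq
    have h1 : q * r (n + 1) ≤ q * (q ^ n * r (n + 1)) := by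
      have := hr (n + 1)
      gcongr
      nlinarith
    have h2 := mul_le_mul_of_nonneg_left ih (by linarith : 0 ≤ q)
    have h3 : ∑ k ∈ Finset.range n, s (k + 1) ≤ q * ∑ k ∈ Finset.range n, s (k + 1) := by
      nlinarith
    rw [pow_succ]
    nlinarith

/-- The scheme tested with `e (n + 1)`. Of the diffusion, `3/4` is reserved for the drift and the
remaining quarter, doubled, is the `μ / 2` of the conclusion. The growth rate `γ` is implicit in
time, hence the requirement that `τ γ` stay below a fixed fraction. -/
theorem energy_estimate {e g p : ℕ → H} {r : ℕ → ℝ} {τ μ γ L T : ℝ} {N : ℕ} (hτ : 0 < τ)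
    (hμ : 0 ≤ μ) (hγ : 0 ≤ γ) (hγL : γ ≤ L / 2) (hτγ : τ * γ ≤ 1 / 3) (hT : N * τ = T)
    (hr : ∀ n, 0 ≤ r n)
    (h : ∀ n < N, ⟪e (n + 1) - e n, e (n + 1)⟫_ℝ
      + τ * (⟪p (n + 1), e (n + 1)⟫_ℝ + μ * ⟪g (n + 1), g (n + 1)⟫_ℝ) = 0)
    (hp : ∀ n < N, -⟪p (n + 1), e (n + 1)⟫_ℝ
      ≤ γ * ‖e (n + 1)‖ ^ 2 + 3 / 4 * μ * ‖g (n + 1)‖ ^ 2 + r (n + 1)) :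
    ∀ n ≤ N, ‖e n‖ ^ 2 + μ / 2 * ∑ k ∈ Finset.range n, τ * ‖g (k + 1)‖ ^ 2
      ≤ Real.exp (3 * L * T) * (‖e 0‖ ^ 2 + 2 * ∑ k ∈ Finset.range n, τ * r (k + 1)) := by
  intro n hn
  have hL : 0 ≤ L := by linarith
  set q := Real.exp (3 * L * τ) with hq
  have hq1 : 1 ≤ q := Real.one_le_exp (by positivity)
  -- With `x = 2 τ γ ≤ 2/3` one has `(1 + 3 x)(1 - x) ≥ 1`, and `1 + 3 x ≤ q` because `γ ≤ L / 2`.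
  -- This is where the bound `1/3` and the exponent `3 L` come from.
  have hqx : 1 ≤ q * (1 - 2 * (τ * γ)) := by
    have h1 : 1 + 3 * (2 * (τ * γ)) ≤ q := by
      refine le_trans ?_ (Real.add_one_le_exp _)
      nlinarith
    have h2 : 0 ≤ τ * γ := by positivity
    nlinarith
  have key := discrete_gronwall (y := fun n => ‖e n‖ ^ 2) (s := fun n => τ * μ / 2 * ‖g n‖ ^ 2)
    (r := fun n => 2 * τ * r n) hq1 (fun n => by positivity)
    (fun n => by have := hr n; positivity) (N := N) (fun n hn => by
      have h0 := h n hn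
      have h1 := hp n hn
      have h2 := half_sq_sub_le_inner_sub (e (n + 1)) (e n)
      rw [real_inner_comm] at h2
      rw [real_inner_self_eq_norm_sq] at h0
      have h3 := mul_le_mul_of_nonneg_left h1 hτ.le
      have h4 : (1 - 2 * (τ * γ)) * ‖e (n + 1)‖ ^ 2 + τ * μ / 2 * ‖g (n + 1)‖ ^ 2
          ≤ ‖e n‖ ^ 2 + 2 * τ * r (n + 1) := by nlinarith
      have h5 := mul_le_mul_of_nonneg_left h4 (by linarith : 0 ≤ q)
      have h6 : 0 ≤ τ * μ / 2 * ‖g (n + 1)‖ ^ 2 := by positivity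
      have h7 : 0 ≤ ‖e (n + 1)‖ ^ 2 := by positivity
      nlinarith) n hn
  have hqn : q ^ n ≤ Real.exp (3 * L * T) := by
    rw [hq, ← Real.exp_nat_mul, ← hT]
    refine Real.exp_le_exp.2 ?_
    have : (n : ℝ) ≤ N := by exact_mod_cast hn
    have h2 : 0 ≤ 3 * L * τ := by positivity
    nlinarith
  have e1 : μ / 2 * ∑ k ∈ Finset.range n, τ * ‖g (k + 1)‖ ^ 2
      = ∑ k ∈ Finset.range n, τ * μ / 2 * ‖g (k + 1)‖ ^ 2 := by
    rw [Finset.mul_sum]; exact Finset.sum_congr rfl fun _ _ => by ring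
  have e2 : 2 * ∑ k ∈ Finset.range n, τ * r (k + 1)
      = ∑ k ∈ Finset.range n, 2 * τ * r (k + 1) := by
    rw [Finset.mul_sum]; exact Finset.sum_congr rfl fun _ _ => by ring
  rw [e1, e2]
  refine key.trans (mul_le_mul_of_nonneg_right hqn ?_)
  have : 0 ≤ ∑ k ∈ Finset.range n, 2 * τ * r (k + 1) :=
    Finset.sum_nonneg fun k _ => by have := hr (k + 1); positivity
  positivity

/-- The damping `κ` absorbs the drift and the source, so no Gronwall argument is needed and the
bound does not grow exponentially in time. -/
theorem damped_energy_estimate {e g p F : ℕ → H} {τ μ κ : ℝ} {N : ℕ} (hτ : 0 < τ)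
    (hκ : 0 < κ)
    (h : ∀ n < N, ⟪e (n + 1) - e n, e (n + 1)⟫_ℝ + τ * (⟪p (n + 1), e (n + 1)⟫_ℝ
      + μ * ⟪g (n + 1), g (n + 1)⟫_ℝ + κ * ⟪e (n + 1), e (n + 1)⟫_ℝ) = 0)
    (hp : ∀ n < N, -⟪p (n + 1), e (n + 1)⟫_ℝ
      ≤ μ / 2 * ‖g (n + 1)‖ ^ 2 + κ / 2 * ‖e (n + 1)‖ ^ 2 + ‖F (n + 1)‖ * ‖e (n + 1)‖) :
    ∀ n ≤ N, ‖e n‖ ^ 2 + (μ * ∑ k ∈ Finset.range n, τ * ‖g (k + 1)‖ ^ 2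
        + κ / 2 * ∑ k ∈ Finset.range n, τ * ‖e (k + 1)‖ ^ 2)
      ≤ ‖e 0‖ ^ 2 + 2 / κ * ∑ k ∈ Finset.range n, τ * ‖F (k + 1)‖ ^ 2 := by
  intro n
  induction n with
  | zero => intro _; simp
  | succ n ih =>
    intro hn
    have ih := ih (by omega)
    have h0 := h n (by omega)
    have h1 := mul_le_mul_of_nonneg_left (hp n (by omega)) hτ.le
    have h2 := half_sq_sub_le_inner_sub (e (n + 1)) (e n)
    rw [real_inner_comm] at h2
    rw [real_inner_self_eq_norm_sq, real_inner_self_eq_norm_sq] at h0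
    simp only [Finset.sum_range_succ]
    -- Half of the damping goes to the drift and a quarter to the source; the last quarter, doubled,
    -- is the `κ / 2` on the left of the conclusion.
    have h3 : ‖F (n + 1)‖ * ‖e (n + 1)‖ ≤ κ / 4 * ‖e (n + 1)‖ ^ 2 + 1 / κ * ‖F (n + 1)‖ ^ 2 := by
      have : 0 ≤ 1 / κ * (κ / 2 * ‖e (n + 1)‖ - ‖F (n + 1)‖) ^ 2 := by positivity
      have e1 : 1 / κ * (κ / 2 * ‖e (n + 1)‖ - ‖F (n + 1)‖) ^ 2
        = κ / 4 * ‖e (n + 1)‖ ^ 2 + 1 / κ * ‖F (n + 1)‖ ^ 2 - ‖F (n + 1)‖ * ‖e (n + 1)‖ := by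
        field_simp; ring
      linarith
    have h4 := mul_le_mul_of_nonneg_left h3 hτ.le
    have e2 : 2 / κ = 2 * (1 / κ) := by ring
    rw [e2] at ih ⊢
    nlinarith

end Abstract

/-! ### Drift terms -/

section Drift
variable {l r : ℝ} {w z v : ℝ → ℝ}

/-- Integration by parts of the advection term for a Lipschitz velocity. -/
theorem abs_inner_drift_le {L : ℝ≥0} (hlr : l ≤ r) (hw : LipschitzOnWith L w (Ioo l r))
    (hz : MemH10 l r z) :
    |ip l r (fun x => w x * deriv z x) z| ≤ L / 2 * ‖toL2 l r z‖ ^ 2 := by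
  -- The extension is absolutely continuous up to the end points, with a derivative bounded by `L`
  -- everywhere; then `∫ w z z' = -½ ∫ w' z²`, as `z` vanishes at both ends.
  obtain ⟨w', hw', hEq⟩ := hw.extend_real
  have hwac : AbsolutelyContinuousOnInterval w' l r :=
    hw'.lipschitzOnWith.absolutelyContinuousOnInterval
  have hzz := hz.1.fun_mul hz.1
  have h1 := hwac.integral_deriv_mul_eq_sub hzz
  rw [hz.2.2.1, hz.2.2.2] at h1
  have hL2 := hz.memLp hlr
  have hb : ∀ x, |deriv w' x| ≤ L := fun x => by
    simpa using norm_deriv_le_of_lipschitz hw' (x₀ := x)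
  have hm1 : MemLp (fun x => deriv w' x * z x) 2 (volume.restrict (Ioo l r)) :=
    memLp_bddMul (measurable_deriv w').aestronglyMeasurable (Eventually.of_forall hb) hL2
  have hwb : ∃ C, ∀ x ∈ Icc l r, ‖w' x‖ ≤ C :=
    isCompact_Icc.exists_bound_of_continuousOn hw'.continuous.continuousOn
  obtain ⟨C, hC⟩ := hwb
  have hm2 : MemLp (fun x => w' x * deriv z x) 2 (volume.restrict (Ioo l r)) :=
    memLp_bddMul (K := C) hw'.continuous.aestronglyMeasurable
      ((ae_restrict_iff' measurableSet_Ioo).2 (Eventually.of_forall fun x hx =>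
        hC x (Ioo_subset_Icc_self hx))) hz.2.1
  have h2 : ∫ x in l..r, deriv w' x * (z x * z x) + w' x * deriv (fun y => z y * z y) x
      = ip l r (fun x => deriv w' x * z x) z + 2 * ip l r (fun x => w' x * deriv z x) z := by
    rw [intervalIntegral.integral_of_le hlr, integral_Ioc_eq_integral_Ioo,
      ip_eq_setIntegral hlr, ip_eq_setIntegral hlr, ← integral_const_mul, ← integral_add]
    · refine integral_congr_ae ?_
      filter_upwards [ae_differentiableAt_of_absolutelyContinuous hz.1 hlr] with x hx
      rw [deriv_fun_mul hx hx]; ring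
    · exact hm1.integrable_mul hL2
    · exact (hm2.integrable_mul hL2).const_mul 2
  have h3 : ip l r (fun x => w x * deriv z x) z = ip l r (fun x => w' x * deriv z x) z := by
    rw [ip_eq_setIntegral hlr, ip_eq_setIntegral hlr]
    exact setIntegral_congr_fun measurableSet_Ioo fun x hx => by simp only [hEq hx]
  have h4 : |ip l r (fun x => deriv w' x * z x) z| ≤ L * ‖toL2 l r z‖ ^ 2 := by
    rw [← inner_toL2 hlr hm1 hL2]
    refine (abs_real_inner_le_norm _ _).trans ?_
    have := norm_toL2_bddMul_le (measurable_deriv w').aestronglyMeasurable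
      (Eventually.of_forall hb) hL2
    nlinarith [norm_nonneg (toL2 l r z)]
  rw [h3]
  rw [h2] at h1
  rw [abs_le] at h4 ⊢
  constructor <;> linarith [h4.1, h4.2]

/-- Young's inequality `K a b ≤ c a² + d b²`. No integration by parts, so elementwise constant
velocities are admissible. -/
theorem abs_inner_bdd_drift_le {K c d : ℝ}
    (hw : AEStronglyMeasurable w (volume.restrict (Ioo l r)))
    (hK : ∀ᵐ x ∂(volume.restrict (Ioo l r)), |w x| ≤ K)
    (hz : MemLp (deriv z) 2 (volume.restrict (Ioo l r)))
    (hc : 0 < c) (hcd : K ^ 2 ≤ 4 * c * d)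
    (y : Lp ℝ 2 (volume.restrict (Ioo l r))) :
    |⟪toL2 l r (fun x => w x * deriv z x), y⟫_ℝ|
      ≤ c * ‖toL2 l r (deriv z)‖ ^ 2 + d * ‖y‖ ^ 2 := by
  refine (abs_real_inner_le_norm _ _).trans ?_
  have h1 := norm_toL2_bddMul_le hw hK hz
  have h2 := mul_le_mul_of_nonneg_right h1 (norm_nonneg y)
  refine h2.trans ?_
  set a := ‖toL2 l r (deriv z)‖
  set b := ‖y‖
  have : 0 ≤ (2 * c * a - K * b) ^ 2 := sq_nonneg _
  have hb : K ^ 2 * b ^ 2 ≤ 4 * c * d * b ^ 2 := by gcongr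
  refine le_of_mul_le_mul_left ?_ (by positivity : 0 < 4 * c)
  nlinarith

end Drift

/-! ### The maximum principle -/

section PosPart
variable {l r : ℝ} {z : ℝ → ℝ} {k : ℝ}

theorem deriv_posPart_sub (hz : ContinuousOn z (Icc l r)) {x : ℝ} (hx : x ∈ Ioo l r) :
    deriv (fun y => max (z y - k) 0) x = if k < z x then deriv z x else 0 := by
  split_ifs with h
  · have hc : ContinuousAt z x := hz.continuousAt (Icc_mem_nhds hx.1 hx.2)
    have h1 : (fun y => max (z y - k) 0) =ᶠ[𝓝 x] fun y => z y - k := by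
      filter_upwards [hc.eventually (lt_mem_nhds h)] with y hy
      exact max_eq_left (by linarith)
    rw [h1.deriv_eq, deriv_sub_const]
  -- Where `z x ≤ k` the truncation attains its minimum `0`. `deriv` then vanishes even at points of
  -- non-differentiability, where it is `0` by default.
  · refine IsLocalMin.deriv_eq_zero (Eventually.of_forall fun y => ?_)
    simp only [max_eq_right (by linarith : z x - k ≤ 0)]
    exact le_max_right _ _

theorem MemH10.posPart_sub (hz : MemH10 l r z) (hlr : l ≤ r) (hk : 0 ≤ k) :
    MemH10 l r (fun y => max (z y - k) 0) := by
  refine ⟨absolutelyContinuousOnInterval_of_abs_sub_le hz.1 fun x y => ?_, ?_, ?_, ?_⟩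
  · refine (abs_max_sub_max_le_abs _ _ _).trans (le_of_eq ?_)
    congr 1; ring
  · refine MemLp.of_le hz.2.1 (measurable_deriv _).aestronglyMeasurable ?_
    refine (ae_restrict_iff' measurableSet_Ioo).2 (Eventually.of_forall fun x hx => ?_)
    rw [deriv_posPart_sub (hz.continuousOn hlr) hx]
    split_ifs <;> simp
  · simp [hz.2.2.1, hk]
  · simp [hz.2.2.2, hk]

end PosPart

/-- Stampacchia truncation. To handle a drift that is only bounded, the damping term `τ κ z` with `κ
= K² / μ` is added to both sides. If `m = max z > k`, the new right-hand side is at most `k + τ κ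
m`, so the level `k'` below `m` can be used for truncation. The damping then absorbs the drift,
whatever the size of `τ`. -/
theorem le_of_resolvent {l r τ μ K k : ℝ} {w z g : ℝ → ℝ} (hlr : l ≤ r) (hτ : 0 < τ) (hμ : 0 < μ)
    (hK : 0 < K) (hk : 0 ≤ k) (hw : AEStronglyMeasurable w (volume.restrict (Ioo l r)))
    (hwK : ∀ᵐ x ∂(volume.restrict (Ioo l r)), |w x| ≤ K) (hz : MemH10 l r z)
    (hg : MemLp g 2 (volume.restrict (Ioo l r))) (hgk : ∀ x ∈ Ioo l r, g x ≤ k)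
    (h : ∀ v, MemH10 l r v → ⟪toL2 l r z, toL2 l r v⟫_ℝ
      + τ * (⟪toL2 l r (fun x => w x * deriv z x), toL2 l r v⟫_ℝ
        + μ * ⟪toL2 l r (deriv z), toL2 l r (deriv v)⟫_ℝ) = ⟪toL2 l r g, toL2 l r v⟫_ℝ) :
    ∀ x ∈ Icc l r, z x ≤ k := by
  have hcont := hz.continuousOn hlr
  obtain ⟨x₀, hx₀, hmax⟩ := isCompact_Icc.exists_isMaxOn (nonempty_Icc.2 hlr) hcont
  intro x hx
  refine le_trans (hmax hx) ?_
  by_contra! hlt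
  set m := z x₀ with hm
  set κ := K ^ 2 / μ with hκdef
  have hκ : 0 < κ := by positivity
  -- A convex combination of `k` and `m` with positive weight on `k`, hence strictly below `m`.
  set k' := (k + τ * κ * m) / (1 + τ * κ) with hk'
  have hD : 0 < 1 + τ * κ := by positivity
  have hkk : k + τ * κ * m = (1 + τ * κ) * k' := by rw [hk']; field_simp
  have hk'm : k' < m := by
    rw [hk', div_lt_iff₀ hD]; nlinarith
  have hm0 : 0 < m := lt_of_le_of_lt hk hlt
  have hk'0 : 0 ≤ k' := by rw [hk']; positivity
  set v : ℝ → ℝ := fun y => max (z y - k') 0 with hv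
  have hvH : MemH10 l r v := hz.posPart_sub hlr hk'0
  have hz2 := hz.memLp hlr
  have hv2 := hvH.memLp hlr
  have hv0 : ∀ y, 0 ≤ v y := fun y => le_max_right _ _
  have hint : Integrable v (volume.restrict (Ioo l r)) :=
    hv2.integrable (by norm_num)
  set I := ∫ y in Ioo l r, v y with hI
  have hdv := fun {y : ℝ} (hy : y ∈ Ioo l r) => deriv_posPart_sub (k := k') hcont hy
  -- the individual terms of the tested equation
  have e1 : ⟪toL2 l r z, toL2 l r v⟫_ℝ = ‖toL2 l r v‖ ^ 2 + k' * I := by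
    rw [← real_inner_self_eq_norm_sq, inner_toL2 hlr hz2 hv2, inner_toL2 hlr hv2 hv2,
      ip_eq_setIntegral hlr, ip_eq_setIntegral hlr, hI, ← integral_const_mul, ← integral_add]
    · refine integral_congr_ae (Eventually.of_forall fun y => ?_)
      simp only [hv]
      rcases le_total (z y - k') 0 with h0 | h0
      · rw [max_eq_right h0]; ring
      · rw [max_eq_left h0]; ring
    · exact hv2.integrable_mul hv2
    · exact hint.const_mul _
  have e2 : ⟪toL2 l r (fun x => w x * deriv z x), toL2 l r v⟫_ℝ
      = ⟪toL2 l r (fun x => w x * deriv v x), toL2 l r v⟫_ℝ := by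
    rw [inner_toL2 hlr (memLp_bddMul hw hwK hz.2.1) hv2,
      inner_toL2 hlr (memLp_bddMul hw hwK hvH.2.1) hv2, ip_eq_setIntegral hlr,
      ip_eq_setIntegral hlr]
    refine setIntegral_congr_fun measurableSet_Ioo fun y hy => ?_
    simp only [hv]
    rw [hdv hy]
    split_ifs with hc
    · rfl
    · rw [max_eq_right (by linarith)]; ring
  have e3 : ⟪toL2 l r (deriv z), toL2 l r (deriv v)⟫_ℝ = ‖toL2 l r (deriv v)‖ ^ 2 := by
    rw [← real_inner_self_eq_norm_sq, inner_toL2 hlr hz.2.1 hvH.2.1,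
      inner_toL2 hlr hvH.2.1 hvH.2.1, ip_eq_setIntegral hlr, ip_eq_setIntegral hlr]
    refine setIntegral_congr_fun measurableSet_Ioo fun y hy => ?_
    simp only [hv]
    rw [hdv hy]
    split_ifs with hc
    · rfl
    · ring
  have e4 : ⟪toL2 l r g, toL2 l r v⟫_ℝ ≤ k * I := by
    rw [inner_toL2 hlr hg hv2, ip_eq_setIntegral hlr, hI, ← integral_const_mul]
    exact setIntegral_mono_on (hg.integrable_mul hv2) (hint.const_mul _) measurableSet_Ioo
      fun y hy => mul_le_mul_of_nonneg_right (hgk y hy) (hv0 y)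
  have e5 : ⟪toL2 l r z, toL2 l r v⟫_ℝ ≤ m * I := by
    rw [inner_toL2 hlr hz2 hv2, ip_eq_setIntegral hlr, hI, ← integral_const_mul]
    exact setIntegral_mono_on (hz2.integrable_mul hv2) (hint.const_mul _) measurableSet_Ioo
      fun y hy => mul_le_mul_of_nonneg_right (hmax (Ioo_subset_Icc_self hy)) (hv0 y)
  have e6 := abs_inner_bdd_drift_le hw hwK hvH.2.1 (c := μ / 2) (d := κ / 2) (by positivity)
    (by rw [hκdef]; field_simp; norm_num) (toL2 l r v)
  have heq := h v hvH
  rw [e2, e3] at heq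
  have e7 := (abs_le.1 e6).1
  -- The choice of `k'` makes all terms in `I` cancel; only quadratic terms in `v` and `deriv v`
  -- survive.
  have e8 : k * I + τ * κ * (m * I) = (1 + τ * κ) * (k' * I) := by
    linear_combination I * hkk
  have hzero : ‖toL2 l r v‖ ^ 2 ≤ 0 := by
    have h1 := mul_le_mul_of_nonneg_left e5 (by positivity : 0 ≤ τ * κ)
    have h2 := mul_le_mul_of_nonneg_left e7 hτ.le
    have h3 : 0 ≤ τ * (μ / 2 * ‖toL2 l r (deriv v)‖ ^ 2) := by positivity
    have h4 : 0 ≤ τ * (κ / 2 * ‖toL2 l r v‖ ^ 2) := by positivity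
    have h5 : (1 + τ * κ) * ⟪toL2 l r z, toL2 l r v⟫_ℝ
      = (1 + τ * κ) * ‖toL2 l r v‖ ^ 2 + (1 + τ * κ) * (k' * I) := by rw [e1]; ring
    nlinarith
  have hn : ‖toL2 l r v‖ = 0 := by nlinarith [norm_nonneg (toL2 l r v)]
  -- Agmon turns `‖v‖ = 0` into `v x₀ = 0`, whereas `v x₀ = m - k' > 0`.
  have hA := hvH.sq_le hlr hx₀
  rw [hn] at hA
  have hvx : v x₀ = m - k' := max_eq_left (by linarith)
  rw [hvx] at hA
  nlinarith

theorem abs_le_of_resolvent {l r τ μ K k : ℝ} {w z g : ℝ → ℝ} (hlr : l ≤ r) (hτ : 0 < τ)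
    (hμ : 0 < μ) (hK : 0 < K) (hk : 0 ≤ k)
    (hw : AEStronglyMeasurable w (volume.restrict (Ioo l r)))
    (hwK : ∀ᵐ x ∂(volume.restrict (Ioo l r)), |w x| ≤ K) (hz : MemH10 l r z)
    (hg : MemLp g 2 (volume.restrict (Ioo l r))) (hgk : ∀ x ∈ Ioo l r, |g x| ≤ k)
    (h : ∀ v, MemH10 l r v → ⟪toL2 l r z, toL2 l r v⟫_ℝ
      + τ * (⟪toL2 l r (fun x => w x * deriv z x), toL2 l r v⟫_ℝ
        + μ * ⟪toL2 l r (deriv z), toL2 l r (deriv v)⟫_ℝ) = ⟪toL2 l r g, toL2 l r v⟫_ℝ) :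
    ∀ x ∈ Icc l r, |z x| ≤ k := by
  have h1 := le_of_resolvent hlr hτ hμ hK hk hw hwK hz hg (fun x hx => (le_abs_self _).trans
    (hgk x hx)) h
  have hd : deriv (fun x => -1 * z x) = fun x => -1 * deriv z x := by
    funext x; exact deriv_const_mul_field _
  have h2 := le_of_resolvent hlr hτ hμ hK hk hw hwK (hz.const_mul (-1)) (hg.const_mul (-1))
    (fun x hx => by have := neg_abs_le (g x); have := hgk x hx; linarith) (fun v hv => by
      have e : (fun x => w x * deriv (fun x => -1 * z x) x)
          = fun x => -1 * (w x * deriv z x) := by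
        rw [hd]; funext x; ring
      rw [e, hd, toL2_const_mul _ (hz.memLp hlr), toL2_const_mul _ (memLp_bddMul hw hwK hz.2.1),
        toL2_const_mul _ hz.2.1, toL2_const_mul _ hg]
      simp only [inner_smul_left]
      have := h v hv
      simp only [conj_trivial]
      linarith)
  intro x hx
  have a1 := h1 x hx
  have a2 := h2 x hx
  exact abs_le.2 ⟨by linarith, a1⟩

/-! ### Solvability of one implicit step -/

section Existence
variable {l r : ℝ}

theorem integrableOn_of_Lp (g : Lp ℝ 2 (volume.restrict (Ioo l r))) :
    Integrable g (volume.restrict (Ioo l r)) :=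
  (Lp.memLp g).integrable (by norm_num)

theorem intervalIntegrable_of_Lp (g : Lp ℝ 2 (volume.restrict (Ioo l r))) (hlr : l ≤ r) :
    IntervalIntegrable g volume l r := by
  rw [intervalIntegrable_iff_integrableOn_Ioo_of_le hlr]
  exact integrableOn_of_Lp g

theorem memLp_primitive (g : Lp ℝ 2 (volume.restrict (Ioo l r))) (hlr : l ≤ r) :
    AbsolutelyContinuousOnInterval (fun x => ∫ y in l..x, g y) l r :=
  (intervalIntegrable_of_Lp g hlr).absolutelyContinuousOnInterval_intervalIntegral (by simp)

theorem primitive_continuousOn (g : Lp ℝ 2 (volume.restrict (Ioo l r))) (hlr : l ≤ r) :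
    ContinuousOn (fun x => ∫ y in l..x, g y) (Icc l r) := by
  have := (memLp_primitive g hlr).continuousOn
  rwa [uIcc_of_le hlr] at this

theorem abs_primitive_le (g : Lp ℝ 2 (volume.restrict (Ioo l r))) (hlr : l ≤ r) {x : ℝ}
    (hx : x ∈ Icc l r) :
    |∫ y in l..x, g y| ≤ ‖toL2 l r (fun _ => 1)‖ * ‖g‖ := by
  have h12 : MemLp (fun _ : ℝ => (1 : ℝ)) 2 (volume.restrict (Ioo l r)) :=
    memLp_of_continuousOn continuousOn_const
  have hg := Lp.memLp g
  have hga : MemLp (fun y => |g y|) 2 (volume.restrict (Ioo l r)) := hg.abs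
  have h1 : |∫ y in l..x, g y| ≤ ∫ y in Ioo l r, |g y| := by
    refine (intervalIntegral.abs_integral_le_integral_abs hx.1).trans ?_
    rw [intervalIntegral.integral_of_le hx.1, integral_Ioc_eq_integral_Ioo]
    exact setIntegral_mono_set (integrableOn_of_Lp g).abs
      (Eventually.of_forall fun y => abs_nonneg _) (Ioo_subset_Ioo le_rfl hx.2).eventuallyLE
  have h2 : ∫ y in Ioo l r, |g y| = ⟪toL2 l r (fun _ => 1), toL2 l r (fun y => |g y|)⟫_ℝ := by
    rw [inner_toL2 hlr h12 hga, ip_eq_setIntegral hlr]; simp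
  rw [h2] at h1
  refine h1.trans ((real_inner_le_norm _ _).trans (le_of_eq ?_))
  have hgn : ‖g‖ = normL2 l r g := by rw [← norm_toL2 hg, toL2_coeFn]
  congr 1
  rw [norm_toL2 hga, hgn, normL2, normL2]
  congr 1; exact eLpNorm_congr_norm_ae (by simp)

/-- The primitive vanishing at `l`, as an operator on `L²(l, r)`. -/
def primitiveL (l r : ℝ) (hlr : l ≤ r) :
    Lp ℝ 2 (volume.restrict (Ioo l r)) →L[ℝ] Lp ℝ 2 (volume.restrict (Ioo l r)) :=
  LinearMap.mkContinuous
    { toFun := fun g => toL2 l r (fun x => ∫ y in l..x, g y)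
      map_add' := fun f g => by
        rw [← toL2_add (memLp_of_continuousOn (primitive_continuousOn f hlr))
          (memLp_of_continuousOn (primitive_continuousOn g hlr))]
        refine toL2_congr ((ae_restrict_iff' measurableSet_Ioo).2
          (Eventually.of_forall fun x hx => ?_))
        have hs : Ioo l x ⊆ Ioo l r := Ioo_subset_Ioo le_rfl hx.2.le
        simp only [intervalIntegral.integral_of_le hx.1.le, integral_Ioc_eq_integral_Ioo]
        rw [← integral_add ((integrableOn_of_Lp f).mono_measure (Measure.restrict_mono hs le_rfl))
          ((integrableOn_of_Lp g).mono_measure (Measure.restrict_mono hs le_rfl))]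
        refine integral_congr_ae ?_
        exact ae_restrict_of_ae_restrict_of_subset hs (Lp.coeFn_add f g)
      map_smul' := fun c g => by
        rw [RingHom.id_apply,
          ← toL2_const_mul c (memLp_of_continuousOn (primitive_continuousOn g hlr))]
        refine toL2_congr ((ae_restrict_iff' measurableSet_Ioo).2
          (Eventually.of_forall fun x hx => ?_))
        have hs : Ioo l x ⊆ Ioo l r := Ioo_subset_Ioo le_rfl hx.2.le
        simp only [intervalIntegral.integral_of_le hx.1.le, integral_Ioc_eq_integral_Ioo]
        rw [← integral_const_mul]
        refine integral_congr_ae ?_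
        exact ae_restrict_of_ae_restrict_of_subset hs (Lp.coeFn_smul c g) }
    -- One factor comes from Cauchy-Schwarz in the pointwise bound, the other from taking the `L²`
    -- norm of a constant.
    (‖toL2 l r (fun _ => 1)‖ * ‖toL2 l r (fun _ => 1)‖) (fun g => by
      have h12 : MemLp (fun _ : ℝ => (1 : ℝ)) 2 (volume.restrict (Ioo l r)) :=
        memLp_of_continuousOn continuousOn_const
      have hp := memLp_of_continuousOn (primitive_continuousOn g hlr)
      rw [mul_right_comm]
      refine Lp.norm_le_mul_norm_of_ae_le_mul ?_
      filter_upwards [coeFn_toL2 hp, coeFn_toL2 h12, ae_restrict_mem measurableSet_Ioo]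
        with x h1 h2 hx
      simp only [LinearMap.coe_mk, AddHom.coe_mk]
      rw [h1, h2, Real.norm_eq_abs, norm_one, mul_one]
      exact abs_primitive_le g hlr (Ioo_subset_Icc_self hx))

/-- Multiplication by a bounded function, as an operator on `L²(l, r)`. -/
def bddMulL {w : ℝ → ℝ} {K : ℝ} (hw : AEStronglyMeasurable w (volume.restrict (Ioo l r)))
    (hK : ∀ᵐ x ∂(volume.restrict (Ioo l r)), |w x| ≤ K) :
    Lp ℝ 2 (volume.restrict (Ioo l r)) →L[ℝ] Lp ℝ 2 (volume.restrict (Ioo l r)) :=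
  LinearMap.mkContinuous
    { toFun := fun g => toL2 l r (fun x => w x * g x)
      map_add' := fun f g => by
        rw [← toL2_add (memLp_bddMul hw hK (Lp.memLp f)) (memLp_bddMul hw hK (Lp.memLp g))]
        refine toL2_congr ?_
        filter_upwards [Lp.coeFn_add f g] with x hx
        rw [hx, Pi.add_apply]; ring
      map_smul' := fun c g => by
        rw [RingHom.id_apply, ← toL2_const_mul c (memLp_bddMul hw hK (Lp.memLp g))]
        refine toL2_congr ?_
        filter_upwards [Lp.coeFn_smul c g] with x hx
        rw [hx, Pi.smul_apply, smul_eq_mul]; ring }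
    K (fun g => by
      have := norm_toL2_bddMul_le hw hK (Lp.memLp g)
      rwa [toL2_coeFn] at this)

/-- Lax-Milgram with the derivative as unknown. An element of `H¹₀` is the primitive of an `L²`
function of mean zero, so the problem lives on the orthogonal complement of the constants, a Hilbert
space already at hand. The damping `κ` makes the form coercive for every `τ`. -/
theorem exists_resolvent {τ μ K κ : ℝ} {w : ℝ → ℝ} (hlr : l ≤ r) (hτ : 0 < τ) (hμ : 0 < μ)
    (hκ : K ^ 2 ≤ 2 * μ * κ) (hw : AEStronglyMeasurable w (volume.restrict (Ioo l r)))
    (hwK : ∀ᵐ x ∂(volume.restrict (Ioo l r)), |w x| ≤ K)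
    (G : Lp ℝ 2 (volume.restrict (Ioo l r))) :
    ∃ z, MemH10 l r z ∧ ∀ v, MemH10 l r v → ⟪toL2 l r z, toL2 l r v⟫_ℝ
      + τ * (⟪toL2 l r (fun x => w x * deriv z x), toL2 l r v⟫_ℝ
        + μ * ⟪toL2 l r (deriv z), toL2 l r (deriv v)⟫_ℝ + κ * ⟪toL2 l r z, toL2 l r v⟫_ℝ)
        = ⟪G, toL2 l r v⟫_ℝ := by
  have h12 : MemLp (fun _ : ℝ => (1 : ℝ)) 2 (volume.restrict (Ioo l r)) :=
    memLp_of_continuousOn continuousOn_const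
  let V : Submodule ℝ (Lp ℝ 2 (volume.restrict (Ioo l r))) := (ℝ ∙ toL2 l r (fun _ => 1))ᗮ
  let J := primitiveL l r hlr
  let M := bddMulL hw hwK
  let ι : V →L[ℝ] Lp ℝ 2 (volume.restrict (Ioo l r)) := V.subtypeL
  let S : Lp ℝ 2 (volume.restrict (Ioo l r)) →L[ℝ] Lp ℝ 2 (volume.restrict (Ioo l r)) :=
    (1 + τ * κ) • J + τ • M
  let B : V →L[ℝ] V →L[ℝ] ℝ :=
    (innerSL ℝ).bilinearComp (S.comp ι) (J.comp ι) + (τ * μ) • (innerSL ℝ).bilinearComp ι ι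
  have hB : ∀ g h : V, B g h = (1 + τ * κ) * ⟪J g, J h⟫_ℝ + τ * ⟪M g, J h⟫_ℝ
      + τ * μ * ⟪(g : Lp ℝ 2 (volume.restrict (Ioo l r))), h⟫_ℝ := by
    intro g h
    simp [B, S, ι]
  have hcoer : IsCoercive B := by
    refine ⟨τ * μ / 2, by positivity, fun g => ?_⟩
    rw [hB]
    have h1 : ‖M g‖ ≤ K * ‖(g : Lp ℝ 2 (volume.restrict (Ioo l r)))‖ := by
      have := norm_toL2_bddMul_le hw hwK (Lp.memLp (g : Lp ℝ 2 (volume.restrict (Ioo l r))))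
      rwa [toL2_coeFn] at this
    have h2 := (abs_le.1 (abs_real_inner_le_norm (M g) (J g))).1
    rw [real_inner_self_eq_norm_sq, real_inner_self_eq_norm_sq]
    have h3 := mul_le_mul_of_nonneg_right h1 (norm_nonneg (J g))
    have h4 : ‖g‖ = ‖(g : Lp ℝ 2 (volume.restrict (Ioo l r)))‖ := rfl
    rw [h4]
    set a := ‖(g : Lp ℝ 2 (volume.restrict (Ioo l r)))‖
    set b := ‖J g‖
    -- Half of the diffusion and the whole damping absorb the drift; the other half is the
    -- coercivity constant `τ * μ / 2`.
    have h5 : K * a * b ≤ μ / 2 * a ^ 2 + κ * b ^ 2 := by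
      have : 0 ≤ (μ * a - K * b) ^ 2 := sq_nonneg _
      have hb : K ^ 2 * b ^ 2 ≤ 2 * μ * κ * b ^ 2 := by gcongr
      refine le_of_mul_le_mul_left ?_ (by positivity : 0 < 2 * μ)
      nlinarith
    have h6 : -(μ / 2 * a ^ 2 + κ * b ^ 2) ≤ ⟪M g, J g⟫_ℝ := by linarith
    have h7 := mul_le_mul_of_nonneg_left h6 hτ.le
    nlinarith [sq_nonneg b]
  let φ : V →L[ℝ] ℝ := (innerSL ℝ G).comp (J.comp ι)
  let y : V := (InnerProductSpace.toDual ℝ V).symm φ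
  let g : V := hcoer.continuousLinearEquivOfBilin.symm y
  have hg : ∀ h : V, B g h = ⟪G, J h⟫_ℝ := by
    intro h
    rw [← hcoer.continuousLinearEquivOfBilin_apply]
    simp only [g, ContinuousLinearEquiv.apply_symm_apply, y,
      InnerProductSpace.toDual_symm_apply]
    simp [φ, ι]
  let γ : Lp ℝ 2 (volume.restrict (Ioo l r)) := g
  refine ⟨fun x => ∫ y in l..x, γ y, ?_, ?_⟩
  all_goals
    have hder : deriv (fun x => ∫ y in l..x, γ y) =ᵐ[volume.restrict (Ioo l r)] γ := by
      rw [Filter.EventuallyEq, ae_restrict_iff' measurableSet_Ioo]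
      filter_upwards [(intervalIntegrable_of_Lp γ hlr).ae_hasDerivAt_integral] with x hx hx'
      exact (hx (by rw [uIcc_of_le hlr]; exact Ioo_subset_Icc_self hx') l (by simp)).deriv
  · refine ⟨memLp_primitive γ hlr, (Lp.memLp γ).ae_eq hder.symm, by simp, ?_⟩
    have h1 : ⟪toL2 l r (fun _ => 1), γ⟫_ℝ = 0 :=
      Submodule.mem_orthogonal_singleton_iff_inner_right.1 g.2
    rw [← toL2_coeFn γ, inner_toL2 hlr h12 (Lp.memLp γ), ip] at h1
    simpa using h1
  · intro v hv
    -- Mean zero of `deriv v` expresses that `v` has equal values, namely `0`, at both ends.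
    have hmem : toL2 l r (deriv v) ∈ V := by
      refine Submodule.mem_orthogonal_singleton_iff_inner_right.2 ?_
      rw [inner_toL2 hlr h12 hv.2.1, ip]
      simp [hv.1.integral_deriv_eq_sub, hv.2.2.1, hv.2.2.2]
    have hJ : J (toL2 l r (deriv v)) = toL2 l r v := by
      refine toL2_congr ((ae_restrict_iff' measurableSet_Ioo).2
          (Eventually.of_forall fun x hx => ?_))
      have hs : Ioo l x ⊆ Ioo l r := Ioo_subset_Ioo le_rfl hx.2.le
      have h1 := (hv.1.mono (c := l) (d := x) (by
        rw [uIcc_of_le hx.1.le, uIcc_of_le hlr]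
        exact Icc_subset_Icc le_rfl hx.2.le)).integral_deriv_eq_sub
      rw [hv.2.2.1, sub_zero] at h1
      rw [← h1]
      simp only [intervalIntegral.integral_of_le hx.1.le, integral_Ioc_eq_integral_Ioo]
      exact integral_congr_ae (ae_restrict_of_ae_restrict_of_subset hs (coeFn_toL2 hv.2.1))
    have h1 := hg ⟨_, hmem⟩
    rw [hB] at h1
    simp only [hJ] at h1
    have e1 : J g = toL2 l r (fun x => ∫ y in l..x, γ y) := rfl
    have e2 : M g = toL2 l r (fun x => w x * deriv (fun x => ∫ y in l..x, γ y) x) := by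
      refine toL2_congr ?_
      filter_upwards [hder] with x hx
      rw [hx]
    have e3 : toL2 l r (deriv (fun x => ∫ y in l..x, γ y)) = γ := by
      rw [toL2_congr hder, toL2_coeFn]
    rw [e1, e2] at h1
    rw [e3, ← h1]
    ring

end Existence

/-! ### Stability of the implicit Euler scheme in the maximum norm -/

section Euler
variable {A B μ τ T : ℝ} {N : ℕ} {w f : ℕ → ℝ → ℝ} {u₀ : ℝ → ℝ} {u : ℕ → ℝ → ℝ}

theorem IsEulerSolution.memLp (h : IsEulerSolution A B μ τ N w f u₀ u) (hAB : A ≤ B)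
    (hu₀ : MemLp u₀ 2 (volume.restrict (Ioo A B))) {n : ℕ} (hn : n ≤ N) :
    MemLp (u n) 2 (volume.restrict (Ioo A B)) := by
  cases n with
  | zero =>
    refine hu₀.ae_eq ((ae_restrict_iff' measurableSet_Ioo).2 (Eventually.of_forall fun x hx => ?_))
    exact (h.init x (Ioo_subset_Icc_self hx)).symm
  | succ n => exact (h.mem n (by omega)).memLp hAB

theorem IsEulerSolution.memH10 (h : IsEulerSolution A B μ τ N w f u₀ u) (hAB : A ≤ B)
    (hu₀ : MemH10 A B u₀) {n : ℕ} (hn : n ≤ N) : MemH10 A B (u n) := by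
  cases n with
  | zero => exact hu₀.congr hAB fun x hx => (h.init x hx).symm
  | succ n => exact h.mem n (by omega)

/-- The step multiplied by `τ`, with drift and source gathered in one vector: the form in which the
abstract energy lemmas take their hypotheses. -/
theorem IsEulerSolution.inner_eq {K : ℝ} (h : IsEulerSolution A B μ τ N w f u₀ u) (hAB : A ≤ B)
    (hτ : 0 < τ) (hu₀ : MemLp u₀ 2 (volume.restrict (Ioo A B)))
    (hf : ∀ n ∈ Icc 1 N, MemLp (f n) 2 (volume.restrict (Ioo A B)))
    (hw : ∀ n ∈ Icc 1 N, AEStronglyMeasurable (w n) (volume.restrict (Ioo A B)))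
    (hwK : ∀ n ∈ Icc 1 N, ∀ᵐ x ∂(volume.restrict (Ioo A B)), |w n x| ≤ K)
    {n : ℕ} (hn : n < N) {v : ℝ → ℝ} (hv : MemH10 A B v) :
    ⟪toL2 A B (u (n + 1)) - toL2 A B (u n), toL2 A B v⟫_ℝ
      + τ * (⟪toL2 A B (fun x => w (n + 1) x * deriv (u (n + 1)) x) - toL2 A B (f (n + 1)),
          toL2 A B v⟫_ℝ
        + μ * ⟪toL2 A B (deriv (u (n + 1))), toL2 A B (deriv v)⟫_ℝ) = 0 := by
  have hn1 : n + 1 ∈ Icc 1 N := ⟨by omega, hn⟩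
  have h1 := h.eqn n hn v hv
  have hu1 := h.memLp hAB hu₀ (show n + 1 ≤ N by omega)
  have hu := h.memLp hAB hu₀ (show n ≤ N by omega)
  have hm := h.mem n hn
  have hv2 := hv.memLp hAB
  have e : (fun x => (u (n + 1) x - u n x) / τ) = fun x => τ⁻¹ * (u (n + 1) x - u n x) := by
    funext x; rw [div_eq_inv_mul]
  have hd : MemLp (fun x => u (n + 1) x - u n x) 2 (volume.restrict (Ioo A B)) := hu1.sub hu
  rw [bForm, e, ← inner_toL2 hAB (hd.const_mul _) hv2, ← inner_toL2 hAB hm.2.1 hv.2.1,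
    ← inner_toL2 hAB (memLp_bddMul (hw _ hn1) (hwK _ hn1) hm.2.1) hv2,
    ← inner_toL2 hAB (hf _ hn1) hv2, toL2_const_mul _ hd, toL2_sub hu1 hu, inner_smul_left] at h1
  simp only [conj_trivial] at h1
  rw [inner_sub_left (toL2 A B fun x => w (n + 1) x * deriv (u (n + 1)) x), ← h1]
  field_simp
  ring

end Euler

/-! ### Sums in time, and the sup-norm bound by splitting off a damped solution. -/

theorem sq_sum_mul_le {τ T : ℝ} {n N : ℕ} (hn : n ≤ N) (hT : N * τ = T)
    (a : ℕ → ℝ) :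
    (∑ k ∈ Finset.range n, τ * a k) ^ 2 ≤ T * ∑ k ∈ Finset.range n, τ * a k ^ 2 := by
  have h1 := sq_sum_le_card_mul_sum_sq (s := Finset.range n) (f := a)
  rw [Finset.card_range] at h1
  rw [← Finset.mul_sum, ← Finset.mul_sum, mul_pow, ← hT]
  have h2 : (n : ℝ) ≤ N := by exact_mod_cast hn
  have h3 : 0 ≤ ∑ k ∈ Finset.range n, a k ^ 2 := Finset.sum_nonneg fun _ _ => sq_nonneg _
  have h4 : τ ^ 2 * (∑ k ∈ Finset.range n, a k) ^ 2
      ≤ τ ^ 2 * (N * ∑ k ∈ Finset.range n, a k ^ 2) := by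
    gcongr
    exact h1.trans (by gcongr)
  linarith

theorem sum_range_le_sum_range {τ : ℝ} {n N : ℕ} (hτ : 0 ≤ τ) (hn : n ≤ N) (a : ℕ → ℝ) :
    ∑ k ∈ Finset.range n, τ * a k ^ 2 ≤ ∑ k ∈ Finset.range N, τ * a k ^ 2 :=
  Finset.sum_le_sum_of_subset_of_nonneg (Finset.range_mono hn) fun _ _ _ => by positivity

/-- With `κ = K² / μ`, the damped part `Z` is of size `√(F / K)` and `κ Z` has time integral of
order `√(T K F / μ)`; the maximum principle passes the latter to `u - Z`. The growth as `μ → 0` is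
thus only `μ^(-1/2)`, for velocities without any regularity. -/
theorem sup_stability {A B μ τ T K M₀ F : ℝ} {N : ℕ} {w f : ℕ → ℝ → ℝ} {u₀ : ℝ → ℝ}
    {u : ℕ → ℝ → ℝ} (hAB : A ≤ B) (hμ : 0 < μ) (hτ : 0 < τ) (hK : 0 < K) (hT : N * τ = T)
    (hw : ∀ n ∈ Icc 1 N, AEStronglyMeasurable (w n) (volume.restrict (Ioo A B)))
    (hwK : ∀ n ∈ Icc 1 N, ∀ᵐ x ∂(volume.restrict (Ioo A B)), |w n x| ≤ K)
    (hf : ∀ n ∈ Icc 1 N, MemLp (f n) 2 (volume.restrict (Ioo A B)))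
    (hF : ∑ k ∈ Finset.range N, τ * ‖toL2 A B (f (k + 1))‖ ^ 2 ≤ F)
    (hu₀ : MemH10 A B u₀) (hM₀ : ∀ x ∈ Icc A B, |u₀ x| ≤ M₀)
    (hu : IsEulerSolution A B μ τ N w f u₀ u) :
    ∀ n ≤ N, ∀ x ∈ Icc A B,
      |u n x| ≤ M₀ + Real.sqrt (6 * T * K * F / μ) + Real.sqrt (5 * F / K) := by
  have hT0 : 0 ≤ T := by rw [← hT]; positivity
  have hF0 : 0 ≤ F := le_trans (Finset.sum_nonneg fun _ _ => by positivity) hF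
  have hM0 : 0 ≤ M₀ := (abs_nonneg _).trans (hM₀ A (left_mem_Icc.2 hAB))
  set κ := K ^ 2 / μ with hκ
  have hκ0 : 0 < κ := by positivity
  have hμκ : μ * κ = K ^ 2 := by rw [hκ]; field_simp
  -- the solution of the damped scheme
  have hex : ∀ (n : ℕ) (y : ℝ → ℝ), ∃ z : ℝ → ℝ, n < N → MemH10 A B z ∧
      ∀ v, MemH10 A B v → ⟪toL2 A B z, toL2 A B v⟫_ℝ
        + τ * (⟪toL2 A B (fun x => w (n + 1) x * deriv z x), toL2 A B v⟫_ℝ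
          + μ * ⟪toL2 A B (deriv z), toL2 A B (deriv v)⟫_ℝ + κ * ⟪toL2 A B z, toL2 A B v⟫_ℝ)
          = ⟪toL2 A B y + τ • toL2 A B (f (n + 1)), toL2 A B v⟫_ℝ := by
    intro n y
    by_cases hn : n < N
    · have hn1 : n + 1 ∈ Icc 1 N := ⟨by omega, hn⟩
      obtain ⟨z, hz⟩ := exists_resolvent hAB hτ hμ (κ := κ) (K := K) (by nlinarith)
        (hw _ hn1) (hwK _ hn1) (toL2 A B y + τ • toL2 A B (f (n + 1)))
      exact ⟨z, fun _ => hz⟩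
    -- A default beyond the last step, so that `choose` gives a function of all `n` and the
    -- recursion for `Z` is total.
    · exact ⟨0, fun h => absurd h hn⟩
  choose S hS using hex
  let Z : ℕ → ℝ → ℝ := fun n => Nat.rec (fun _ => 0) S n
  have hZ0 : Z 0 = fun _ => 0 := rfl
  have hZmem : ∀ n ≤ N, MemH10 A B (Z n) := by
    intro n hn
    cases n with
    | zero => exact MemH10.zero
    | succ n => exact (hS n (Z n) (by omega)).1
  have hZL : ∀ n ≤ N, MemLp (Z n) 2 (volume.restrict (Ioo A B)) := fun n hn =>
    (hZmem n hn).memLp hAB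
  let e : ℕ → Lp ℝ 2 (volume.restrict (Ioo A B)) := fun n => toL2 A B (Z n)
  let g : ℕ → Lp ℝ 2 (volume.restrict (Ioo A B)) := fun n => toL2 A B (deriv (Z n))
  let q : ℕ → Lp ℝ 2 (volume.restrict (Ioo A B)) := fun n =>
    toL2 A B (fun x => w n x * deriv (Z n) x)
  let p : ℕ → Lp ℝ 2 (volume.restrict (Ioo A B)) := fun n => q n - toL2 A B (f n)
  have he0 : e 0 = 0 := by
    have : toL2 A B (fun _ => (0 : ℝ)) = 0 := by
      rw [toL2_of_memLp MemLp.zero']; exact MemLp.toLp_zero _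
    exact this
  have hg0 : g 0 = 0 := by
    have h1 : deriv (Z 0) = fun _ => 0 := by rw [hZ0]; funext x; simp
    have : toL2 A B (fun _ => (0 : ℝ)) = 0 := by
      rw [toL2_of_memLp MemLp.zero']; exact MemLp.toLp_zero _
    simp only [g, h1, this]
  have hstep : ∀ n < N, ∀ v, MemH10 A B v → ⟪e (n + 1) - e n, toL2 A B v⟫_ℝ
      + τ * (⟪p (n + 1), toL2 A B v⟫_ℝ + μ * ⟪g (n + 1), toL2 A B (deriv v)⟫_ℝ
        + κ * ⟪e (n + 1), toL2 A B v⟫_ℝ) = 0 := by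
    intro n hn v hv
    have h1 := (hS n (Z n) hn).2 v hv
    rw [inner_add_left, inner_smul_left, conj_trivial] at h1
    simp only [p, inner_sub_left]
    simp only [e, g, q]
    change ⟪toL2 A B (S n (Z n)), _⟫_ℝ - _ + τ * (⟪toL2 A B (fun x => w (n + 1) x
      * deriv (S n (Z n)) x), _⟫_ℝ - _ + μ * ⟪toL2 A B (deriv (S n (Z n))), _⟫_ℝ
      + κ * ⟪toL2 A B (S n (Z n)), _⟫_ℝ) = 0
    linarith
  have hq : ∀ n < N, ‖q (n + 1)‖ ≤ K * ‖g (n + 1)‖ := fun n hn =>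
    norm_toL2_bddMul_le (hw _ ⟨by omega, hn⟩) (hwK _ ⟨by omega, hn⟩) (hZmem (n + 1) hn).2.1
  have henergy := damped_energy_estimate (e := e) (g := g) (p := p) (F := fun n => toL2 A B (f n))
    hτ hκ0 (N := N) (fun n hn => hstep n hn _ (hZmem (n + 1) hn)) (fun n hn => by
      have h1 := abs_inner_bdd_drift_le (hw _ ⟨by omega, hn⟩) (hwK _ ⟨by omega, hn⟩)
        (hZmem (n + 1) hn).2.1 (c := μ / 2) (d := κ / 2) (by positivity)
        (by nlinarith) (e (n + 1))
      have h2 := (abs_le.1 h1).1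
      have h3 := real_inner_le_norm (toL2 A B (f (n + 1))) (e (n + 1))
      simp only [p, inner_sub_left]
      simp only [q, g] at h2 ⊢
      linarith)
  have hgrad := gradient_estimate (e := e) (g := g) (p := p) hτ hμ.le hκ0.le (N := N)
    (fun n hn => by
      have h1 := hstep n hn _ ((hZmem (n + 1) hn).sub (hZmem n hn.le) hAB)
      rw [(hZmem (n + 1) hn).toL2_deriv_sub (hZmem n hn.le) hAB,
        toL2_sub (hZL (n + 1) hn) (hZL n hn.le)] at h1
      exact h1)
  rw [he0] at henergy hgrad
  rw [hg0] at hgrad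
  have hFn : ∀ n ≤ N, ∑ k ∈ Finset.range n, τ * ‖toL2 A B (f (k + 1))‖ ^ 2 ≤ F := fun n hn =>
    (sum_range_le_sum_range hτ.le hn fun k => ‖toL2 A B (f (k + 1))‖).trans hF
  have hE : ∀ n ≤ N, ‖e n‖ ^ 2 + (μ * ∑ k ∈ Finset.range n, τ * ‖g (k + 1)‖ ^ 2
        + κ / 2 * ∑ k ∈ Finset.range n, τ * ‖e (k + 1)‖ ^ 2) ≤ 2 / κ * F := by
    intro n hn
    have h1 := henergy n hn
    have h2 := mul_le_mul_of_nonneg_left (hFn n hn) (by positivity : 0 ≤ 2 / κ)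
    simp only [norm_zero] at h1
    linarith
  have hnn : ∀ (n : ℕ) (a : ℕ → ℝ), 0 ≤ ∑ k ∈ Finset.range n, τ * a k ^ 2 := fun n a =>
    Finset.sum_nonneg fun _ _ => by positivity
  have hEe : ∀ n ≤ N, ‖e n‖ ^ 2 ≤ 2 * μ * F / K ^ 2 := by
    intro n hn
    have h1 := hE n hn
    have h2 := mul_nonneg hμ.le (hnn n fun k => ‖g (k + 1)‖)
    have h3 := mul_nonneg (by positivity : 0 ≤ κ / 2) (hnn n fun k => ‖e (k + 1)‖)
    have e1 : 2 / κ * F = 2 * μ * F / K ^ 2 := by rw [hκ]; field_simp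
    linarith
  have hEg : ∀ n ≤ N, ∑ k ∈ Finset.range n, τ * ‖g (k + 1)‖ ^ 2 ≤ 2 * F / K ^ 2 := by
    intro n hn
    have h1 := hE n hn
    have h3 := mul_nonneg (by positivity : 0 ≤ κ / 2) (hnn n fun k => ‖e (k + 1)‖)
    have e1 : 2 / κ * F = μ * (2 * F / K ^ 2) := by rw [hκ]; field_simp
    refine le_of_mul_le_mul_left ?_ hμ
    nlinarith [sq_nonneg ‖e n‖]
  have hEs : ∀ n ≤ N, ∑ k ∈ Finset.range n, τ * ‖e (k + 1)‖ ^ 2 ≤ 4 * F * μ ^ 2 / K ^ 4 := by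
    intro n hn
    have h1 := hE n hn
    have h2 := mul_nonneg hμ.le (hnn n fun k => ‖g (k + 1)‖)
    have e1 : 2 / κ * F = κ / 2 * (4 * F * μ ^ 2 / K ^ 4) := by rw [hκ]; field_simp; ring
    refine le_of_mul_le_mul_left ?_ (by positivity : 0 < κ / 2)
    nlinarith [sq_nonneg ‖e n‖]
  have hEG : ∀ n ≤ N, ‖g n‖ ^ 2 ≤ 3 * F / μ := by
    intro n hn
    have h1 := hgrad n hn
    simp only [norm_zero] at h1
    have h2 : ∑ k ∈ Finset.range n, ‖p (k + 1)‖ ^ 2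
        ≤ ∑ k ∈ Finset.range n, (2 * K ^ 2 * ‖g (k + 1)‖ ^ 2
          + 2 * ‖toL2 A B (f (k + 1))‖ ^ 2) := by
      refine Finset.sum_le_sum fun k hk => ?_
      have hkN : k < N := lt_of_lt_of_le (Finset.mem_range.1 hk) hn
      have h3 : ‖p (k + 1)‖ ≤ K * ‖g (k + 1)‖ + ‖toL2 A B (f (k + 1))‖ :=
        (norm_sub_le _ _).trans (add_le_add (hq k hkN) le_rfl)
      have h4 : ‖p (k + 1)‖ ^ 2 ≤ (K * ‖g (k + 1)‖ + ‖toL2 A B (f (k + 1))‖) ^ 2 := by gcongr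
      nlinarith [sq_nonneg (K * ‖g (k + 1)‖ - ‖toL2 A B (f (k + 1))‖)]
    have h5 : τ / 2 * ∑ k ∈ Finset.range n, ‖p (k + 1)‖ ^ 2
        ≤ K ^ 2 * ∑ k ∈ Finset.range n, τ * ‖g (k + 1)‖ ^ 2
          + ∑ k ∈ Finset.range n, τ * ‖toL2 A B (f (k + 1))‖ ^ 2 := by
      refine (mul_le_mul_of_nonneg_left h2 (by positivity)).trans (le_of_eq ?_)
      rw [Finset.mul_sum, Finset.mul_sum, ← Finset.sum_add_distrib]
      exact Finset.sum_congr rfl fun _ _ => by ring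
    have h6 := mul_le_mul_of_nonneg_left (hEg n hn) (by positivity : 0 ≤ K ^ 2)
    have e1 : K ^ 2 * (2 * F / K ^ 2) = 2 * F := by field_simp
    have h7 := hFn n hn
    rw [le_div_iff₀ hμ]
    nlinarith [sq_nonneg ‖e n‖]
  -- pointwise bounds
  let s : ℕ → ℝ := fun n => Real.sqrt (2 * ‖e n‖ * ‖g n‖)
  have hs0 : ∀ n, 0 ≤ s n := fun n => Real.sqrt_nonneg _
  have hZs : ∀ n ≤ N, ∀ x ∈ Icc A B, |Z n x| ≤ s n := fun n hn x hx =>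
    Real.abs_le_sqrt ((hZmem n hn).sq_le hAB hx)
  -- The weights balance the two estimates: `K / μ` times the bound `2 μ F / K²` and `μ / K` times
  -- the bound `3 F / μ` are both of order `F / K`.
  have hs2 : ∀ n, s n ^ 2 ≤ K / μ * ‖e n‖ ^ 2 + μ / K * ‖g n‖ ^ 2 := by
    intro n
    rw [Real.sq_sqrt (by positivity)]
    have h1 : 0 ≤ (K * ‖e n‖ - μ * ‖g n‖) ^ 2 / (μ * K) := by positivity
    have e1 : (K * ‖e n‖ - μ * ‖g n‖) ^ 2 / (μ * K)
        = K / μ * ‖e n‖ ^ 2 + μ / K * ‖g n‖ ^ 2 - 2 * ‖e n‖ * ‖g n‖ := by field_simp; ring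
    linarith
  have hsn : ∀ n ≤ N, s n ≤ Real.sqrt (5 * F / K) := by
    intro n hn
    refine Real.le_sqrt_of_sq_le ((hs2 n).trans ?_)
    have h1 := mul_le_mul_of_nonneg_left (hEe n hn) (by positivity : 0 ≤ K / μ)
    have h2 := mul_le_mul_of_nonneg_left (hEG n hn) (by positivity : 0 ≤ μ / K)
    have e1 : K / μ * (2 * μ * F / K ^ 2) + μ / K * (3 * F / μ) = 5 * F / K := by
      field_simp; ring
    linarith
  -- Cauchy-Schwarz in time: the factor `κ²` against the summed bounds, both of order `F μ / K³`
  -- after weighting, leaves `6 T K F / μ`.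
  have hsum : ∀ n ≤ N, ∑ k ∈ Finset.range n, τ * κ * s (k + 1)
      ≤ Real.sqrt (6 * T * K * F / μ) := by
    intro n hn
    refine Real.le_sqrt_of_sq_le ?_
    have h1 := sq_sum_mul_le hn hT fun k => s (k + 1)
    have h2 : ∑ k ∈ Finset.range n, τ * s (k + 1) ^ 2
        ≤ K / μ * ∑ k ∈ Finset.range n, τ * ‖e (k + 1)‖ ^ 2
          + μ / K * ∑ k ∈ Finset.range n, τ * ‖g (k + 1)‖ ^ 2 := by
      rw [Finset.mul_sum, Finset.mul_sum, ← Finset.sum_add_distrib]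
      refine Finset.sum_le_sum fun k _ => ?_
      have := mul_le_mul_of_nonneg_left (hs2 (k + 1)) hτ.le
      linarith
    have h3 := mul_le_mul_of_nonneg_left (hEs n hn) (by positivity : 0 ≤ K / μ)
    have h4 := mul_le_mul_of_nonneg_left (hEg n hn) (by positivity : 0 ≤ μ / K)
    have e1 : ∑ k ∈ Finset.range n, τ * κ * s (k + 1)
        = κ * ∑ k ∈ Finset.range n, τ * s (k + 1) := by
      rw [Finset.mul_sum]; exact Finset.sum_congr rfl fun _ _ => by ring
    have e2 : κ ^ 2 * (T * (K / μ * (4 * F * μ ^ 2 / K ^ 4) + μ / K * (2 * F / K ^ 2)))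
        = 6 * T * K * F / μ := by rw [hκ]; field_simp; ring
    rw [e1, mul_pow, ← e2]
    have h5 : (∑ k ∈ Finset.range n, τ * s (k + 1)) ^ 2
        ≤ T * (K / μ * (4 * F * μ ^ 2 / K ^ 4) + μ / K * (2 * F / K ^ 2)) :=
      h1.trans (mul_le_mul_of_nonneg_left (by linarith) hT0)
    exact mul_le_mul_of_nonneg_left h5 (by positivity)
  -- the remainder satisfies a maximum principle
  have hV : ∀ n ≤ N, ∀ x ∈ Icc A B,
      |u n x - Z n x| ≤ M₀ + ∑ k ∈ Finset.range n, τ * κ * s (k + 1) := by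
    intro n
    induction n with
    | zero => intro _ x hx; simpa [hZ0, hu.init x hx] using hM₀ x hx
    | succ n ih =>
      intro hn
      have hn' : n < N := by omega
      have ih := ih hn'.le
      have hun := hu.memH10 hAB hu₀ hn'.le
      have hun1 := hu.memH10 hAB hu₀ hn
      have hz := hZmem n hn'.le
      have hz1 := hZmem (n + 1) hn
      have hVL : MemLp (fun x => u n x - Z n x) 2 (volume.restrict (Ioo A B)) :=
        (hun.memLp hAB).sub (hZL n hn'.le)
      have hgL : MemLp (fun x => (u n x - Z n x) + τ * κ * Z (n + 1) x) 2
          (volume.restrict (Ioo A B)) := hVL.add ((hZL (n + 1) hn).const_mul _)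
      have hwn := hw (n + 1) ⟨by omega, hn⟩
      have hwKn := hwK (n + 1) ⟨by omega, hn⟩
      -- Subtracting the schemes, `u (n + 1) - Z (n + 1)` solves the undamped step with right-hand
      -- side `u n - Z n + τ κ Z (n + 1)`.
      refine abs_le_of_resolvent hAB hτ hμ hK
        (add_nonneg hM0 (Finset.sum_nonneg fun k _ => by have := hs0 (k + 1); positivity))
        hwn hwKn (hun1.sub hz1 hAB) hgL (fun x hx => ?_) (fun v hv => ?_)
      · have hx' := Ioo_subset_Icc_self hx
        have h1 := ih x hx'
        have h2 := hZs (n + 1) hn x hx'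
        refine (abs_add_le _ _).trans ?_
        rw [Finset.sum_range_succ, abs_mul, abs_of_pos (by positivity : 0 < τ * κ)]
        have h3 := mul_le_mul_of_nonneg_left h2 (by positivity : 0 ≤ τ * κ)
        linarith
      · have h1 := hu.inner_eq hAB hτ (hu₀.memLp hAB) hf hw hwK hn' hv
        have h2 := hstep n hn' v hv
        have e1 : toL2 A B (fun x => w (n + 1) x * deriv (fun x => u (n + 1) x - Z (n + 1) x) x)
            = toL2 A B (fun x => w (n + 1) x * deriv (u (n + 1)) x) - q (n + 1) := by
          rw [← toL2_sub (memLp_bddMul hwn hwKn hun1.2.1) (memLp_bddMul hwn hwKn hz1.2.1)]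
          refine toL2_congr ?_
          filter_upwards [MemH10.deriv_sub_ae hun1.1 hz1.1 hAB] with x hx
          rw [hx]; ring
        rw [e1, hun1.toL2_deriv_sub hz1 hAB, toL2_sub (hun1.memLp hAB) (hZL _ hn),
          toL2_add hVL ((hZL (n + 1) hn).const_mul _), toL2_const_mul _ (hZL _ hn),
          toL2_sub (hun.memLp hAB) (hZL _ hn'.le)]
        simp only [p, e, g, inner_sub_left, inner_add_left, inner_smul_left, conj_trivial]
          at h1 h2 ⊢
        linarith
  intro n hn x hx
  have h1 := hV n hn x hx
  have h2 := hZs n hn x hx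
  have h3 := hsn n hn
  have h4 := hsum n hn
  have h5 : |u n x| ≤ |u n x - Z n x| + |Z n x| := by
    have := abs_add_le (u n x - Z n x) (Z n x)
    rwa [sub_add_cancel] at this
  linarith

/-! ### Estimates for Lipschitz velocities -/

/-- The advection term with a Lipschitz velocity `w` is controlled by the diffusion, up to a growth
rate `γ` that is both at most `L / 2` and small compared to the time step. -/
theorem exists_growth_rate {A B μ τ M : ℝ} {L : ℝ≥0} (hAB : A ≤ B) (hμ : 0 < μ) (hτ : 0 < τ)
    (hM : τ * M ^ 2 ≤ μ) :
    ∃ γ : ℝ, 0 ≤ γ ∧ γ ≤ L / 2 ∧ τ * γ ≤ 1 / 3 ∧ ∀ w z : ℝ → ℝ,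
      LipschitzOnWith L w (Ioo A B) → AEStronglyMeasurable w (volume.restrict (Ioo A B)) →
      (∀ᵐ x ∂(volume.restrict (Ioo A B)), |w x| ≤ M) → MemH10 A B z →
      -⟪toL2 A B (fun x => w x * deriv z x), toL2 A B z⟫_ℝ
        ≤ γ * ‖toL2 A B z‖ ^ 2 + 3 / 4 * μ * ‖toL2 A B (deriv z)‖ ^ 2 := by
  -- For short time steps integration by parts gives the rate `L / 2`.
  rcases le_or_gt (τ * (L / 2)) (1 / 3) with h | h
  · refine ⟨L / 2, by positivity, le_rfl, h, fun w z hw hwm hwM hz => ?_⟩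
    rw [inner_toL2 hAB (memLp_bddMul hwm hwM hz.2.1) (hz.memLp hAB)]
    have := (abs_le.1 (abs_inner_drift_le hAB hw hz)).1
    have h2 : 0 ≤ 3 / 4 * μ * ‖toL2 A B (deriv z)‖ ^ 2 := by positivity
    linarith
  -- For long time steps Young's inequality gives the rate `1 / (3 τ)`, now below `L / 2`; its
  -- condition reads `M² ≤ 4 (3μ/4) / (3τ) = μ / τ`, the time step restriction. So `τ` need not be
  -- small compared with `1 / L`.
  · refine ⟨1 / (3 * τ), by positivity, ?_, le_of_eq (by field_simp), fun w z _ hwm hwM hz => ?_⟩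
    · rw [div_le_iff₀ (by positivity)]; linarith
    · have h1 := abs_inner_bdd_drift_le hwm hwM hz.2.1 (c := 3 / 4 * μ) (d := 1 / (3 * τ))
        (by positivity) (by
          have e : 4 * (3 / 4 * μ) * (1 / (3 * τ)) = μ / τ := by field_simp
          rw [e, le_div_iff₀ hτ]; linarith) (toL2 A B z)
      have := (abs_le.1 h1).1
      linarith

section LipschitzVelocity
variable {A B μ τ T M F : ℝ} {L : ℝ≥0} {N : ℕ} {w f : ℕ → ℝ → ℝ} {u₀ : ℝ → ℝ}
  {u : ℕ → ℝ → ℝ}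

/-- A bound on `μ ∑ τ ‖∂u‖²` that is uniform in `μ`; it measures the source `(a_h - a) ∂u` of the
error equation. -/
theorem IsEulerSolution.energy_le (hAB : A ≤ B) (hμ : 0 < μ) (hτ : 0 < τ) (hTpos : 0 < T)
    (hT : N * τ = T)
    (hM : τ * M ^ 2 ≤ μ) (hwL : ∀ n ∈ Icc 1 N, LipschitzOnWith L (w n) (Ioo A B))
    (hw : ∀ n ∈ Icc 1 N, AEStronglyMeasurable (w n) (volume.restrict (Ioo A B)))
    (hwM : ∀ n ∈ Icc 1 N, ∀ᵐ x ∂(volume.restrict (Ioo A B)), |w n x| ≤ M)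
    (hf : ∀ n ∈ Icc 1 N, MemLp (f n) 2 (volume.restrict (Ioo A B)))
    (hF : ∑ k ∈ Finset.range N, τ * ‖toL2 A B (f (k + 1))‖ ^ 2 ≤ F)
    (hu₀ : MemH10 A B u₀) (hu : IsEulerSolution A B μ τ N w f u₀ u) :
    μ / 2 * ∑ k ∈ Finset.range N, τ * ‖toL2 A B (deriv (u (k + 1)))‖ ^ 2
      ≤ 2 * Real.exp (3 * L * T) * ‖toL2 A B u₀‖ ^ 2 + 4 * Real.exp (3 * L * T) ^ 2 * T * F := by
  obtain ⟨γ, hγ0, hγL, hτγ, hγ⟩ := exists_growth_rate (L := L) hAB hμ hτ hM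
  set E := Real.exp (3 * L * T) with hE
  have hE0 : 0 < E := Real.exp_pos _
  have hmem : ∀ n ≤ N, MemH10 A B (u n) := fun n hn => hu.memH10 hAB hu₀ hn
  have h0 : toL2 A B (u 0) = toL2 A B u₀ := toL2_congr
    ((ae_restrict_iff' measurableSet_Ioo).2 (Eventually.of_forall fun x hx =>
      hu.init x (Ioo_subset_Icc_self hx)))
  have hen := energy_estimate (e := fun n => toL2 A B (u n))
    (g := fun n => toL2 A B (deriv (u n)))
    (p := fun n => toL2 A B (fun x => w n x * deriv (u n) x) - toL2 A B (f n))
    (r := fun n => ‖toL2 A B (f n)‖ * ‖toL2 A B (u n)‖) (N := N) hτ hμ.le hγ0 hγL hτγ hT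
    (fun n => by positivity)
    (fun n hn => hu.inner_eq hAB hτ (hu₀.memLp hAB) hf hw hwM hn (hmem (n + 1) hn))
    (fun n hn => by
      have h1 := hγ (w (n + 1)) (u (n + 1)) (hwL _ ⟨by omega, hn⟩) (hw _ ⟨by omega, hn⟩)
        (hwM _ ⟨by omega, hn⟩) (hmem (n + 1) hn)
      have h2 := real_inner_le_norm (toL2 A B (f (n + 1))) (toL2 A B (u (n + 1)))
      rw [inner_sub_left]
      linarith)
  -- The source term is linear in `‖u‖`; it is estimated with the largest norm `Y`, and half of `Y²`
  -- is absorbed by the energy inequality at the maximal index `m`.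
  obtain ⟨m, hm, hmax⟩ := Finset.exists_max_image (Finset.range (N + 1))
    (fun n => ‖toL2 A B (u n)‖) ⟨0, by simp⟩
  have hmN : m ≤ N := by simpa [Nat.lt_succ_iff] using hm
  set Y := ‖toL2 A B (u m)‖ with hY
  have hbound : ∀ n ≤ N, E * (‖toL2 A B (u 0)‖ ^ 2
      + 2 * ∑ k ∈ Finset.range n, τ * (‖toL2 A B (f (k + 1))‖ * ‖toL2 A B (u (k + 1))‖))
      ≤ E * ‖toL2 A B u₀‖ ^ 2 + Y ^ 2 / 2 + 2 * E ^ 2 * T * F := by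
    intro n hn
    have h1 : ∑ k ∈ Finset.range n, τ * (‖toL2 A B (f (k + 1))‖ * ‖toL2 A B (u (k + 1))‖)
        ≤ ∑ k ∈ Finset.range n, (τ * (Y ^ 2 / (4 * E * T))
          + E * T * (τ * ‖toL2 A B (f (k + 1))‖ ^ 2)) := by
      refine Finset.sum_le_sum fun k hk => ?_
      have hk' : ‖toL2 A B (u (k + 1))‖ ≤ Y := hmax (k + 1) (by
        have := Finset.mem_range.1 hk; simp; omega)
      have h2 : ‖toL2 A B (f (k + 1))‖ * ‖toL2 A B (u (k + 1))‖ ≤ ‖toL2 A B (f (k + 1))‖ * Y := by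
        gcongr
      -- Young with weight `1 / (4 E T)`: after summation over a time at most `T` and multiplication
      -- by `2 E`, exactly `Y² / 2` is left.
      have h3 : 0 ≤ (Y - 2 * E * T * ‖toL2 A B (f (k + 1))‖) ^ 2 / (4 * E * T) := by positivity
      have e3 : (Y - 2 * E * T * ‖toL2 A B (f (k + 1))‖) ^ 2 / (4 * E * T)
        = Y ^ 2 / (4 * E * T) - ‖toL2 A B (f (k + 1))‖ * Y
          + E * T * ‖toL2 A B (f (k + 1))‖ ^ 2 := by field_simp; ring
      have h4 : ‖toL2 A B (f (k + 1))‖ * ‖toL2 A B (u (k + 1))‖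
        ≤ Y ^ 2 / (4 * E * T) + E * T * ‖toL2 A B (f (k + 1))‖ ^ 2 := by linarith
      have := mul_le_mul_of_nonneg_left h4 hτ.le
      linarith
    rw [Finset.sum_add_distrib, Finset.sum_const, Finset.card_range,
      ← Finset.mul_sum _ _ (E * T), nsmul_eq_mul] at h1
    have h2 : (n : ℝ) * (τ * (Y ^ 2 / (4 * E * T))) ≤ Y ^ 2 / (4 * E) := by
      have hnN : (n : ℝ) ≤ N := by exact_mod_cast hn
      calc (n : ℝ) * (τ * (Y ^ 2 / (4 * E * T))) ≤ N * (τ * (Y ^ 2 / (4 * E * T))) := by gcongr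
        _ = T * (Y ^ 2 / (4 * E * T)) := by rw [← mul_assoc, hT]
        _ = _ := by field_simp
    have h3 := (sum_range_le_sum_range hτ.le hn fun k => ‖toL2 A B (f (k + 1))‖).trans hF
    have h4 := mul_le_mul_of_nonneg_left h3 (by positivity : 0 ≤ E * T)
    have h5 : 2 * E * (Y ^ 2 / (4 * E)) = Y ^ 2 / 2 := by field_simp; ring
    have h6 := mul_le_mul_of_nonneg_left (h1.trans (add_le_add h2 h4)) (by positivity : 0 ≤ 2 * E)
    rw [h0]
    nlinarith
  have h1 := (hen m hmN).trans (hbound m hmN)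
  have h2 := (hen N le_rfl).trans (hbound N le_rfl)
  have h3 : 0 ≤ μ / 2 * ∑ k ∈ Finset.range m, τ * ‖toL2 A B (deriv (u (k + 1)))‖ ^ 2 :=
    mul_nonneg (by positivity) (Finset.sum_nonneg fun _ _ => by positivity)
  have h4 := sq_nonneg ‖toL2 A B (u N)‖
  nlinarith

/-- The gradient estimate without damping. Multiplied by `μ` and combined with the energy bound, it
controls `μ ‖∂u‖` at each time, which pairs with a perturbation that is only square summable in
time. -/
theorem IsEulerSolution.deriv_le (hAB : A ≤ B) (hμ : 0 < μ) (hτ : 0 < τ)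
    (hw : ∀ n ∈ Icc 1 N, AEStronglyMeasurable (w n) (volume.restrict (Ioo A B)))
    (hwM : ∀ n ∈ Icc 1 N, ∀ᵐ x ∂(volume.restrict (Ioo A B)), |w n x| ≤ M)
    (hf : ∀ n ∈ Icc 1 N, MemLp (f n) 2 (volume.restrict (Ioo A B)))
    (hF : ∑ k ∈ Finset.range N, τ * ‖toL2 A B (f (k + 1))‖ ^ 2 ≤ F)
    (hu₀ : MemH10 A B u₀) (hu : IsEulerSolution A B μ τ N w f u₀ u) {n : ℕ} (hn : n ≤ N) :
    μ * ‖toL2 A B (deriv (u n))‖ ^ 2 ≤ μ * ‖toL2 A B (deriv u₀)‖ ^ 2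
      + M ^ 2 * ∑ k ∈ Finset.range N, τ * ‖toL2 A B (deriv (u (k + 1)))‖ ^ 2 + F := by
  have hmem : ∀ n ≤ N, MemH10 A B (u n) := fun n hn => hu.memH10 hAB hu₀ hn
  have h0 : toL2 A B (deriv (u 0)) = toL2 A B (deriv u₀) :=
    toL2_congr (MemH10.deriv_congr_ae hu.init)
  have hgr := gradient_estimate (e := fun n => toL2 A B (u n))
    (g := fun n => toL2 A B (deriv (u n)))
    (p := fun n => toL2 A B (fun x => w n x * deriv (u n) x) - toL2 A B (f n))
    (κ := 0) (N := N) hτ hμ.le le_rfl (fun n hn => by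
      have h1 := hu.inner_eq hAB hτ (hu₀.memLp hAB) hf hw hwM hn
        ((hmem (n + 1) hn).sub (hmem n hn.le) hAB)
      rw [(hmem (n + 1) hn).toL2_deriv_sub (hmem n hn.le) hAB,
        toL2_sub ((hmem (n + 1) hn).memLp hAB) ((hmem n hn.le).memLp hAB)] at h1
      rw [zero_mul, add_zero]
      exact h1) n hn
  rw [zero_mul, zero_mul, add_zero, add_zero, h0] at hgr
  have h1 : τ / 2 * ∑ k ∈ Finset.range n, ‖toL2 A B (fun x => w (k + 1) x * deriv (u (k + 1)) x)
        - toL2 A B (f (k + 1))‖ ^ 2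
      ≤ M ^ 2 * ∑ k ∈ Finset.range n, τ * ‖toL2 A B (deriv (u (k + 1)))‖ ^ 2
        + ∑ k ∈ Finset.range n, τ * ‖toL2 A B (f (k + 1))‖ ^ 2 := by
    rw [Finset.mul_sum, Finset.mul_sum, ← Finset.sum_add_distrib]
    refine Finset.sum_le_sum fun k hk => ?_
    have hkN : k < N := lt_of_lt_of_le (Finset.mem_range.1 hk) hn
    have h3 := norm_toL2_bddMul_le (hw (k + 1) ⟨by omega, hkN⟩) (hwM (k + 1) ⟨by omega, hkN⟩)
      (hmem (k + 1) hkN).2.1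
    have h4 : ‖toL2 A B (fun x => w (k + 1) x * deriv (u (k + 1)) x) - toL2 A B (f (k + 1))‖ ^ 2
        ≤ (M * ‖toL2 A B (deriv (u (k + 1)))‖ + ‖toL2 A B (f (k + 1))‖) ^ 2 := by
      gcongr
      exact (norm_sub_le _ _).trans (add_le_add h3 le_rfl)
    have h5 := mul_le_mul_of_nonneg_left h4 (by positivity : 0 ≤ τ / 2)
    nlinarith [mul_nonneg hτ.le
      (sq_nonneg (M * ‖toL2 A B (deriv (u (k + 1)))‖ - ‖toL2 A B (f (k + 1))‖))]
  have h2 := (sum_range_le_sum_range hτ.le hn fun k => ‖toL2 A B (f (k + 1))‖).trans hF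
  have h3 := mul_le_mul_of_nonneg_left
    (sum_range_le_sum_range hτ.le hn fun k => ‖toL2 A B (deriv (u (k + 1)))‖) (sq_nonneg M)
  linarith

end LipschitzVelocity

/-! ### Comparison of two Euler solutions with close velocities. -/

theorem sq_sum_mul_mul_le (τ : ℝ) (n : ℕ) (a b : ℕ → ℝ) :
    (∑ k ∈ Finset.range n, τ * (a k * b k)) ^ 2
      ≤ (∑ k ∈ Finset.range n, τ * a k ^ 2) * ∑ k ∈ Finset.range n, τ * b k ^ 2 := by
  have h := Finset.sum_mul_sq_le_sq_mul_sq (Finset.range n) a b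
  simp only [← Finset.mul_sum]
  rw [mul_pow]
  nlinarith [mul_le_mul_of_nonneg_left h (sq_nonneg τ)]

/-- Closes the error energy inequality, whose right side contains `‖g‖` because the gradient of the
perturbed solution was replaced by the sum of `a` and `‖g‖`. The largest `‖e n‖` is absorbed as a
maximum in time, the `‖g‖` part by diffusion. -/
theorem perturbation_energy_le {H : Type*} [NormedAddCommGroup H] {e g : ℕ → H} {a δ : ℕ → ℝ}
    {μ τ E : ℝ} {N : ℕ} (hμ : 0 < μ) (hτ : 0 < τ) (hE0 : 0 < E) (hδ0 : ∀ n, 0 ≤ δ n)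
    (ha0 : ∀ n, 0 ≤ a n)
    (hsmall : 32 * E ^ 2 * ∑ k ∈ Finset.range N, τ * δ (k + 1) ^ 2 ≤ μ)
    (hen : ∀ n ≤ N, ‖e n‖ ^ 2 + μ / 2 * ∑ k ∈ Finset.range n, τ * ‖g (k + 1)‖ ^ 2
      ≤ E * (2 * ∑ k ∈ Finset.range n,
        τ * (δ (k + 1) * (a (k + 1) + ‖g (k + 1)‖) * ‖e (k + 1)‖))) :
    (∀ n ≤ N, ‖e n‖ ^ 2 ≤ 16 * E ^ 2 * (∑ k ∈ Finset.range N, τ * δ (k + 1) ^ 2)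
      * ∑ k ∈ Finset.range N, τ * a (k + 1) ^ 2) ∧
    μ * ∑ k ∈ Finset.range N, τ * ‖g (k + 1)‖ ^ 2
      ≤ 32 * E ^ 2 * (∑ k ∈ Finset.range N, τ * δ (k + 1) ^ 2)
        * ∑ k ∈ Finset.range N, τ * a (k + 1) ^ 2 := by
  set Δ := ∑ k ∈ Finset.range N, τ * δ (k + 1) ^ 2 with hΔ
  have hΔ0 : 0 ≤ Δ := Finset.sum_nonneg fun _ _ => by positivity
  set Sa := ∑ k ∈ Finset.range N, τ * a (k + 1) ^ 2 with hSa
  set Sg := ∑ k ∈ Finset.range N, τ * ‖g (k + 1)‖ ^ 2 with hSg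
  have hSa0 : 0 ≤ Sa := Finset.sum_nonneg fun _ _ => by positivity
  have hSg0 : 0 ≤ Sg := Finset.sum_nonneg fun _ _ => by positivity
  obtain ⟨m, hm, hmax⟩ := Finset.exists_max_image (Finset.range (N + 1))
    (fun n => ‖e n‖) ⟨0, by simp⟩
  have hmN : m ≤ N := by simpa [Nat.lt_succ_iff] using hm
  set Y := ‖e m‖ with hY
  have hY0 : 0 ≤ Y := norm_nonneg _
  set X := ∑ k ∈ Finset.range N, τ * (δ (k + 1) * a (k + 1)) with hX
  set X' := ∑ k ∈ Finset.range N, τ * (δ (k + 1) * ‖g (k + 1)‖) with hX'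
  have hX2 : X ^ 2 ≤ Δ * Sa := sq_sum_mul_mul_le τ N (fun k => δ (k + 1)) fun k => a (k + 1)
  have hX2' : X' ^ 2 ≤ Δ * Sg :=
    sq_sum_mul_mul_le τ N (fun k => δ (k + 1)) fun k => ‖g (k + 1)‖
  have hR : ∀ n ≤ N, ‖e n‖ ^ 2 + μ / 2 * ∑ k ∈ Finset.range n, τ * ‖g (k + 1)‖ ^ 2
      ≤ Y ^ 2 / 2 + 4 * E ^ 2 * Δ * Sa + μ / 8 * Sg := by
    intro n hn
    have h1 := hen n hn
    have h2 : ∑ k ∈ Finset.range n, τ * (δ (k + 1) * (a (k + 1) + ‖g (k + 1)‖) * ‖e (k + 1)‖)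
        ≤ (X + X') * Y := by
      have h3 : ∑ k ∈ Finset.range n, τ * (δ (k + 1) * (a (k + 1) + ‖g (k + 1)‖) * ‖e (k + 1)‖)
          ≤ ∑ k ∈ Finset.range N,
            τ * (δ (k + 1) * (a (k + 1) + ‖g (k + 1)‖) * ‖e (k + 1)‖) := by
        refine Finset.sum_le_sum_of_subset_of_nonneg (Finset.range_mono hn) fun k _ _ => ?_
        have := hδ0 (k + 1)
        have := ha0 (k + 1)
        positivity
      refine h3.trans ?_
      rw [hX, hX', ← Finset.sum_add_distrib, Finset.sum_mul]
      refine Finset.sum_le_sum fun k hk => ?_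
      have hk' : ‖e (k + 1)‖ ≤ Y := hmax (k + 1) (by
        have := Finset.mem_range.1 hk; simp; omega)
      have h4 := hδ0 (k + 1)
      have := ha0 (k + 1)
      have h5 : δ (k + 1) * (a (k + 1) + ‖g (k + 1)‖) * ‖e (k + 1)‖
        ≤ δ (k + 1) * (a (k + 1) + ‖g (k + 1)‖) * Y := by gcongr
      have := mul_le_mul_of_nonneg_left h5 hτ.le
      linarith
    have h3 := mul_le_mul_of_nonneg_left h2 (by positivity : 0 ≤ 2 * E)
    have h4 : 2 * E * X * Y ≤ Y ^ 2 / 4 + 4 * E ^ 2 * (Δ * Sa) := by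
      nlinarith [sq_nonneg (Y / 2 - 2 * E * X), mul_le_mul_of_nonneg_left hX2 (sq_nonneg E)]
    have h5 : 2 * E * X' * Y ≤ Y ^ 2 / 4 + 4 * E ^ 2 * (Δ * Sg) := by
      nlinarith [sq_nonneg (Y / 2 - 2 * E * X'), mul_le_mul_of_nonneg_left hX2' (sq_nonneg E)]
    -- The constant `32` turns `4 E² Δ Sg` into `μ / 8 * Sg`, a quarter of the available diffusion.
    have h6 := mul_le_mul_of_nonneg_right hsmall hSg0
    linarith
  have hY2 : Y ^ 2 ≤ 8 * E ^ 2 * Δ * Sa + μ / 4 * Sg := by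
    have h1 := hR m hmN
    have h2 : 0 ≤ μ / 2 * ∑ k ∈ Finset.range m, τ * ‖g (k + 1)‖ ^ 2 :=
      mul_nonneg (by positivity) (Finset.sum_nonneg fun _ _ => by positivity)
    linarith
  have hSgb : μ * Sg ≤ 32 * E ^ 2 * Δ * Sa := by
    have h1 := hR N le_rfl
    have h2 := sq_nonneg ‖e N‖
    linarith
  have hYb : Y ^ 2 ≤ 16 * E ^ 2 * Δ * Sa := by linarith
  refine ⟨fun n hn => ?_, hSgb⟩
  have hnY : ‖e n‖ ≤ Y := hmax n (by simp; omega)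
  refine le_trans ?_ hYb
  gcongr

set_option maxHeartbeats 1000000 in
/-- The difference of two Euler solutions, for close velocities. -/
theorem abs_sub_le_of_close_velocities {A B μ τ T M K Cu Cg : ℝ} {L : ℝ≥0} {N : ℕ}
    {w w' f : ℕ → ℝ → ℝ} {u₀ : ℝ → ℝ} {u u' : ℕ → ℝ → ℝ} {δ : ℕ → ℝ} (hAB : A ≤ B) (hμ : 0 < μ)
    (hτ : 0 < τ) (hT : N * τ = T) (hM : τ * M ^ 2 ≤ μ) (hMK : M ≤ K)
    (hwL : ∀ n ∈ Icc 1 N, LipschitzOnWith L (w n) (Ioo A B))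
    (hw : ∀ n ∈ Icc 1 N, AEStronglyMeasurable (w n) (volume.restrict (Ioo A B)))
    (hwM : ∀ n ∈ Icc 1 N, ∀ᵐ x ∂(volume.restrict (Ioo A B)), |w n x| ≤ M)
    (hw' : ∀ n ∈ Icc 1 N, AEStronglyMeasurable (w' n) (volume.restrict (Ioo A B)))
    (hwK' : ∀ n ∈ Icc 1 N, ∀ᵐ x ∂(volume.restrict (Ioo A B)), |w' n x| ≤ K)
    (hδ0 : ∀ n, 0 ≤ δ n)
    (hδ : ∀ n ∈ Icc 1 N, ∀ᵐ x ∂(volume.restrict (Ioo A B)), |w' n x - w n x| ≤ δ n)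
    (hf : ∀ n ∈ Icc 1 N, MemLp (f n) 2 (volume.restrict (Ioo A B)))
    (hu₀ : MemH10 A B u₀) (hu : IsEulerSolution A B μ τ N w f u₀ u)
    (hu' : IsEulerSolution A B μ τ N w' f u₀ u')
    (hCu : μ * ∑ k ∈ Finset.range N, τ * ‖toL2 A B (deriv (u (k + 1)))‖ ^ 2 ≤ Cu)
    (hCg : ∀ n ≤ N, μ ^ 2 * ‖toL2 A B (deriv (u n))‖ ^ 2 ≤ Cg)
    (hsmall : 32 * Real.exp (3 * L * T) ^ 2 * ∑ k ∈ Finset.range N, τ * δ (k + 1) ^ 2 ≤ μ) :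
    ∀ n ≤ N, ∀ x ∈ Icc A B, (μ * (u n x - u' n x)) ^ 2
      ≤ (16 * Real.exp (3 * L * T) ^ 2 * Cu + (Cg + 32 * K ^ 2 * Real.exp (3 * L * T) ^ 2 * Cu))
        * ∑ k ∈ Finset.range N, τ * δ (k + 1) ^ 2 := by
  obtain ⟨γ, hγ0, hγL, hτγ, hγ⟩ := exists_growth_rate (L := L) hAB hμ hτ hM
  set E := Real.exp (3 * L * T) with hE
  have hE0 : 0 < E := Real.exp_pos _
  set Δ := ∑ k ∈ Finset.range N, τ * δ (k + 1) ^ 2 with hΔ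
  have hΔ0 : 0 ≤ Δ := Finset.sum_nonneg fun _ _ => by positivity
  have hmem : ∀ n ≤ N, MemH10 A B (u n) := fun n hn => hu.memH10 hAB hu₀ hn
  have hmem' : ∀ n ≤ N, MemH10 A B (u' n) := fun n hn => hu'.memH10 hAB hu₀ hn
  have hwK : ∀ n ∈ Icc 1 N, ∀ᵐ x ∂(volume.restrict (Ioo A B)), |w n x| ≤ K := fun n hn => by
    filter_upwards [hwM n hn] with x hx using hx.trans hMK
  have hsubm : ∀ n ∈ Icc 1 N, AEStronglyMeasurable (fun x => w' n x - w n x)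
      (volume.restrict (Ioo A B)) := fun n hn => (hw' n hn).sub (hw n hn)
  let e : ℕ → Lp ℝ 2 (volume.restrict (Ioo A B)) := fun n => toL2 A B (fun x => u n x - u' n x)
  let g : ℕ → Lp ℝ 2 (volume.restrict (Ioo A B)) := fun n =>
    toL2 A B (deriv fun x => u n x - u' n x)
  let p : ℕ → Lp ℝ 2 (volume.restrict (Ioo A B)) := fun n =>
    toL2 A B (fun x => w n x * deriv (u n) x) - toL2 A B (fun x => w' n x * deriv (u' n) x)
  have he : ∀ n ≤ N, e n = toL2 A B (u n) - toL2 A B (u' n) := fun n hn =>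
    toL2_sub ((hmem n hn).memLp hAB) ((hmem' n hn).memLp hAB)
  have hg : ∀ n ≤ N, g n = toL2 A B (deriv (u n)) - toL2 A B (deriv (u' n)) := fun n hn =>
    (hmem n hn).toL2_deriv_sub (hmem' n hn) hAB
  have hz : ∀ x ∈ Icc A B, u 0 x = u' 0 x := fun x hx => by rw [hu.init x hx, hu'.init x hx]
  have he0 : e 0 = 0 := by
    rw [he 0 (Nat.zero_le _), toL2_congr ((ae_restrict_iff' measurableSet_Ioo).2
      (Eventually.of_forall fun x hx => hz x (Ioo_subset_Icc_self hx))), sub_self]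
  have hg0 : g 0 = 0 := by
    rw [hg 0 (Nat.zero_le _), toL2_congr (MemH10.deriv_congr_ae hz), sub_self]
  have hstep : ∀ n < N, ∀ v, MemH10 A B v → ⟪e (n + 1) - e n, toL2 A B v⟫_ℝ
      + τ * (⟪p (n + 1), toL2 A B v⟫_ℝ + μ * ⟪g (n + 1), toL2 A B (deriv v)⟫_ℝ) = 0 := by
    intro n hn v hv
    have h1 := hu.inner_eq hAB hτ (hu₀.memLp hAB) hf hw hwK hn hv
    have h2 := hu'.inner_eq hAB hτ (hu₀.memLp hAB) hf hw' hwK' hn hv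
    rw [he (n + 1) hn, he n hn.le, hg (n + 1) hn]
    simp only [p, inner_sub_left] at h1 h2 ⊢
    linarith
  have hmul : ∀ n ∈ Icc 1 N, ∀ y : ℝ → ℝ, MemLp y 2 (volume.restrict (Ioo A B)) →
      ‖toL2 A B (fun x => (w' n x - w n x) * y x)‖ ≤ δ n * ‖toL2 A B y‖ := fun n hn y hy =>
    norm_toL2_bddMul_le (hsubm n hn) (hδ n hn) hy
  -- In this splitting the error is carried by the Lipschitz velocity, as the energy estimate
  -- requires; the price is the gradient of `u'`.
  have hp1 : ∀ n ∈ Icc 1 N, p n = toL2 A B (fun x => w n x * deriv (fun x => u n x - u' n x) x)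
      - toL2 A B (fun x => (w' n x - w n x) * deriv (u' n) x) := by
    intro n hn
    have hu1 := (hmem n hn.2).2.1
    have hu2 := (hmem' n hn.2).2.1
    have hu3 := ((hmem n hn.2).sub (hmem' n hn.2) hAB).2.1
    simp only [p]
    rw [← toL2_sub (memLp_bddMul (hw n hn) (hwK n hn) hu1)
        (memLp_bddMul (hw' n hn) (hwK' n hn) hu2),
      ← toL2_sub (memLp_bddMul (hw n hn) (hwK n hn) hu3)
        (memLp_bddMul (hsubm n hn) (hδ n hn) hu2)]
    refine toL2_congr ?_
    filter_upwards [MemH10.deriv_sub_ae (hmem n hn.2).1 (hmem' n hn.2).1 hAB] with x hx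
    rw [hx]; ring
  -- In this splitting the source contains only the gradient of `u`, bounded at each time by `hCg`;
  -- the rougher velocity `w'` is harmless in the gradient estimate.
  have hp2 : ∀ n ∈ Icc 1 N, p n = toL2 A B (fun x => w' n x * deriv (fun x => u n x - u' n x) x)
      - toL2 A B (fun x => (w' n x - w n x) * deriv (u n) x) := by
    intro n hn
    have hu1 := (hmem n hn.2).2.1
    have hu2 := (hmem' n hn.2).2.1
    have hu3 := ((hmem n hn.2).sub (hmem' n hn.2) hAB).2.1
    simp only [p]
    rw [← toL2_sub (memLp_bddMul (hw n hn) (hwK n hn) hu1)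
        (memLp_bddMul (hw' n hn) (hwK' n hn) hu2),
      ← toL2_sub (memLp_bddMul (hw' n hn) (hwK' n hn) hu3)
        (memLp_bddMul (hsubm n hn) (hδ n hn) hu1)]
    refine toL2_congr ?_
    filter_upwards [MemH10.deriv_sub_ae (hmem n hn.2).1 (hmem' n hn.2).1 hAB] with x hx
    rw [hx]; ring
  have hmemd : ∀ n ≤ N, MemH10 A B (fun x => u n x - u' n x) := fun n hn =>
    (hmem n hn).sub (hmem' n hn) hAB
  let a : ℕ → ℝ := fun n => ‖toL2 A B (deriv (u n))‖
  have hen := energy_estimate (e := e) (g := g) (p := p)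
    (r := fun n => δ n * (a n + ‖g n‖) * ‖e n‖) (N := N) hτ hμ.le hγ0 hγL hτγ hT
    (fun n => by have := hδ0 n; positivity)
    (fun n hn => hstep n hn _ (hmemd (n + 1) hn))
    (fun n hn => by
      have hn1 : n + 1 ∈ Icc 1 N := ⟨by omega, hn⟩
      have h1 := hγ (w (n + 1)) _ (hwL _ hn1) (hw _ hn1) (hwM _ hn1) (hmemd (n + 1) hn)
      have h2 := real_inner_le_norm
        (toL2 A B (fun x => (w' (n + 1) x - w (n + 1) x) * deriv (u' (n + 1)) x)) (e (n + 1))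
      have h3 := hmul (n + 1) hn1 _ (hmem' (n + 1) hn).2.1
      have h4 : ‖toL2 A B (deriv (u' (n + 1)))‖ ≤ a (n + 1) + ‖g (n + 1)‖ := by
        have : toL2 A B (deriv (u' (n + 1))) = toL2 A B (deriv (u (n + 1))) - g (n + 1) := by
          rw [hg (n + 1) hn]; abel
        rw [this]; exact norm_sub_le _ _
      have h5 : ‖toL2 A B (fun x => (w' (n + 1) x - w (n + 1) x) * deriv (u' (n + 1)) x)‖
          * ‖e (n + 1)‖ ≤ δ (n + 1) * (a (n + 1) + ‖g (n + 1)‖) * ‖e (n + 1)‖ := by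
        have := hδ0 (n + 1)
        gcongr
        exact h3.trans (by gcongr)
      rw [hp1 (n + 1) hn1, inner_sub_left]
      linarith)
  rw [he0] at hen
  set Sa := ∑ k ∈ Finset.range N, τ * a (k + 1) ^ 2 with hSa
  set Sg := ∑ k ∈ Finset.range N, τ * ‖g (k + 1)‖ ^ 2 with hSg
  obtain ⟨hYb, hSgb⟩ := perturbation_energy_le (e := e) (g := g) (a := a) hμ hτ hE0 hδ0
    (fun n => norm_nonneg _) hsmall
    (fun n hn => by
      have h1 := hen n hn
      rwa [norm_zero, zero_pow two_ne_zero, zero_add] at h1)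
  have hμY : ∀ n ≤ N, μ * ‖e n‖ ^ 2 ≤ 16 * E ^ 2 * Cu * Δ := by
    intro n hn
    have h1 := mul_le_mul_of_nonneg_left (hYb n hn) hμ.le
    have h2 := mul_le_mul_of_nonneg_left hCu (by positivity : 0 ≤ 16 * E ^ 2 * Δ)
    linarith
  have hμSg : μ ^ 2 * Sg ≤ 32 * E ^ 2 * Cu * Δ := by
    have h1 := mul_le_mul_of_nonneg_left hSgb hμ.le
    have h2 := mul_le_mul_of_nonneg_left hCu (by positivity : 0 ≤ 32 * E ^ 2 * Δ)
    linarith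
  have hgrad := gradient_estimate (e := e) (g := g) (p := p) (κ := 0) (N := N) hτ hμ.le le_rfl
    (fun n hn => by
      have h1 := hstep n hn _ ((hmemd (n + 1) hn).sub (hmemd n hn.le) hAB)
      rw [(hmemd (n + 1) hn).toL2_deriv_sub (hmemd n hn.le) hAB,
        toL2_sub ((hmemd (n + 1) hn).memLp hAB) ((hmemd n hn.le).memLp hAB)] at h1
      rw [zero_mul, add_zero]
      exact h1)
  intro n hn x hx
  have hgn : μ ^ 3 * ‖g n‖ ^ 2 ≤ (Cg + 32 * K ^ 2 * E ^ 2 * Cu) * Δ := by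
    have h1 := hgrad n hn
    rw [hg0, norm_zero, zero_mul, zero_mul, add_zero] at h1
    have h2 : μ ^ 2 * (τ / 2 * ∑ k ∈ Finset.range n, ‖p (k + 1)‖ ^ 2)
        ≤ ∑ k ∈ Finset.range n, (Cg * (τ * δ (k + 1) ^ 2)
          + K ^ 2 * (μ ^ 2 * (τ * ‖g (k + 1)‖ ^ 2))) := by
      rw [Finset.mul_sum, Finset.mul_sum]
      refine Finset.sum_le_sum fun k hk => ?_
      have hkN : k < N := lt_of_lt_of_le (Finset.mem_range.1 hk) hn
      have hk1 : k + 1 ∈ Icc 1 N := ⟨by omega, hkN⟩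
      have h3 : ‖p (k + 1)‖ ≤ K * ‖g (k + 1)‖ + δ (k + 1) * a (k + 1) := by
        rw [hp2 (k + 1) hk1]
        exact (norm_sub_le _ _).trans (add_le_add
          (norm_toL2_bddMul_le (hw' _ hk1) (hwK' _ hk1) (hmemd (k + 1) hkN).2.1)
          (hmul (k + 1) hk1 _ (hmem (k + 1) hkN).2.1))
      have h4 : ‖p (k + 1)‖ ^ 2 ≤ (K * ‖g (k + 1)‖ + δ (k + 1) * a (k + 1)) ^ 2 := by gcongr
      have h5 : ‖p (k + 1)‖ ^ 2 ≤ 2 * (K ^ 2 * ‖g (k + 1)‖ ^ 2)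
          + 2 * (δ (k + 1) ^ 2 * a (k + 1) ^ 2) := by
        nlinarith [sq_nonneg (K * ‖g (k + 1)‖ - δ (k + 1) * a (k + 1))]
      have h6 := mul_le_mul_of_nonneg_left h5 (by positivity : 0 ≤ μ ^ 2 * (τ / 2))
      have h7 := mul_le_mul_of_nonneg_left (hCg (k + 1) hkN)
        (by positivity : 0 ≤ τ * δ (k + 1) ^ 2)
      simp only [a] at h6
      linarith
    rw [Finset.sum_add_distrib, ← Finset.mul_sum _ _ Cg, ← Finset.mul_sum _ _ (K ^ 2),
      ← Finset.mul_sum _ _ (μ ^ 2)] at h2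
    have hCg0 : 0 ≤ Cg := le_trans (by positivity) (hCg n hn)
    have h3 := mul_le_mul_of_nonneg_left
      (sum_range_le_sum_range hτ.le hn fun k => δ (k + 1)) hCg0
    have h4 := mul_le_mul_of_nonneg_left
      (sum_range_le_sum_range hτ.le hn fun k => ‖g (k + 1)‖) (by positivity : 0 ≤ K ^ 2 * μ ^ 2)
    have h5 := mul_le_mul_of_nonneg_left hμSg (sq_nonneg K)
    have h6 := mul_le_mul_of_nonneg_left h1 (sq_nonneg μ)
    linarith
  have hen3 := hμY n hn
  have hag := (hmemd n hn).sq_le hAB hx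
  have h1 := mul_le_mul_of_nonneg_left hag (sq_nonneg μ)
  -- The powers of `μ` are those of the two bounds: `μ ‖e‖²` and `μ³ ‖g‖²` are both of order `Δ`.
  have h2 : μ ^ 2 * (2 * ‖e n‖ * ‖g n‖) ≤ μ * ‖e n‖ ^ 2 + μ ^ 3 * ‖g n‖ ^ 2 := by
    nlinarith [mul_nonneg hμ.le (sq_nonneg (‖e n‖ - μ * ‖g n‖))]
  rw [mul_pow]
  linarith

/-! ### The error estimate -/

/-- `toReal` sends an infinite norm to `0`, so a bound on `normLinf` says something pointwise only
after membership in `L^∞` is known. -/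
theorem ae_abs_le_normLinf {l r : ℝ} {v : ℝ → ℝ} (hv : MemLp v ∞ (volume.restrict (Ioo l r))) :
    ∀ᵐ x ∂(volume.restrict (Ioo l r)), |v x| ≤ normLinf l r v := by
  have h1 : eLpNormEssSup v (volume.restrict (Ioo l r)) ≠ ∞ := by
    have := hv.2.ne
    rwa [eLpNorm_exponent_top] at this
  filter_upwards [enorm_ae_le_eLpNormEssSup v (volume.restrict (Ioo l r))] with x hx
  have h2 := ENNReal.toReal_mono h1 hx
  rw [normLinf, eLpNorm_exponent_top]
  simpa using h2

theorem normLinf_le {l r b : ℝ} {v : ℝ → ℝ} (hb : 0 ≤ b) (h : ∀ x ∈ Icc l r, |v x| ≤ b) :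
    normLinf l r v ≤ b := by
  rw [normLinf, eLpNorm_exponent_top]
  refine ENNReal.toReal_le_of_le_ofReal hb (eLpNormEssSup_le_of_ae_bound ?_)
  exact (ae_restrict_iff' measurableSet_Ioo).2
    (Eventually.of_forall fun x hx => h x (Ioo_subset_Icc_self hx))

theorem Grid.memLp_pcw {A B : ℝ} (G : Grid A B) (c : ℕ → ℝ) :
    MemLp (G.pcw c) ∞ (volume.restrict (Ioo A B)) := by
  refine memLp_top_of_bound (C := ∑ j ∈ Finset.range G.elems, |c j|) ?_
    (Eventually.of_forall fun x => ?_)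
  · refine Measurable.aestronglyMeasurable ?_
    unfold Grid.pcw
    exact Finset.measurable_sum _ fun j _ => measurable_const.indicator measurableSet_Ioo
  · unfold Grid.pcw
    refine (norm_sum_le _ _).trans (Finset.sum_le_sum fun j _ => ?_)
    exact (norm_indicator_le_norm_self _ _)

theorem memLp_top_of_lipschitzOnWith {A B : ℝ} {L : ℝ≥0} {w : ℝ → ℝ}
    (h : LipschitzOnWith L w (Ioo A B)) : MemLp w ∞ (volume.restrict (Ioo A B)) := by
  obtain ⟨w', hw', hEq⟩ := h.extend_real
  obtain ⟨C, hC⟩ := isCompact_Icc.exists_bound_of_continuousOn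
    (hw'.continuous.continuousOn (s := Icc A B))
  have h1 : MemLp w' ∞ (volume.restrict (Ioo A B)) :=
    memLp_top_of_bound hw'.continuous.aestronglyMeasurable C
      ((ae_restrict_iff' measurableSet_Ioo).2
        (Eventually.of_forall fun x hx => hC x (Ioo_subset_Icc_self hx)))
  exact h1.ae_eq ((ae_restrict_iff' measurableSet_Ioo).2
    (Eventually.of_forall fun x hx => (hEq hx).symm))

theorem sum_Icc_one_eq_sum_range (N : ℕ) (b : ℕ → ℝ) :
    ∑ n ∈ Finset.Icc 1 N, b n = ∑ k ∈ Finset.range N, b (k + 1) := by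
  rw [Finset.range_eq_Ico, Finset.sum_Ico_add' b 0 N 1]
  rfl

theorem seqL2_sq {N : ℕ} {τ : ℝ} (hτ : 0 ≤ τ) (b : ℕ → ℝ) :
    seqL2 N τ b ^ 2 = ∑ k ∈ Finset.range N, τ * b (k + 1) ^ 2 := by
  have h : 0 ≤ ∑ n ∈ Finset.Icc 1 N, b n ^ 2 := Finset.sum_nonneg fun _ _ => sq_nonneg _
  rw [seqL2, Real.sq_sqrt (by positivity), sum_Icc_one_eq_sum_range N (fun n => b n ^ 2),
    Finset.mul_sum]

/-- The threshold `32 E² Δ = μ` separates perturbation theory, with constant `C₁`, from the crude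
bound by the size of both solutions, with constant `C₃`. -/
theorem error_estimate {A B T M F Mmax D : ℝ} (hAB : A < B) (hT : 0 < T) {u₀ : ℝ → ℝ} (L : ℝ≥0)
    (hM : 0 ≤ M) (hD : 0 ≤ D) (hMmax : 0 < Mmax) (hu₀ : MemH10 A B u₀) :
    ∃ C : ℝ, 0 < C ∧
      ∀ (μ : ℝ) (N : ℕ) (G : Grid A B) (c : ℕ → ℕ → ℝ) (aN fN u U : ℕ → ℝ → ℝ),
        0 < μ → μ ≤ Mmax → 1 ≤ N → T / N * M ^ 2 ≤ μ →
        (∀ n ∈ Set.Icc 1 N, LipschitzOnWith L (aN n) (Ioo A B) ∧ normLinf A B (aN n) ≤ M) →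
        (∀ n ∈ Set.Icc 1 N, MemLp (fN n) 2 (volume.restrict (Ioo A B))) →
        seqL2 N (T / N) (fun n => normL2 A B (fN n)) ≤ F →
        (∀ n ∈ Set.Icc 1 N, normLinf A B (G.pcw (c n)) ≤ D * M) →
        IsEulerSolution A B μ (T / N) N aN fN u₀ u →
        IsEulerSolution A B μ (T / N) N (fun n => G.pcw (c n)) fN u₀ U →
        μ * seqLinf N (fun n => normLinf A B (fun x => u n x - U n x))
          ≤ C * seqL2 N (T / N) (fun n => normLinf A B (fun x => G.pcw (c n) x - aN n x)) := by
  obtain ⟨M₀, hM₀⟩ := isCompact_Icc.exists_bound_of_continuousOn (hu₀.continuousOn hAB.le)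
  have hM₀0 : 0 ≤ M₀ := (norm_nonneg _).trans (hM₀ A (left_mem_Icc.2 hAB.le))
  -- A common bound for both velocities; the summand `1` keeps it positive when `M = 0`.
  set K := (D + 1) * M + 1 with hK
  have hK0 : 0 < K := by positivity
  have hMK : M ≤ K := by nlinarith [mul_nonneg hD hM]
  have hDK : D * M ≤ K := by nlinarith
  set E := Real.exp (3 * L * T) with hE
  have hE0 : 0 < E := Real.exp_pos _
  set Cu := 2 * (2 * E * ‖toL2 A B u₀‖ ^ 2 + 4 * E ^ 2 * T * F ^ 2) with hCu
  have hCu0 : 0 ≤ Cu := by positivity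
  set Cg := Mmax ^ 2 * ‖toL2 A B (deriv u₀)‖ ^ 2 + M ^ 2 * Cu + Mmax * F ^ 2 with hCg
  have hCg0 : 0 ≤ Cg := by positivity
  set C₁ := Real.sqrt (16 * E ^ 2 * Cu + (Cg + 32 * K ^ 2 * E ^ 2 * Cu)) with hC₁
  set C₂ := 2 * (Real.sqrt Mmax * M₀ + Real.sqrt (6 * T * K * F ^ 2)
    + Real.sqrt Mmax * Real.sqrt (5 * F ^ 2 / K)) with hC₂
  have hC₂0 : 0 ≤ C₂ := by positivity
  set C₃ := C₂ * Real.sqrt (32 * E ^ 2) with hC₃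
  refine ⟨C₁ + C₃ + 1, by positivity, ?_⟩
  intro μ N G c aN fN u U hμ hμM hN hτM haN hfN hfF hc hu hU
  have hNpos : (0 : ℝ) < N := by exact_mod_cast hN
  set τ := T / N with hτdef
  have hτ : 0 < τ := by positivity
  have hNτ : N * τ = T := by rw [hτdef]; field_simp
  set δ : ℕ → ℝ := fun n => normLinf A B (fun x => G.pcw (c n) x - aN n x) with hδdef
  have hδ0 : ∀ n, 0 ≤ δ n := fun n => ENNReal.toReal_nonneg
  have haT : ∀ n ∈ Icc 1 N, MemLp (aN n) ∞ (volume.restrict (Ioo A B)) := fun n hn =>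
    memLp_top_of_lipschitzOnWith (haN n hn).1
  have hδ : ∀ n ∈ Icc 1 N, ∀ᵐ x ∂(volume.restrict (Ioo A B)), |G.pcw (c n) x - aN n x| ≤ δ n :=
    fun n hn => ae_abs_le_normLinf ((G.memLp_pcw (c n)).sub (haT n hn))
  have hw : ∀ n ∈ Icc 1 N, AEStronglyMeasurable (aN n) (volume.restrict (Ioo A B)) :=
    fun n hn => (haT n hn).1
  have hw' : ∀ n ∈ Icc 1 N, AEStronglyMeasurable (G.pcw (c n)) (volume.restrict (Ioo A B)) :=
    fun n _ => (G.memLp_pcw (c n)).1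
  have hwM : ∀ n ∈ Icc 1 N, ∀ᵐ x ∂(volume.restrict (Ioo A B)), |aN n x| ≤ M := fun n hn => by
    filter_upwards [ae_abs_le_normLinf (haT n hn)] with x hx using hx.trans (haN n hn).2
  have hwK : ∀ n ∈ Icc 1 N, ∀ᵐ x ∂(volume.restrict (Ioo A B)), |aN n x| ≤ K := fun n hn => by
    filter_upwards [hwM n hn] with x hx using hx.trans hMK
  have hwK' : ∀ n ∈ Icc 1 N, ∀ᵐ x ∂(volume.restrict (Ioo A B)), |G.pcw (c n) x| ≤ K :=
    fun n hn => by
      filter_upwards [ae_abs_le_normLinf (G.memLp_pcw (c n))] with x hx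
      exact hx.trans ((hc n hn).trans hDK)
  have hFsum : ∑ k ∈ Finset.range N, τ * ‖toL2 A B (fN (k + 1))‖ ^ 2 ≤ F ^ 2 := by
    have h1 : seqL2 N τ (fun n => normL2 A B (fN n)) ^ 2 ≤ F ^ 2 := by
      have : 0 ≤ seqL2 N τ (fun n => normL2 A B (fN n)) := Real.sqrt_nonneg _
      gcongr
    rw [seqL2_sq hτ.le] at h1
    refine le_trans (le_of_eq (Finset.sum_congr rfl fun k hk => ?_)) h1
    rw [norm_toL2 (hfN (k + 1) ⟨by omega, Finset.mem_range.1 hk⟩)]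
  set Δ := ∑ k ∈ Finset.range N, τ * δ (k + 1) ^ 2 with hΔ
  have hΔ0 : 0 ≤ Δ := Finset.sum_nonneg fun _ _ => by positivity
  have hseq : seqL2 N τ δ = Real.sqrt Δ := by
    have h0 : 0 ≤ seqL2 N τ δ := Real.sqrt_nonneg _
    rw [hΔ, ← seqL2_sq hτ.le, Real.sqrt_sq h0]
  rw [hseq]
  have key : ∀ n ≤ N, ∀ x ∈ Icc A B, μ * |u n x - U n x| ≤ (C₁ + C₃ + 1) * Real.sqrt Δ := by
    intro n hn x hx
    have hs0 := Real.sqrt_nonneg Δ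
    rcases le_or_gt (32 * E ^ 2 * Δ) μ with hsmall | hlarge
    · have hCu' : μ * ∑ k ∈ Finset.range N, τ * ‖toL2 A B (deriv (u (k + 1)))‖ ^ 2 ≤ Cu := by
        have := hu.energy_le hAB.le hμ hτ hT hNτ hτM (fun n hn => (haN n hn).1) hw hwM hfN
          hFsum hu₀
        rw [hCu]; linarith
      have hCg' : ∀ n ≤ N, μ ^ 2 * ‖toL2 A B (deriv (u n))‖ ^ 2 ≤ Cg := by
        intro n hn
        have h1 := hu.deriv_le hAB.le hμ hτ hw hwM hfN hFsum hu₀ hn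
        have h2 := mul_le_mul_of_nonneg_left h1 hμ.le
        have h3 := mul_le_mul_of_nonneg_left hCu' (sq_nonneg M)
        have h4 : μ ^ 2 * ‖toL2 A B (deriv u₀)‖ ^ 2 ≤ Mmax ^ 2 * ‖toL2 A B (deriv u₀)‖ ^ 2 := by
          gcongr
        have h5 : μ * F ^ 2 ≤ Mmax * F ^ 2 := by gcongr
        rw [hCg]
        linarith
      have h1 := abs_sub_le_of_close_velocities hAB.le hμ hτ hNτ hτM hMK
        (fun n hn => (haN n hn).1) hw hwM hw' hwK' hδ0 hδ hfN hu₀ hu hU hCu' hCg' hsmall n hn x hx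
      have h2 := Real.abs_le_sqrt h1
      rw [abs_mul, abs_of_pos hμ, Real.sqrt_mul (by positivity)] at h2
      have h3 : 0 ≤ C₃ * Real.sqrt Δ := by positivity
      change μ * _ ≤ C₁ * Real.sqrt Δ at h2
      linarith
    · have h1 := sup_stability hAB.le hμ hτ hK0 hNτ hw hwK hfN hFsum hu₀ hM₀ hu n hn x hx
      have h2 := sup_stability hAB.le hμ hτ hK0 hNτ hw' hwK' hfN hFsum hu₀ hM₀ hU n hn x hx
      have h3 : |u n x - U n x| ≤ |u n x| + |U n x| := abs_sub _ _
      have hsμ : Real.sqrt μ * Real.sqrt μ = μ := Real.mul_self_sqrt hμ.le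
      have hsμ0 : 0 < Real.sqrt μ := Real.sqrt_pos.2 hμ
      have hsM : Real.sqrt μ ≤ Real.sqrt Mmax := Real.sqrt_le_sqrt hμM
      have h4 : μ * Real.sqrt (6 * T * K * F ^ 2 / μ) = Real.sqrt μ * Real.sqrt (6 * T * K * F ^ 2) := by
        rw [Real.sqrt_div (by positivity)]
        nth_rewrite 1 [← hsμ]
        field_simp
      have h5 : μ * |u n x - U n x| ≤ Real.sqrt μ * C₂ := by
        have h6 : μ * M₀ ≤ Real.sqrt μ * (Real.sqrt Mmax * M₀) := by
          nth_rewrite 1 [← hsμ]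
          rw [mul_assoc]
          gcongr
        have h7 : μ * Real.sqrt (5 * F ^ 2 / K)
            ≤ Real.sqrt μ * (Real.sqrt Mmax * Real.sqrt (5 * F ^ 2 / K)) := by
          nth_rewrite 1 [← hsμ]
          rw [mul_assoc]
          gcongr
        have h8 := mul_le_mul_of_nonneg_left (h3.trans (add_le_add h1 h2)) hμ.le
        rw [hC₂]
        linarith
      -- Only here is the failure of smallness used: the factor `√μ` that the sup bounds leave over
      -- is itself controlled by the right-hand side.
      have h6 : Real.sqrt μ ≤ Real.sqrt (32 * E ^ 2) * Real.sqrt Δ := by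
        rw [← Real.sqrt_mul (by positivity)]
        exact Real.sqrt_le_sqrt hlarge.le
      have h7 := mul_le_mul_of_nonneg_right h6 hC₂0
      have h8 : 0 ≤ C₁ * Real.sqrt Δ := by positivity
      rw [hC₃]
      linarith
  have hb0 : 0 ≤ (C₁ + C₃ + 1) * Real.sqrt Δ := by positivity
  rw [mul_comm, ← le_div_iff₀ hμ, seqLinf]
  have : Nonempty (Set.Icc 1 N) := ⟨⟨1, ⟨le_rfl, hN⟩⟩⟩
  refine ciSup_le fun n => normLinf_le (by positivity) fun x hx => ?_
  rw [le_div_iff₀ hμ, mul_comm]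
  exact key n n.2.2 x hx

/-! ### Completeness of the cosines -/

section Cosine
variable {l r : ℝ} {g : ℝ → ℝ}

/-- `cos θ cos ((i + 1) θ)` is the mean of `cos ((i + 2) θ)` and `cos (i θ)`, so orthogonality to
all multiples of the angle passes to powers of the cosine. -/
theorem integral_mul_cos_pow_mul_cos (hg : IntervalIntegrable g volume l r)
    (h : ∀ j : ℕ, ∫ x in l..r, g x * Real.cos (j * (Real.pi * (x - l) / (r - l))) = 0) (m : ℕ) :
    ∀ j : ℕ, ∫ x in l..r, g x * (Real.cos (Real.pi * (x - l) / (r - l)) ^ m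
      * Real.cos (j * (Real.pi * (x - l) / (r - l)))) = 0 := by
  induction m with
  | zero => intro j; simpa using h j
  | succ m ih =>
    intro j
    cases j with
    | zero =>
      rw [← ih 1]
      refine intervalIntegral.integral_congr fun x _ => ?_
      simp only [Nat.cast_zero, zero_mul, Real.cos_zero, Nat.cast_one, one_mul, mul_one, pow_succ]
    | succ i =>
      have hi : ∀ k : ℕ, IntervalIntegrable (fun x => g x
          * (Real.cos (Real.pi * (x - l) / (r - l)) ^ m
            * Real.cos (k * (Real.pi * (x - l) / (r - l))))) volume l r := fun k =>
        hg.mul_continuousOn (Continuous.continuousOn (by fun_prop))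
      have h1 : ∫ x in l..r, g x * (Real.cos (Real.pi * (x - l) / (r - l)) ^ (m + 1)
            * Real.cos ((i + 1 : ℕ) * (Real.pi * (x - l) / (r - l))))
          = ∫ x in l..r, ((1 / 2) * (g x * (Real.cos (Real.pi * (x - l) / (r - l)) ^ m
            * Real.cos ((i + 2 : ℕ) * (Real.pi * (x - l) / (r - l)))))
            + (1 / 2) * (g x * (Real.cos (Real.pi * (x - l) / (r - l)) ^ m
            * Real.cos (i * (Real.pi * (x - l) / (r - l)))))) := by
        refine intervalIntegral.integral_congr fun x _ => ?_
        set θ := Real.pi * (x - l) / (r - l)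
        have e1 : ((i + 2 : ℕ) : ℝ) * θ = (i + 1 : ℕ) * θ + θ := by push_cast; ring
        have e2 : (i : ℝ) * θ = (i + 1 : ℕ) * θ - θ := by push_cast; ring
        simp only [e1, e2, Real.cos_add, Real.cos_sub]
        ring
      rw [h1, intervalIntegral.integral_add ((hi _).const_mul _) ((hi _).const_mul _),
        intervalIntegral.integral_const_mul, intervalIntegral.integral_const_mul, ih, ih]
      simp

theorem integral_mul_polynomial_cos (hg : IntervalIntegrable g volume l r)
    (h : ∀ j : ℕ, ∫ x in l..r, g x * Real.cos (j * (Real.pi * (x - l) / (r - l))) = 0)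
    (P : Polynomial ℝ) :
    ∫ x in l..r, g x * P.eval (Real.cos (Real.pi * (x - l) / (r - l))) = 0 := by
  simp only [Polynomial.eval_eq_sum_range, Finset.mul_sum]
  rw [intervalIntegral.integral_finsetSum]
  · refine Finset.sum_eq_zero fun m _ => ?_
    have h1 := integral_mul_cos_pow_mul_cos hg h m 0
    have h2 : ∫ x in l..r, g x * (P.coeff m * Real.cos (Real.pi * (x - l) / (r - l)) ^ m)
        = P.coeff m * ∫ x in l..r, g x * (Real.cos (Real.pi * (x - l) / (r - l)) ^ m
          * Real.cos ((0 : ℕ) * (Real.pi * (x - l) / (r - l)))) := by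
      rw [← intervalIntegral.integral_const_mul]
      refine intervalIntegral.integral_congr fun x _ => ?_
      simp only [Nat.cast_zero, zero_mul, Real.cos_zero, mul_one]
      ring
    rw [h2, h1, mul_zero]
  · intro m _
    exact hg.mul_continuousOn (Continuous.continuousOn (by fun_prop))

theorem integral_mul_continuous_eq_zero (hlr : l < r) (hg : IntervalIntegrable g volume l r)
    (h : ∀ j : ℕ, ∫ x in l..r, g x * Real.cos (j * (Real.pi * (x - l) / (r - l))) = 0)
    {ψ : ℝ → ℝ} (hψ : Continuous ψ) : ∫ x in l..r, g x * ψ x = 0 := by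
  have hh : 0 < r - l := sub_pos.2 hlr
  have hpi := Real.pi_pos
  set C := ∫ x in l..r, |g x| with hC
  have hC0 : 0 ≤ C := intervalIntegral.integral_nonneg hlr.le fun x _ => abs_nonneg _
  have key : ∀ ε > 0, |∫ x in l..r, g x * ψ x| ≤ C * ε := by
    intro ε hε
    -- On `[l, r]` the angle runs through `[0, π]`, where `arccos` inverts the cosine; so `ψ` is `χ`
    -- of the cosine, and Weierstrass approximates `χ` by polynomials.
    let χ : ℝ → ℝ := fun y => ψ (l + (r - l) / Real.pi * Real.arccos y)
    have hχ : Continuous χ := by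
      have := Real.continuous_arccos
      fun_prop
    obtain ⟨P, hP⟩ := exists_polynomial_near_of_continuousOn (-1) 1 χ hχ.continuousOn ε hε
    have hi1 : IntervalIntegrable (fun x => g x * ψ x) volume l r :=
      hg.mul_continuousOn hψ.continuousOn
    have hi2 : IntervalIntegrable
        (fun x => g x * P.eval (Real.cos (Real.pi * (x - l) / (r - l)))) volume l r :=
      hg.mul_continuousOn (Continuous.continuousOn
        (P.continuous.comp (by fun_prop)))
    have h1 : ∫ x in l..r, g x * ψ x = ∫ x in l..r,
        (g x * ψ x - g x * P.eval (Real.cos (Real.pi * (x - l) / (r - l)))) := by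
      rw [intervalIntegral.integral_sub hi1 hi2, integral_mul_polynomial_cos hg h P, sub_zero]
    rw [h1, hC, ← intervalIntegral.integral_mul_const]
    refine (intervalIntegral.abs_integral_le_integral_abs hlr.le).trans
      (intervalIntegral.integral_mono_on hlr.le (hi1.sub hi2).abs (hg.abs.mul_const _) ?_)
    intro x hx
    have e1 : χ (Real.cos (Real.pi * (x - l) / (r - l))) = ψ x := by
      simp only [χ]
      rw [Real.arccos_cos]
      · congr 1; field_simp; ring
      · have := sub_nonneg.2 hx.1; positivity
      · rw [div_le_iff₀ hh]; nlinarith [hx.2]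
    have h2 := hP (Real.cos (Real.pi * (x - l) / (r - l)))
      ⟨Real.neg_one_le_cos _, Real.cos_le_one _⟩
    rw [e1] at h2
    rw [← mul_sub, abs_mul, abs_sub_comm]
    gcongr
  by_contra hne
  have hpos := abs_pos.2 hne
  have h1 := key (|∫ x in l..r, g x * ψ x| / (C + 1)) (by positivity)
  rw [← mul_div_assoc, le_div_iff₀ (by positivity)] at h1
  nlinarith

theorem ae_eq_zero_of_integral_mul_cos (hlr : l < r) (hg : IntervalIntegrable g volume l r)
    (h : ∀ j : ℕ, ∫ x in l..r, g x * Real.cos (j * (Real.pi * (x - l) / (r - l))) = 0) :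
    ∀ᵐ x ∂(volume.restrict (Ioo l r)), g x = 0 := by
  rw [ae_restrict_iff' measurableSet_Ioo]
  have hgi : IntegrableOn g (Ioo l r) := (intervalIntegrable_iff_integrableOn_Ioo_of_le hlr.le).1 hg
  refine isOpen_Ioo.ae_eq_zero_of_integral_contDiff_smul_eq_zero hgi.locallyIntegrableOn
    fun ψ hψ _ hs => ?_
  rw [← integral_mul_continuous_eq_zero hlr hg h hψ.continuous,
    intervalIntegral.integral_of_le hlr.le, integral_Ioc_eq_integral_Ioo,
    ← setIntegral_eq_integral_of_forall_compl_eq_zero (s := Ioo l r)]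
  · simp [mul_comm]
  · intro x hx
    have : ψ x = 0 := image_eq_zero_of_notMem_tsupport fun h => hx (hs h)
    simp [this]

/-- The frequency is an integer rather than a natural number because differences of indices occur in
the biorthogonality relation. -/
theorem integral_cos_eq_zero (hlr : l < r) {j : ℤ} (hj : j ≠ 0) :
    ∫ x in l..r, Real.cos (j * (Real.pi * (x - l) / (r - l))) = 0 := by
  have hh : r - l ≠ 0 := (sub_pos.2 hlr).ne'
  have hpi := Real.pi_ne_zero
  have hj' : (j : ℝ) ≠ 0 := by exact_mod_cast hj
  have hd : ∀ x ∈ uIcc l r, HasDerivAt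
      (fun x => (r - l) / (j * Real.pi) * Real.sin (j * (Real.pi * (x - l) / (r - l))))
      (Real.cos (j * (Real.pi * (x - l) / (r - l)))) x := by
    intro x _
    have h1 : HasDerivAt (fun x : ℝ => j * (Real.pi * (x - l) / (r - l)))
        (j * (Real.pi * 1 / (r - l))) x :=
      ((((hasDerivAt_id x).sub_const l).const_mul Real.pi).div_const (r - l)).const_mul _
    convert! (h1.sin.const_mul ((r - l) / (j * Real.pi))) using 1
    field_simp
  rw [intervalIntegral.integral_eq_sub_of_hasDerivAt hd
    (Continuous.intervalIntegrable (by fun_prop) _ _)]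
  rw [mul_div_assoc, div_self hh, mul_one, Real.sin_int_mul_pi]
  simp

/-- Subtracting the mean supplies the missing frequency `0` and does not affect the others. -/
theorem ae_eq_const_of_integral_mul_cos (hlr : l < r) (hg : IntervalIntegrable g volume l r)
    (h : ∀ j : ℕ, 1 ≤ j →
      ∫ x in l..r, g x * Real.cos (j * (Real.pi * (x - l) / (r - l))) = 0) :
    ∃ c, ∀ᵐ x ∂(volume.restrict (Ioo l r)), g x = c := by
  have hh : r - l ≠ 0 := (sub_pos.2 hlr).ne'
  set c := (∫ x in l..r, g x) / (r - l) with hc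
  refine ⟨c, ?_⟩
  have h1 := ae_eq_zero_of_integral_mul_cos (g := fun x => g x - c) hlr
    (hg.sub intervalIntegrable_const) fun j => ?_
  · filter_upwards [h1] with x hx using sub_eq_zero.1 hx
  · simp only [sub_mul]
    rw [intervalIntegral.integral_sub (hg.mul_continuousOn (Continuous.continuousOn (by fun_prop)))
      (Continuous.intervalIntegrable (by fun_prop) _ _), intervalIntegral.integral_const_mul]
    rcases Nat.eq_zero_or_pos j with rfl | hj
    · simp [hc]; field_simp; simp
    · have h2 := integral_cos_eq_zero hlr (j := (j : ℤ)) (by exact_mod_cast hj.ne')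
      rw [Int.cast_natCast] at h2
      rw [h j hj, h2]; simp

end Cosine

/-! ### Functionals on `H¹₀` that vanish on the eigenfunctions -/

section Functional
variable {l r : ℝ}

theorem memH10_of_contDiff {v : ℝ → ℝ} (hv : ContDiff ℝ 1 v) (hl : v l = 0) (hr : v r = 0) :
    MemH10 l r v :=
  ⟨hv.contDiffOn.absolutelyContinuousOnInterval,
    memLp_of_continuousOn (hv.continuous_deriv le_rfl).continuousOn, hl, hr⟩

/-- With `Φ` a primitive of `F`, the functional is `∫ (G - Φ) v'`. The derivatives of the sines are
the cosines of positive frequency, so `G - Φ` is constant and annihilates the derivative of every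
element of `H¹₀`. Density of the sines in `H¹₀` is thus obtained from completeness of the cosines.
-/
theorem functional_eq_zero_of_sin (hlr : l < r) {F G : ℝ → ℝ}
    (hF : MemLp F 2 (volume.restrict (Ioo l r))) (hG : MemLp G 2 (volume.restrict (Ioo l r)))
    (h : ∀ j : ℕ, 1 ≤ j → ip l r F (fun x => Real.sin (j * (Real.pi * (x - l) / (r - l))))
      + ip l r G (deriv fun x => Real.sin (j * (Real.pi * (x - l) / (r - l)))) = 0)
    {φ : ℝ → ℝ} (hφ : MemH10 l r φ) : ip l r F φ + ip l r G (deriv φ) = 0 := by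
  have hh : r - l ≠ 0 := (sub_pos.2 hlr).ne'
  have hFi : IntervalIntegrable F volume l r :=
    (intervalIntegrable_iff_integrableOn_Ioo_of_le hlr.le).2 (hF.integrable (by norm_num))
  have hGi : IntervalIntegrable G volume l r :=
    (intervalIntegrable_iff_integrableOn_Ioo_of_le hlr.le).2 (hG.integrable (by norm_num))
  set Φ : ℝ → ℝ := fun x => ∫ y in l..x, F y with hΦ
  have hac : AbsolutelyContinuousOnInterval Φ l r :=
    hFi.absolutelyContinuousOnInterval_intervalIntegral (by simp)
  have hΦc : ContinuousOn Φ (Icc l r) := by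
    have := hac.continuousOn
    rwa [uIcc_of_le hlr.le] at this
  have hΦ2 := memLp_of_continuousOn hΦc
  have hΦi : IntervalIntegrable Φ volume l r := hac.continuousOn.intervalIntegrable
  have hder : ∀ᵐ x, x ∈ uIoc l r → deriv Φ x = F x := by
    filter_upwards [hFi.ae_hasDerivAt_integral] with x hx hx'
    exact (hx (uIoc_subset_uIcc hx') l (by simp)).deriv
  have hparts : ∀ v, MemH10 l r v →
      ip l r F v + ip l r G (deriv v) = ∫ x in l..r, (G x - Φ x) * deriv v x := by
    intro v hv
    have h1 := hac.integral_mul_deriv_eq_deriv_mul hv.1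
    rw [hv.2.2.1, hv.2.2.2] at h1
    have h2 : ∫ x in l..r, deriv Φ x * v x = ip l r F v := by
      refine intervalIntegral.integral_congr_ae ?_
      filter_upwards [hder] with x hx hx'
      rw [hx hx']
    rw [h2] at h1
    have i1 : IntervalIntegrable (fun x => G x * deriv v x) volume l r :=
      (intervalIntegrable_iff_integrableOn_Ioo_of_le hlr.le).2 (hG.integrable_mul hv.2.1)
    have i2 : IntervalIntegrable (fun x => Φ x * deriv v x) volume l r :=
      (intervalIntegrable_iff_integrableOn_Ioo_of_le hlr.le).2 (hΦ2.integrable_mul hv.2.1)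
    simp only [sub_mul]
    rw [intervalIntegral.integral_sub i1 i2, h1, ip]
    simp [ip]
    ring
  have hsin : ∀ j : ℕ, MemH10 l r (fun x => Real.sin (j * (Real.pi * (x - l) / (r - l)))) := by
    intro j
    refine memH10_of_contDiff (by fun_prop) (by simp) ?_
    rw [mul_div_assoc, div_self hh, mul_one, Real.sin_nat_mul_pi]
  have hpi := Real.pi_ne_zero
  obtain ⟨c, hc⟩ := ae_eq_const_of_integral_mul_cos (g := fun x => G x - Φ x) hlr (hGi.sub hΦi)
    (fun j hj => by
      have h1 := h j hj
      rw [hparts _ (hsin j)] at h1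
      have hd : deriv (fun x => Real.sin (j * (Real.pi * (x - l) / (r - l))))
          = fun x => Real.cos (j * (Real.pi * (x - l) / (r - l))) * (j * Real.pi / (r - l)) := by
        funext x
        have h1 : HasDerivAt (fun x : ℝ => j * (Real.pi * (x - l) / (r - l)))
            (j * (Real.pi * 1 / (r - l))) x :=
          ((((hasDerivAt_id x).sub_const l).const_mul Real.pi).div_const (r - l)).const_mul _
        rw [h1.sin.deriv]; ring
      rw [hd] at h1
      simp only [← mul_assoc] at h1
      rw [intervalIntegral.integral_mul_const] at h1
      have hj' : (j : ℝ) ≠ 0 := by exact_mod_cast (by omega : j ≠ 0)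
      have hne : (j : ℝ) * Real.pi / (r - l) ≠ 0 := by positivity
      simpa only [← mul_assoc] using (mul_eq_zero.1 h1).resolve_right hne)
  rw [hparts φ hφ]
  have h2 : ∫ x in l..r, (G x - Φ x) * deriv φ x = ∫ x in l..r, c * deriv φ x := by
    rw [intervalIntegral.integral_of_le hlr.le, intervalIntegral.integral_of_le hlr.le,
      integral_Ioc_eq_integral_Ioo, integral_Ioc_eq_integral_Ioo]
    refine integral_congr_ae ?_
    filter_upwards [hc] with x hx
    rw [hx]
  rw [h2, intervalIntegral.integral_const_mul, hφ.1.integral_deriv_eq_sub, hφ.2.2.1, hφ.2.2.2]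
  simp

theorem MemH10.exp_mul {v : ℝ → ℝ} (hv : MemH10 l r v) (hlr : l ≤ r) (c : ℝ) :
    MemH10 l r (fun x => Real.exp (c * (x - l)) * v x) ∧
    ∀ᵐ x ∂(volume.restrict (Ioo l r)), deriv (fun x => Real.exp (c * (x - l)) * v x) x
      = Real.exp (c * (x - l)) * (c * v x + deriv v x) := by
  have hE : ContDiff ℝ 1 fun x => Real.exp (c * (x - l)) := by fun_prop
  have hd : ∀ᵐ x ∂(volume.restrict (Ioo l r)), deriv (fun x => Real.exp (c * (x - l)) * v x) x
      = Real.exp (c * (x - l)) * (c * v x + deriv v x) := by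
    filter_upwards [ae_differentiableAt_of_absolutelyContinuous hv.1 hlr] with x hx
    have h1 : HasDerivAt (fun x : ℝ => c * (x - l)) (c * 1) x :=
      ((hasDerivAt_id x).sub_const l).const_mul c
    rw [(h1.exp.fun_mul hx.hasDerivAt).deriv]; ring
  refine ⟨⟨hE.contDiffOn.absolutelyContinuousOnInterval.fun_mul hv.1, ?_, by simp [hv.2.2.1],
    by simp [hv.2.2.2]⟩, hd⟩
  have h1 : MemLp (fun x => c * v x + deriv v x) 2 (volume.restrict (Ioo l r)) :=
    ((hv.memLp hlr).const_mul c).add hv.2.1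
  obtain ⟨K, hK⟩ := isCompact_Icc.exists_bound_of_continuousOn
    (hE.continuous.continuousOn (s := Icc l r))
  exact (memLp_bddMul hE.continuous.aestronglyMeasurable
    ((ae_restrict_iff' measurableSet_Ioo).2 (Eventually.of_forall fun x hx =>
      hK x (Ioo_subset_Icc_self hx))) h1).ae_eq (hd.mono fun x hx => hx.symm)

/-- Multiplication by the exponential is a bijection of `H¹₀`. Pulled back along it, the functional
again has the form treated for pure sines, with coefficients `exp · (P - c Q)` and `exp · Q`. -/
theorem functional_eq_zero_of_exp_mul_sin (hlr : l < r) (c : ℝ)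
    (P Q : Lp ℝ 2 (volume.restrict (Ioo l r)))
    (h : ∀ j : ℕ, 1 ≤ j → ∀ v, (v = fun x => Real.exp (-c * (x - l))
        * Real.sin (j * (Real.pi * (x - l) / (r - l)))) →
      ⟪P, toL2 l r v⟫_ℝ + ⟪Q, toL2 l r (deriv v)⟫_ℝ = 0)
    {v : ℝ → ℝ} (hv : MemH10 l r v) : ⟪P, toL2 l r v⟫_ℝ + ⟪Q, toL2 l r (deriv v)⟫_ℝ = 0 := by
  have hE : Continuous fun x => Real.exp (-c * (x - l)) := by fun_prop
  obtain ⟨K, hK⟩ := isCompact_Icc.exists_bound_of_continuousOn (hE.continuousOn (s := Icc l r))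
  have hKae : ∀ᵐ x ∂(volume.restrict (Ioo l r)), |Real.exp (-c * (x - l))| ≤ K :=
    (ae_restrict_iff' measurableSet_Ioo).2 (Eventually.of_forall fun x hx =>
      hK x (Ioo_subset_Icc_self hx))
  have hP := Lp.memLp P
  have hQ := Lp.memLp Q
  have hG : MemLp (fun x => Real.exp (-c * (x - l)) * Q x) 2 (volume.restrict (Ioo l r)) :=
    memLp_bddMul hE.aestronglyMeasurable hKae hQ
  have hF : MemLp (fun x => Real.exp (-c * (x - l)) * (P x - c * Q x)) 2
      (volume.restrict (Ioo l r)) :=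
    memLp_bddMul hE.aestronglyMeasurable hKae (hP.sub (hQ.const_mul c))
  have trans : ∀ φ, MemH10 l r φ →
      ip l r (fun x => Real.exp (-c * (x - l)) * (P x - c * Q x)) φ
        + ip l r (fun x => Real.exp (-c * (x - l)) * Q x) (deriv φ)
      = ⟪P, toL2 l r (fun x => Real.exp (-c * (x - l)) * φ x)⟫_ℝ
        + ⟪Q, toL2 l r (deriv fun x => Real.exp (-c * (x - l)) * φ x)⟫_ℝ := by
    intro φ hφ
    obtain ⟨hm, hd⟩ := hφ.exp_mul hlr.le (-c)
    have e1 : ⟪P, toL2 l r (fun x => Real.exp (-c * (x - l)) * φ x)⟫_ℝ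
        = ip l r P (fun x => Real.exp (-c * (x - l)) * φ x) := by
      rw [← inner_toL2 hlr.le hP (hm.memLp hlr.le), toL2_coeFn]
    have e2 : ⟪Q, toL2 l r (deriv fun x => Real.exp (-c * (x - l)) * φ x)⟫_ℝ
        = ip l r Q (deriv fun x => Real.exp (-c * (x - l)) * φ x) := by
      rw [← inner_toL2 hlr.le hQ hm.2.1, toL2_coeFn]
    have i1 : Integrable (fun x => Real.exp (-c * (x - l)) * (P x - c * Q x) * φ x)
        (volume.restrict (Ioo l r)) := hF.integrable_mul (hφ.memLp hlr.le)
    have i2 : Integrable (fun x => Real.exp (-c * (x - l)) * Q x * deriv φ x)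
        (volume.restrict (Ioo l r)) := hG.integrable_mul hφ.2.1
    have i3 : Integrable (fun x => P x * (Real.exp (-c * (x - l)) * φ x))
        (volume.restrict (Ioo l r)) := hP.integrable_mul (hm.memLp hlr.le)
    have i4 : Integrable (fun x => Q x * deriv (fun x => Real.exp (-c * (x - l)) * φ x) x)
        (volume.restrict (Ioo l r)) := hQ.integrable_mul hm.2.1
    rw [e1, e2, ip_eq_setIntegral hlr.le, ip_eq_setIntegral hlr.le, ip_eq_setIntegral hlr.le,
      ip_eq_setIntegral hlr.le, ← integral_add i1 i2, ← integral_add i3 i4]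
    refine integral_congr_ae ?_
    filter_upwards [hd] with x hx
    rw [hx]; ring
  have hh : r - l ≠ 0 := (sub_pos.2 hlr).ne'
  have hsin : ∀ j : ℕ, MemH10 l r (fun x => Real.sin (j * (Real.pi * (x - l) / (r - l)))) := by
    intro j
    refine memH10_of_contDiff (by fun_prop) (by simp) ?_
    rw [mul_div_assoc, div_self hh, mul_one, Real.sin_nat_mul_pi]
  obtain ⟨hm, -⟩ := hv.exp_mul hlr.le c
  have h1 := functional_eq_zero_of_sin hlr hF hG (fun j hj => by
    rw [trans _ (hsin j)]
    exact h j hj _ rfl) hm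
  rw [trans _ hm] at h1
  have e : (fun x => Real.exp (-c * (x - l)) * (Real.exp (c * (x - l)) * v x)) = v := by
    funext x
    rw [← mul_assoc, ← Real.exp_add]
    simp
  rwa [e] at h1

end Functional

/-! ### The sub-grid equation on one interval -/

section Subgrid
variable {l r a μ τ : ℝ}

/-- The dual eigenfunction `p z_j`. -/
theorem weight_mul_eigFun (hμ : μ ≠ 0) (j : ℕ) :
    (fun x => weight l a μ x * eigFun l r a μ j x) = fun x => Real.sqrt (2 / (r - l)) *
      (Real.exp (-(a / (2 * μ)) * (x - l)) * Real.sin (j * (Real.pi * (x - l) / (r - l)))) := by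
  funext x
  have e1 : Real.exp (-(a / (2 * μ)) * (x - l))
      = Real.exp (-(a * (x - l) / μ)) * Real.exp (a * (x - l) / (2 * μ)) := by
    rw [← Real.exp_add]; congr 1; field_simp; ring
  have e2 : (j : ℝ) * (Real.pi * (x - l) / (r - l)) = j * Real.pi * (x - l) / (r - l) := by ring
  rw [weight, eigFun, e1, e2]; ring

theorem contDiff_expSin (c s : ℝ) (j : ℕ) : ContDiff ℝ 1 fun x => s *
      (Real.exp (-c * (x - l)) * Real.sin (j * (Real.pi * (x - l) / (r - l)))) := by
  fun_prop

theorem memH10_weight_mul_eigFun (hlr : l < r) (hμ : μ ≠ 0) (j : ℕ) :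
    MemH10 l r (fun x => weight l a μ x * eigFun l r a μ j x) := by
  have hh : r - l ≠ 0 := (sub_pos.2 hlr).ne'
  rw [weight_mul_eigFun hμ]
  refine memH10_of_contDiff (contDiff_expSin _ _ j) (by simp) ?_
  rw [mul_div_assoc, div_self hh, mul_one, Real.sin_nat_mul_pi]
  simp

theorem bForm_const (w v : ℝ → ℝ) : bForm l r (fun _ => a) μ w v
    = a * ip l r (deriv w) v + μ * ip l r (deriv w) (deriv v) := by
  rw [bForm]
  congr 1
  rw [ip, ip, ← intervalIntegral.integral_const_mul]
  exact intervalIntegral.integral_congr fun x _ => by ring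

/-- `q = p z_j` is an eigenfunction of the adjoint: `(a q + μ q')' = -λ_j q`. One integration by
parts against `w`, which vanishes at the ends, gives the identity. -/
theorem bForm_weight_mul_eigFun (hlr : l < r) (hμ : 0 < μ) (j : ℕ) {w : ℝ → ℝ}
    (hw : MemH10 l r w) :
    bForm l r (fun _ => a) μ w (fun x => weight l a μ x * eigFun l r a μ j x)
      = eigVal l r a μ j * ip l r w (fun x => weight l a μ x * eigFun l r a μ j x) := by
  have hh : r - l ≠ 0 := (sub_pos.2 hlr).ne'
  rw [bForm_const, weight_mul_eigFun hμ.ne']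
  set s := Real.sqrt (2 / (r - l))
  set c := a / (2 * μ) with hc
  set k := (j : ℝ) * Real.pi / (r - l) with hk
  have harg : ∀ x, (j : ℝ) * (Real.pi * (x - l) / (r - l)) = k * (x - l) := fun x => by
    rw [hk]; ring
  simp only [harg]
  set q : ℝ → ℝ := fun x => s * (Real.exp (-c * (x - l)) * Real.sin (k * (x - l))) with hq
  have hlin : ∀ (b x : ℝ), HasDerivAt (fun x : ℝ => b * (x - l)) b x := fun b x => by
    simpa using ((hasDerivAt_id x).sub_const l).const_mul b
  have hq' : ∀ x, HasDerivAt q (s * (Real.exp (-c * (x - l)) *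
      (k * Real.cos (k * (x - l)) - c * Real.sin (k * (x - l))))) x := fun x => by
    convert! (((hlin (-c) x).exp.fun_mul (hlin k x).sin).const_mul s) using 1
    ring
  have hdq : deriv q = fun x => s * (Real.exp (-c * (x - l)) *
      (k * Real.cos (k * (x - l)) - c * Real.sin (k * (x - l)))) := funext fun x => (hq' x).deriv
  set ψ : ℝ → ℝ := fun x => a * q x + μ * deriv q x with hψ
  have hψ' : ∀ x, HasDerivAt ψ (-(eigVal l r a μ j * q x)) x := fun x => by
    have h2 : HasDerivAt (deriv q) (s * (Real.exp (-c * (x - l)) *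
        (-(2 * c * k) * Real.cos (k * (x - l)) + (c ^ 2 - k ^ 2) * Real.sin (k * (x - l))))) x := by
      rw [hdq]
      convert! (((hlin (-c) x).exp.fun_mul (((hlin k x).cos.const_mul k).fun_sub
        ((hlin k x).sin.const_mul c))).const_mul s) using 1
      ring
    convert! ((hq' x).const_mul a).fun_add (h2.const_mul μ) using 1
    rw [eigVal, ← hk, hq]
    have ha : a = 2 * μ * c := by rw [hc]; field_simp
    rw [ha]
    field_simp
    ring
  have hqc : ContDiff ℝ 2 q := by rw [hq]; fun_prop
  have hψc : ContDiff ℝ 1 ψ := by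
    have h1 : ContDiff ℝ 1 (deriv q) := by rw [hdq]; fun_prop
    have h2 : ContDiff ℝ 1 q := hqc.of_le (by norm_num)
    rw [hψ]; fun_prop
  have hparts := hw.1.integral_mul_deriv_eq_deriv_mul
    (hψc.contDiffOn.absolutelyContinuousOnInterval (a := l) (b := r))
  rw [hw.2.2.1, hw.2.2.2, zero_mul, zero_mul, sub_zero, zero_sub] at hparts
  have hdψ : deriv ψ = fun x => -(eigVal l r a μ j * q x) := funext fun x => (hψ' x).deriv
  have hi := hw.1.intervalIntegrable_deriv
  have hdqc : Continuous (deriv q) := hqc.continuous_deriv (by norm_num)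
  have i1 : IntervalIntegrable (fun x => deriv w x * q x) volume l r :=
    hi.mul_continuousOn hqc.continuous.continuousOn
  have i2 : IntervalIntegrable (fun x => deriv w x * deriv q x) volume l r :=
    hi.mul_continuousOn hdqc.continuousOn
  have e1 : ∫ x in l..r, deriv w x * ψ x
      = a * ip l r (deriv w) q + μ * ip l r (deriv w) (deriv q) := by
    rw [ip, ip, ← intervalIntegral.integral_const_mul, ← intervalIntegral.integral_const_mul,
      ← intervalIntegral.integral_add (i1.const_mul _) (i2.const_mul _)]
    exact intervalIntegral.integral_congr fun x _ => by simp only [hψ]; ring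
  have e2 : ∫ x in l..r, w x * deriv ψ x = -(eigVal l r a μ j * ip l r w q) := by
    rw [ip, ← intervalIntegral.integral_const_mul, ← intervalIntegral.integral_neg, hdψ]
    exact intervalIntegral.integral_congr fun x _ => by ring
  linarith

/-- The weight cancels both exponentials, leaving the orthogonality of the sines; the product of
sines is written as a difference of cosines. -/
theorem ip_eigFun_weight_mul_eigFun (hlr : l < r) (hμ : 0 < μ) {i j : ℕ} (hj : 1 ≤ j) :
    ip l r (eigFun l r a μ i) (fun x => weight l a μ x * eigFun l r a μ j x)
      = if i = j then 1 else 0 := by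
  have hh : 0 < r - l := sub_pos.2 hlr
  have h1 : ip l r (eigFun l r a μ i) (fun x => weight l a μ x * eigFun l r a μ j x)
      = ∫ x in l..r, (1 / (r - l)) * (Real.cos (((i : ℤ) - j : ℤ) * (Real.pi * (x - l) / (r - l)))
        - Real.cos (((i : ℤ) + j : ℤ) * (Real.pi * (x - l) / (r - l)))) := by
    refine intervalIntegral.integral_congr fun x _ => ?_
    have e0 : Real.sqrt (2 / (r - l)) * Real.sqrt (2 / (r - l)) = 2 / (r - l) :=
      Real.mul_self_sqrt (by positivity)
    have e1 : Real.exp (a * (x - l) / (2 * μ)) * Real.exp (a * (x - l) / (2 * μ))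
        * Real.exp (-(a * (x - l) / μ)) = 1 := by
      rw [← Real.exp_add, ← Real.exp_add, ← Real.exp_zero]; congr 1; field_simp; ring
    simp only [weight, eigFun]
    have e2 : ∀ k : ℕ, (k : ℝ) * Real.pi * (x - l) / (r - l)
      = k * (Real.pi * (x - l) / (r - l)) := fun k => by ring
    rw [e2, e2]
    push_cast
    rw [sub_mul, add_mul, Real.cos_sub, Real.cos_add]
    linear_combination (Real.exp (a * (x - l) / (2 * μ)) * Real.exp (a * (x - l) / (2 * μ))
        * Real.exp (-(a * (x - l) / μ)) * Real.sin (i * (Real.pi * (x - l) / (r - l)))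
        * Real.sin (j * (Real.pi * (x - l) / (r - l)))) * e0
      + 2 / (r - l) * Real.sin (i * (Real.pi * (x - l) / (r - l)))
        * Real.sin (j * (Real.pi * (x - l) / (r - l))) * e1
  rw [h1, intervalIntegral.integral_const_mul, intervalIntegral.integral_sub
    (Continuous.intervalIntegrable (by fun_prop) _ _)
    (Continuous.intervalIntegrable (by fun_prop) _ _),
    integral_cos_eq_zero hlr (j := (i : ℤ) + j) (by omega), sub_zero]
  split_ifs with hij
  · subst hij
    simp
    field_simp
  · rw [integral_cos_eq_zero hlr (j := (i : ℤ) - j) (by omega), mul_zero]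

theorem continuous_eigFun (j : ℕ) : Continuous (eigFun l r a μ j) := by
  unfold eigFun; fun_prop

/-- A function of `H¹₀(l, r)` that has the spectral expansion of the sub-grid scales solves the
sub-grid equation. -/
theorem subgrid_equation (hlr : l < r) (hμ : 0 < μ) (hτ : 0 < τ) {f old U Ut : ℝ → ℝ}
    (hf : MemLp f 2 (volume.restrict (Ioo l r))) (hold : MemLp old 2 (volume.restrict (Ioo l r)))
    (hU : MemLp U 2 (volume.restrict (Ioo l r)))
    (hU' : MemLp (deriv U) 2 (volume.restrict (Ioo l r))) (hUt : MemH10 l r Ut)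
    (hser : Tendsto (fun J : ℕ => normL2 l r (fun x => Ut x
      - subgridSum l r a μ τ f old U J x)) atTop (𝓝 0))
    {v : ℝ → ℝ} (hv : MemH10 l r v) :
    ip l r Ut v + τ * bForm l r (fun _ => a) μ Ut v = residual l r a μ τ f old U v := by
  have hUt2 := hUt.memLp hlr.le
  -- the coefficients of the expansion
  have hcoef : ∀ j : ℕ, 1 ≤ j → ip l r Ut (fun x => weight l a μ x * eigFun l r a μ j x)
      = (1 + τ * eigVal l r a μ j)⁻¹
        * residual l r a μ τ f old U (fun x => weight l a μ x * eigFun l r a μ j x) := by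
    intro j hj
    set q : ℝ → ℝ := fun x => weight l a μ x * eigFun l r a μ j x with hq
    have hqH : MemH10 l r q := memH10_weight_mul_eigFun hlr hμ.ne' j
    have hqc := hqH.continuousOn hlr.le
    have hq2 := hqH.memLp hlr.le
    set β : ℕ → ℝ := fun i => (1 + τ * eigVal l r a μ i)⁻¹
        * residual l r a μ τ f old U (fun x => weight l a μ x * eigFun l r a μ i x) with hβ
    have hS : ∀ J, Continuous (subgridSum l r a μ τ f old U J) := fun J => by
      unfold subgridSum
      exact continuous_finsetSum _ fun i _ => continuous_const.mul (continuous_eigFun i)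
    have hsum : ∀ J, j ≤ J → ip l r (subgridSum l r a μ τ f old U J) q = β j := by
      intro J hJ
      have e1 : ip l r (subgridSum l r a μ τ f old U J) q
          = ∑ i ∈ Finset.Icc 1 J, β i * ip l r (eigFun l r a μ i) q := by
        simp only [ip, ← intervalIntegral.integral_const_mul]
        rw [← intervalIntegral.integral_finsetSum]
        · refine intervalIntegral.integral_congr fun x _ => ?_
          simp only [subgridSum, Finset.sum_mul, hβ, mul_assoc]
        · intro i _
          refine ContinuousOn.intervalIntegrable ?_
          rw [uIcc_of_le hlr.le]
          exact continuousOn_const.mul ((continuous_eigFun i).continuousOn.mul hqc)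
      rw [e1, Finset.sum_eq_single j]
      · rw [ip_eigFun_weight_mul_eigFun hlr hμ hj]; simp
      · intro i _ hij
        rw [ip_eigFun_weight_mul_eigFun hlr hμ hj, if_neg hij, mul_zero]
      · intro h
        exact absurd (Finset.mem_Icc.2 ⟨hj, hJ⟩) h
    -- From `J = j` on the coefficient of the partial sum no longer changes, so `L²` convergence
    -- identifies it with that of `Ut`.
    have hle : ∀ᶠ J in atTop, |ip l r Ut q - β j|
        ≤ normL2 l r (fun x => Ut x - subgridSum l r a μ τ f old U J x) * ‖toL2 l r q‖ := by
      filter_upwards [eventually_ge_atTop j] with J hJ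
      have hS2 : MemLp (subgridSum l r a μ τ f old U J) 2 (volume.restrict (Ioo l r)) :=
        memLp_of_continuousOn (hS J).continuousOn
      have hd2 : MemLp (fun x => Ut x - subgridSum l r a μ τ f old U J x) 2
        (volume.restrict (Ioo l r)) := hUt2.sub hS2
      rw [← hsum J hJ, ← inner_toL2 hlr.le hUt2 hq2, ← inner_toL2 hlr.le hS2 hq2,
        ← inner_sub_left, ← toL2_sub hUt2 hS2, ← norm_toL2 hd2]
      exact abs_real_inner_le_norm _ _
    have h0 : |ip l r Ut q - β j| ≤ 0 := by
      refine ge_of_tendsto ?_ hle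
      simpa using hser.mul_const ‖toL2 l r q‖
    exact sub_eq_zero.1 (abs_nonpos_iff.1 h0)
  -- the functional `v ↦ (Ut, v) + τ b(Ut, v) - ⟨R, v⟩`
  set P : Lp ℝ 2 (volume.restrict (Ioo l r)) := toL2 l r Ut + (τ * a) • toL2 l r (deriv Ut)
    - (toL2 l r old + τ • toL2 l r f - toL2 l r U - (τ * a) • toL2 l r (deriv U)) with hP
  set Q : Lp ℝ 2 (volume.restrict (Ioo l r)) :=
    (τ * μ) • (toL2 l r (deriv Ut) + toL2 l r (deriv U)) with hQ
  have htrans : ∀ w, MemH10 l r w → ⟪P, toL2 l r w⟫_ℝ + ⟪Q, toL2 l r (deriv w)⟫_ℝ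
      = ip l r Ut w + τ * bForm l r (fun _ => a) μ Ut w - residual l r a μ τ f old U w := by
    intro w hw
    have hw2 := hw.memLp hlr.le
    rw [residual, bForm_const, bForm_const, hP, hQ]
    simp only [inner_add_left, inner_sub_left, inner_smul_left, conj_trivial]
    rw [inner_toL2 hlr.le hUt2 hw2, inner_toL2 hlr.le hUt.2.1 hw2, inner_toL2 hlr.le hold hw2,
      inner_toL2 hlr.le hf hw2, inner_toL2 hlr.le hU hw2, inner_toL2 hlr.le hU' hw2,
      inner_toL2 hlr.le hUt.2.1 hw.2.1, inner_toL2 hlr.le hU' hw.2.1]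
    ring
  -- On `p z_j` the left side of the sub-grid equation equals `(1 + τ λ_j) (Ut, p z_j)`, and the
  -- factor `β_j` is the inverse of `1 + τ λ_j`. The test functions here lack the normalising square
  -- root, which is divided out.
  have hzero := functional_eq_zero_of_exp_mul_sin hlr (a / (2 * μ)) P Q (fun j hj w hw => by
    have hqH : MemH10 l r (fun x => weight l a μ x * eigFun l r a μ j x) :=
      memH10_weight_mul_eigFun hlr hμ.ne' j
    have h1 := htrans _ hqH
    have hlam : 0 ≤ eigVal l r a μ j := by unfold eigVal; positivity
    have hne : 1 + τ * eigVal l r a μ j ≠ 0 := by positivity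
    have h2 := hcoef j hj
    rw [eq_inv_mul_iff_mul_eq₀ hne] at h2
    rw [bForm_weight_mul_eigFun hlr hμ j hUt, ← h2] at h1
    have hs : Real.sqrt (2 / (r - l)) ≠ 0 := by
      have : 0 < r - l := sub_pos.2 hlr
      positivity
    have hh : r - l ≠ 0 := (sub_pos.2 hlr).ne'
    have hwH : MemH10 l r w := by
      have := memH10_of_contDiff (l := l) (r := r) (contDiff_expSin (l := l) (r := r)
        (a / (2 * μ)) 1 j) (by simp)
        (by rw [mul_div_assoc, div_self hh, mul_one, Real.sin_nat_mul_pi]; simp)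
      rw [hw]
      simpa only [one_mul] using this
    have e1 : (fun x => weight l a μ x * eigFun l r a μ j x)
        = fun x => Real.sqrt (2 / (r - l)) * w x := by
      rw [weight_mul_eigFun hμ.ne', hw]
    have e2 : deriv (fun x => Real.sqrt (2 / (r - l)) * w x)
        = fun x => Real.sqrt (2 / (r - l)) * deriv w x := by
      funext x; exact deriv_const_mul_field _
    rw [e1, e2, toL2_const_mul _ (hwH.memLp hlr.le), toL2_const_mul _ hwH.2.1,
      inner_smul_right, inner_smul_right, ← mul_add] at h1
    refine (mul_eq_zero.1 (h1.trans ?_)).resolve_left hs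
    ring) hv
  rw [htrans v hv] at hzero
  linarith

end Subgrid

/-! ### Gluing along a partition -/

section Glue
variable {x : ℕ → ℝ} {n : ℕ} {u : ℝ → ℝ}

theorem partition_le (hx : ∀ k < n, x k ≤ x (k + 1)) {i j : ℕ} (hij : i ≤ j) (hj : j ≤ n) :
    x i ≤ x j := by
  induction j, hij using Nat.le_induction with
  | base => exact le_rfl
  | succ j _ ih => exact (ih (by omega)).trans (hx j (by omega))

theorem absolutelyContinuousOnInterval_glue (hx : ∀ k < n, x k ≤ x (k + 1))
    (h : ∀ k < n, AbsolutelyContinuousOnInterval u (x k) (x (k + 1))) :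
    AbsolutelyContinuousOnInterval u (x 0) (x n) := by
  induction n with
  | zero =>
    exact LipschitzOnWith.absolutelyContinuousOnInterval (K := 0) (by simp [LipschitzOnWith])
  | succ n ih =>
    exact absolutelyContinuousOnInterval_trans
      (ih (fun k hk => hx k (by omega)) fun k hk => h k (by omega)) (h n (by omega))
      (partition_le hx (Nat.zero_le n) (by omega)) (hx n (by omega))

theorem memLp_deriv_glue (hx : ∀ k < n, x k ≤ x (k + 1))
    (h : ∀ k < n, MemLp (deriv u) 2 (volume.restrict (Ioo (x k) (x (k + 1))))) :
    MemLp (deriv u) 2 (volume.restrict (Ioo (x 0) (x n))) := by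
  rw [memLp_two_iff_integrable_sq (measurable_deriv u).aestronglyMeasurable]
  have h0 := partition_le hx (Nat.zero_le n) le_rfl
  refine (intervalIntegrable_iff_integrableOn_Ioo_of_le h0).1
    (IntervalIntegrable.trans_iterate fun k hk => ?_)
  exact (intervalIntegrable_iff_integrableOn_Ioo_of_le (hx k hk)).2
    ((memLp_two_iff_integrable_sq (measurable_deriv u).aestronglyMeasurable).1 (h k hk))

theorem memH10_glue (hx : ∀ k < n, x k ≤ x (k + 1))
    (h : ∀ k < n, AbsolutelyContinuousOnInterval u (x k) (x (k + 1)) ∧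
      MemLp (deriv u) 2 (volume.restrict (Ioo (x k) (x (k + 1)))))
    (h0 : u (x 0) = 0) (hn : u (x n) = 0) : MemH10 (x 0) (x n) u :=
  ⟨absolutelyContinuousOnInterval_glue hx fun k hk => (h k hk).1,
    memLp_deriv_glue hx fun k hk => (h k hk).2, h0, hn⟩

theorem ae_restrict_Ioo_glue {p : ℝ → Prop} (hx : ∀ k < n, x k ≤ x (k + 1))
    (h : ∀ k < n, ∀ᵐ y ∂(volume.restrict (Ioo (x k) (x (k + 1)))), p y) :
    ∀ᵐ y ∂(volume.restrict (Ioo (x 0) (x n))), p y := by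
  simp only [Measure.restrict_congr_set Ioo_ae_eq_Ioc] at h ⊢
  induction n with
  | zero => simp
  | succ n ih =>
    rw [← Ioc_union_Ioc_eq_Ioc (partition_le hx (Nat.zero_le n) (by omega)) (hx n (by omega)),
      ae_restrict_union_iff]
    exact ⟨ih (fun k hk => hx k (by omega)) fun k hk => h k (by omega), h n (by omega)⟩

end Glue

/-! ### The finite element space -/

namespace Grid

theorem left_le_right {A B : ℝ} (G : Grid A B) : A ≤ B := by
  have := partition_le (n := G.last) (fun k hk => (G.node_lt k hk).le) (Nat.zero_le G.last) le_rfl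
  rwa [G.node_first, last, G.node_last] at this

variable {A B : ℝ} (G : Grid A B)

theorem node_le_node {i j : ℕ} (hij : i ≤ j) (hj : j ≤ G.last) : G.node i ≤ G.node j :=
  partition_le (n := G.last) (fun k hk => (G.node_lt k hk).le) hij hj

theorem node_lt_node {i j : ℕ} (hij : i < j) (hj : j ≤ G.last) : G.node i < G.node j :=
  (G.node_lt i (lt_of_lt_of_le hij hj)).trans_le (G.node_le_node hij hj)

theorem le_last {j : ℕ} (hj : j ≤ G.elems) : G.deg * j ≤ G.last := Nat.mul_le_mul_left _ hj

theorem elem_lt {j : ℕ} (hj : j < G.elems) :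
    G.node (G.deg * j) < G.node (G.deg * (j + 1)) :=
  G.node_lt_node (by have := G.deg_pos; rw [mul_add, mul_one]; omega) (G.le_last hj)

theorem first_elem : G.node (G.deg * 0) = A := by rw [mul_zero, G.node_first]

/-- `pcw` is `0` at the element boundaries by default; these finitely many points are null. -/
theorem pcw_const_ae (a : ℝ) :
    ∀ᵐ x ∂(volume.restrict (Ioo A B)), G.pcw (fun _ => a) x = a := by
  have h := ae_restrict_Ioo_glue (x := fun j => G.node (G.deg * j)) (n := G.elems)
    (p := fun x => G.pcw (fun _ => a) x = a) (fun j hj => (G.elem_lt hj).le) (fun j hj => by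
      refine (ae_restrict_iff' measurableSet_Ioo).2 (Eventually.of_forall fun x hx => ?_)
      rw [pcw, Finset.sum_eq_single j, indicator_of_mem hx]
      · intro k hk hkj
        have hk := Finset.mem_range.1 hk
        refine indicator_of_notMem (fun hxk => ?_) _
        rcases lt_or_gt_of_ne hkj with h | h
        · have := G.node_le_node (Nat.mul_le_mul_left G.deg (show k + 1 ≤ j by omega))
            (G.le_last hj.le)
          linarith [hx.1, hxk.2]
        · have := G.node_le_node (Nat.mul_le_mul_left G.deg (show j + 1 ≤ k by omega))
            (G.le_last hk.le)
          linarith [hx.2, hxk.1]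
      · intro h; exact absurd (Finset.mem_range.2 hj) h)
  simpa only [G.first_elem, G.node_last] using h

theorem bForm_pcw_const (a μ : ℝ) (w v : ℝ → ℝ) :
    bForm A B (G.pcw fun _ => a) μ w v = bForm A B (fun _ => a) μ w v := by
  rw [bForm, bForm]
  congr 1
  rw [ip_eq_setIntegral G.left_le_right, ip_eq_setIntegral G.left_le_right]
  refine integral_congr_ae ?_
  filter_upwards [G.pcw_const_ae a] with x hx
  rw [hx]

theorem piece_of_eq_polynomial {l r : ℝ} {v : ℝ → ℝ} {P : Polynomial ℝ} (hlr : l ≤ r)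
    (h : ∀ x ∈ Icc l r, v x = P.eval x) : AbsolutelyContinuousOnInterval v l r ∧
      MemLp (deriv v) 2 (volume.restrict (Ioo l r)) := by
  have hP : ContDiff ℝ 1 fun x => P.eval x := by
    simpa only [Polynomial.coe_aeval_eq_eval] using P.contDiff_aeval (𝕜 := ℝ) 1
  have hEq : ∀ x ∈ Icc l r, P.eval x = v x := fun x hx => (h x hx).symm
  refine ⟨absolutelyContinuousOnInterval_congr
    (hP.contDiffOn.absolutelyContinuousOnInterval) (by rwa [uIcc_of_le hlr]), ?_⟩
  exact (memLp_of_continuousOn (hP.continuous_deriv le_rfl).continuousOn).ae_eq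
    (MemH10.deriv_congr_ae hEq)

variable {G} in
theorem MemXh.memH10 {v : ℝ → ℝ} (h : G.MemXh v) : MemH10 A B v := by
  have hg := memH10_glue (x := fun j => G.node (G.deg * j)) (n := G.elems) (u := v)
    (fun j hj => (G.elem_lt hj).le) (fun j hj => by
      obtain ⟨P, -, hP⟩ := h.2.2.2 j hj
      exact piece_of_eq_polynomial (G.elem_lt hj).le hP)
    (by rw [G.first_elem]; exact h.2.1) (by rw [G.node_last]; exact h.2.2.1)
  simpa only [G.first_elem, G.node_last] using hg

/-- The Lagrange interpolation polynomial on the `j`-th element. -/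
def interpPoly (v : ℝ → ℝ) (j : ℕ) : Polynomial ℝ :=
  Lagrange.interpolate (Finset.range (G.deg + 1)) (fun i => G.node (G.deg * j + i))
    (fun i => v (G.node (G.deg * j + i)))

theorem injOn_node {j : ℕ} (hj : j < G.elems) :
    Set.InjOn (fun i => G.node (G.deg * j + i)) (Finset.range (G.deg + 1)) := by
  have hlast : G.deg * j + G.deg ≤ G.last := by
    have := G.le_last (show j + 1 ≤ G.elems by omega)
    rwa [mul_add, mul_one] at this
  intro i hi k hk hik
  simp only [Finset.coe_range, mem_Iio] at hi hk
  rcases lt_trichotomy i k with h | h | h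
  · exact absurd hik (G.node_lt_node (by omega) (by omega)).ne
  · exact h
  · exact absurd hik (G.node_lt_node (by omega) (by omega)).ne'

theorem natDegree_interpPoly_le (v : ℝ → ℝ) {j : ℕ} (hj : j < G.elems) :
    (G.interpPoly v j).natDegree ≤ G.deg := by
  have h := Lagrange.degree_interpolate_lt (fun i => v (G.node (G.deg * j + i))) (G.injOn_node hj)
  rw [Finset.card_range] at h
  rw [Polynomial.natDegree_le_iff_coeff_eq_zero]
  intro m hm
  exact Polynomial.coeff_eq_zero_of_degree_lt (h.trans_le (by exact_mod_cast hm))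

theorem eval_interpPoly (v : ℝ → ℝ) {j i : ℕ} (hj : j < G.elems) (hi : i ≤ G.deg) :
    (G.interpPoly v j).eval (G.node (G.deg * j + i)) = v (G.node (G.deg * j + i)) := by
  have hi' : i ∈ Finset.range (G.deg + 1) := Finset.mem_range.2 (by omega)
  have h := Lagrange.eval_interpolate_at_node (fun i => v (G.node (G.deg * j + i)))
    (G.injOn_node hj) hi'
  rw [interpPoly]
  exact h

/-- The interpolant is built element by element: the polynomials of adjacent elements both take the
value of `v` at the common node, so they fit together continuously. -/
theorem exists_interpolant {v : ℝ → ℝ} (hA : v A = 0) (hB : v B = 0) :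
    ∃ vh, G.MemXh vh ∧ ∀ i ≤ G.last, vh (G.node i) = v (G.node i) := by
  have hex : ∀ m ≤ G.elems, ∃ vh : ℝ → ℝ, ∀ j < m,
      ∀ x ∈ Icc (G.node (G.deg * j)) (G.node (G.deg * (j + 1))),
        vh x = (G.interpPoly v j).eval x := by
    intro m
    induction m with
    | zero => intro _; exact ⟨0, fun j hj => absurd hj (by omega)⟩
    | succ m ih =>
      intro hm
      obtain ⟨vh, hvh⟩ := ih (by omega)
      refine ⟨fun x => if x < G.node (G.deg * m) then vh x else (G.interpPoly v m).eval x,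
        fun j hj x hx => ?_⟩
      rcases Nat.lt_succ_iff_lt_or_eq.1 hj with hjm | rfl
      · have hle : G.node (G.deg * (j + 1)) ≤ G.node (G.deg * m) :=
          G.node_le_node (Nat.mul_le_mul_left _ hjm) (G.le_last (by omega))
        beta_reduce
        split_ifs with hlt
        · exact hvh j hjm x hx
        -- The only point of an earlier element that falls under the new formula is the shared node,
        -- where both polynomials equal `v`.
        · have e1 : x = G.node (G.deg * m) := le_antisymm (hx.2.trans hle) (not_lt.1 hlt)
          have e2 : x = G.node (G.deg * (j + 1)) :=
            le_antisymm hx.2 (hle.trans (not_lt.1 hlt))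
          have h1 := G.eval_interpPoly v (j := m) (i := 0) (by omega) (Nat.zero_le _)
          have h2 := G.eval_interpPoly v (j := j) (i := G.deg) (by omega) le_rfl
          rw [add_zero, ← e1] at h1
          rw [← mul_add_one, ← e2] at h2
          rw [h1, h2]
      · beta_reduce
        rw [if_neg (not_lt.2 hx.1)]
  obtain ⟨vh, hvh⟩ := hex G.elems le_rfl
  have hnode : ∀ i ≤ G.last, vh (G.node i) = v (G.node i) := by
    intro i hi
    obtain ⟨j, k, hj, hk, rfl⟩ : ∃ j k, j < G.elems ∧ k ≤ G.deg ∧ i = G.deg * j + k := by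
      rcases hi.lt_or_eq with h | rfl
      · refine ⟨i / G.deg, i % G.deg, ?_, (Nat.mod_lt _ G.deg_pos).le, (Nat.div_add_mod _ _).symm⟩
        exact Nat.div_lt_of_lt_mul h
      -- The quotient by `deg` would place the last node in a non-existent element; it is local node
      -- `deg` of the last one.
      · have := G.elems_pos
        refine ⟨G.elems - 1, G.deg, by omega, le_rfl, ?_⟩
        rw [last, ← mul_add_one]; congr 1; omega
    have hlast : G.deg * j + G.deg ≤ G.last := by
      have := G.le_last (show j + 1 ≤ G.elems by omega)
      rwa [mul_add, mul_one] at this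
    rw [hvh j hj _ ⟨G.node_le_node (by omega) (by omega),
      G.node_le_node (by rw [mul_add_one]; omega) (by rw [mul_add_one]; omega)⟩]
    exact G.eval_interpPoly v hj hk
  have hvA : vh A = 0 := by
    have := hnode 0 (Nat.zero_le _)
    rwa [G.node_first, hA] at this
  have hvB : vh B = 0 := by
    have := hnode G.last le_rfl
    rwa [last, G.node_last, hB] at this
  have hac := absolutelyContinuousOnInterval_glue (x := fun j => G.node (G.deg * j))
    (n := G.elems) (u := vh) (fun j hj => (G.elem_lt hj).le)
    fun j hj => (piece_of_eq_polynomial (G.elem_lt hj).le (hvh j hj)).1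
  simp only [G.first_elem, G.node_last] at hac
  have hc := hac.continuousOn
  rw [uIcc_of_le G.left_le_right] at hc
  exact ⟨vh, ⟨hc, hvA, hvB, fun j hj =>
    ⟨G.interpPoly v j, G.natDegree_interpPoly_le v hj, hvh j hj⟩⟩, hnode⟩

end Grid

/-! ### Nodal exactness -/

/-- The weak form of one step of the implicit Euler scheme, with all terms on one side. -/
def stepForm (l r a μ τ : ℝ) (f old w v : ℝ → ℝ) : ℝ :=
  ip l r w v + τ * bForm l r (fun _ => a) μ w v - τ * ip l r f v - ip l r old v

section Step
variable {l r a μ τ : ℝ} {f old w v : ℝ → ℝ}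

/-- A single integrand makes the form additive over the intervals between nodes. -/
theorem stepForm_eq_integral (hlr : l ≤ r) (hf : MemLp f 2 (volume.restrict (Ioo l r)))
    (hold : MemLp old 2 (volume.restrict (Ioo l r))) (hw : MemLp w 2 (volume.restrict (Ioo l r)))
    (hw' : MemLp (deriv w) 2 (volume.restrict (Ioo l r)))
    (hv : MemLp v 2 (volume.restrict (Ioo l r)))
    (hv' : MemLp (deriv v) 2 (volume.restrict (Ioo l r))) :
    IntervalIntegrable (fun x => w x * v x + τ * (a * (deriv w x * v x)
        + μ * (deriv w x * deriv v x)) - τ * (f x * v x) - old x * v x) volume l r ∧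
    stepForm l r a μ τ f old w v = ∫ x in l..r, (w x * v x + τ * (a * (deriv w x * v x)
        + μ * (deriv w x * deriv v x)) - τ * (f x * v x) - old x * v x) := by
  have ii : ∀ {p q : ℝ → ℝ}, MemLp p 2 (volume.restrict (Ioo l r)) →
      MemLp q 2 (volume.restrict (Ioo l r)) →
      IntervalIntegrable (fun x => p x * q x) volume l r := fun hp hq =>
    (intervalIntegrable_iff_integrableOn_Ioo_of_le hlr).2 (hp.integrable_mul hq)
  have i1 := ii hw hv
  have i2 := ((ii hw' hv).const_mul a).add ((ii hw' hv').const_mul μ)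
  have i3 := (ii hf hv).const_mul τ
  have i4 := ii hold hv
  refine ⟨((i1.add (i2.const_mul τ)).sub i3).sub i4, ?_⟩
  rw [stepForm, bForm_const,
    intervalIntegral.integral_sub ((i1.add (i2.const_mul τ)).sub i3) i4,
    intervalIntegral.integral_sub (i1.add (i2.const_mul τ)) i3,
    intervalIntegral.integral_add i1 (i2.const_mul τ), intervalIntegral.integral_const_mul,
    intervalIntegral.integral_const_mul,
    intervalIntegral.integral_add ((ii hw' hv).const_mul a) ((ii hw' hv').const_mul μ),
    intervalIntegral.integral_const_mul, intervalIntegral.integral_const_mul]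
  rfl

theorem stepForm_sub_right (hlr : l ≤ r) {z : ℝ → ℝ}
    (hf : MemLp f 2 (volume.restrict (Ioo l r)))
    (hold : MemLp old 2 (volume.restrict (Ioo l r))) (hw : MemLp w 2 (volume.restrict (Ioo l r)))
    (hw' : MemLp (deriv w) 2 (volume.restrict (Ioo l r))) (hv : MemH10 l r v)
    (hz : MemH10 l r z) :
    stepForm l r a μ τ f old w (fun x => v x - z x)
      = stepForm l r a μ τ f old w v - stepForm l r a μ τ f old w z := by
  have hv2 := hv.memLp hlr
  have hz2 := hz.memLp hlr
  have hd := hv.sub hz hlr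
  simp only [stepForm, bForm_const]
  rw [← inner_toL2 hlr hw (hd.memLp hlr), ← inner_toL2 hlr hw' (hd.memLp hlr),
    ← inner_toL2 hlr hw' hd.2.1, ← inner_toL2 hlr hf (hd.memLp hlr),
    ← inner_toL2 hlr hold (hd.memLp hlr), toL2_sub hv2 hz2, hv.toL2_deriv_sub hz hlr]
  simp only [inner_sub_right]
  rw [inner_toL2 hlr hw hv2, inner_toL2 hlr hw hz2, inner_toL2 hlr hw' hv2, inner_toL2 hlr hw' hz2,
    inner_toL2 hlr hw' hv.2.1, inner_toL2 hlr hw' hz.2.1, inner_toL2 hlr hf hv2,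
    inner_toL2 hlr hf hz2, inner_toL2 hlr hold hv2, inner_toL2 hlr hold hz2]
  ring

/-- For constant velocity `∫ d d' = 0` on `H¹₀`, so testing the difference with itself leaves only
nonnegative terms. -/
theorem eq_of_stepForm_eq_zero {z : ℝ → ℝ} (hlr : l ≤ r) (hμ : 0 < μ) (hτ : 0 < τ)
    (hw : MemH10 l r w) (hz : MemH10 l r z)
    (h1 : ∀ v, MemH10 l r v → stepForm l r a μ τ f old w v = 0)
    (h2 : ∀ v, MemH10 l r v → stepForm l r a μ τ f old z v = 0) :
    ∀ x ∈ Icc l r, w x = z x := by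
  have hd := hw.sub hz hlr
  have hd2 := hd.memLp hlr
  set d : ℝ → ℝ := fun x => w x - z x with hdd
  have e1 := h1 d hd
  have e2 := h2 d hd
  simp only [stepForm, bForm_const] at e1 e2
  rw [← inner_toL2 hlr (hw.memLp hlr) hd2, ← inner_toL2 hlr hw.2.1 hd2,
    ← inner_toL2 hlr hw.2.1 hd.2.1] at e1
  rw [← inner_toL2 hlr (hz.memLp hlr) hd2, ← inner_toL2 hlr hz.2.1 hd2,
    ← inner_toL2 hlr hz.2.1 hd.2.1] at e2
  have s1 : toL2 l r d = toL2 l r w - toL2 l r z := toL2_sub (hw.memLp hlr) (hz.memLp hlr)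
  have s2 : toL2 l r (deriv d) = toL2 l r (deriv w) - toL2 l r (deriv z) :=
    hw.toL2_deriv_sub hz hlr
  have e3 : ⟪toL2 l r d, toL2 l r d⟫_ℝ + τ * (a * ⟪toL2 l r (deriv d), toL2 l r d⟫_ℝ
      + μ * ⟪toL2 l r (deriv d), toL2 l r (deriv d)⟫_ℝ) = 0 := by
    have a1 : ⟪toL2 l r d, toL2 l r d⟫_ℝ
      = ⟪toL2 l r w, toL2 l r d⟫_ℝ - ⟪toL2 l r z, toL2 l r d⟫_ℝ := by
        nth_rewrite 1 [s1]; rw [inner_sub_left]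
    have a2 : ∀ y, ⟪toL2 l r (deriv d), y⟫_ℝ
      = ⟪toL2 l r (deriv w), y⟫_ℝ - ⟪toL2 l r (deriv z), y⟫_ℝ := fun y => by
        rw [s2, inner_sub_left]
    rw [a1, a2, a2]
    linarith
  have hskew : ⟪toL2 l r (deriv d), toL2 l r d⟫_ℝ = 0 := by
    rw [inner_toL2 hlr hd.2.1 hd2, ip]
    have := hd.1.integral_mul_deriv_eq_deriv_mul hd.1
    rw [hd.2.2.1, hd.2.2.2] at this
    have e : ∫ x in l..r, d x * deriv d x = ∫ x in l..r, deriv d x * d x :=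
      intervalIntegral.integral_congr fun x _ => mul_comm _ _
    linarith
  rw [hskew, real_inner_self_eq_norm_sq, real_inner_self_eq_norm_sq] at e3
  have hn : ‖toL2 l r d‖ ^ 2 ≤ 0 := by
    have : 0 ≤ τ * (μ * ‖toL2 l r (deriv d)‖ ^ 2) := by positivity
    linarith
  have hn0 : ‖toL2 l r d‖ = 0 := by nlinarith [norm_nonneg (toL2 l r d)]
  intro x hx
  have hA := hd.sq_le hlr hx
  rw [hn0] at hA
  have : d x = 0 := by nlinarith
  exact sub_eq_zero.1 this

end Step

theorem stepForm_of_isEulerSolution {A B a μ τ : ℝ} {N : ℕ} {f : ℕ → ℝ → ℝ} {u₀ : ℝ → ℝ}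
    {u : ℕ → ℝ → ℝ} (hAB : A ≤ B) (hτ : 0 < τ)
    (hf : ∀ n ∈ Icc 1 N, MemLp (f n) 2 (volume.restrict (Ioo A B)))
    (hu₀ : MemLp u₀ 2 (volume.restrict (Ioo A B)))
    (hu : IsEulerSolution A B μ τ N (fun _ _ => a) f u₀ u) {n : ℕ} (hn : n < N) {v : ℝ → ℝ}
    (hv : MemH10 A B v) : stepForm A B a μ τ (f (n + 1)) (u n) (u (n + 1)) v = 0 := by
  have h := hu.inner_eq (K := |a|) hAB hτ hu₀ hf (fun _ _ => aestronglyMeasurable_const)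
    (fun _ _ => Eventually.of_forall fun _ => le_rfl) hn hv
  have hm := hu.mem n hn
  rw [toL2_const_mul _ hm.2.1] at h
  simp only [inner_sub_left, inner_smul_left, conj_trivial] at h
  have hv2 := hv.memLp hAB
  rw [inner_toL2 hAB (hm.memLp hAB) hv2, inner_toL2 hAB (hu.memLp hAB hu₀ hn.le) hv2,
    inner_toL2 hAB hm.2.1 hv2, inner_toL2 hAB (hf _ ⟨by omega, hn⟩) hv2,
    inner_toL2 hAB hm.2.1 hv.2.1] at h
  rw [stepForm, bForm_const]
  linarith

/-- The induction needs equality on all of `[A, B]`, since the previous step enters through an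
integral. Square integrability of `Ut n` is carried along because `Ut 0` need not lie in `H¹₀`. -/
theorem nodal_exactness {A B a μ τ : ℝ} {N : ℕ} (G : Grid A B) {f : ℕ → ℝ → ℝ} {u₀ : ℝ → ℝ}
    {u Uh Ut : ℕ → ℝ → ℝ} (hμ : 0 < μ) (hτ : 0 < τ)
    (hf : ∀ n ∈ Icc 1 N, MemLp (f n) 2 (volume.restrict (Ioo A B)))
    (hu₀ : MemLp u₀ 2 (volume.restrict (Ioo A B)))
    (hu : IsEulerSolution A B μ τ N (fun _ _ => a) f u₀ u)
    (hU : IsSpectralVMS G μ τ N (fun _ _ => a) f u₀ Uh Ut) :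
    ∀ n ≤ N, MemLp (Ut n) 2 (volume.restrict (Ioo A B)) ∧
      ∀ x ∈ Icc A B, Uh n x + Ut n x = u n x := by
  have hAB := G.left_le_right
  intro n
  induction n with
  | zero =>
    intro _
    refine ⟨?_, fun x hx => by rw [hU.sub_init x hx, hu.init x hx]; ring⟩
    refine (hu₀.sub ((hU.mem 0 (Nat.zero_le _)).memH10.memLp hAB)).ae_eq
      ((ae_restrict_iff' measurableSet_Ioo).2 (Eventually.of_forall fun x hx => ?_))
    exact (hU.sub_init x (Ioo_subset_Icc_self hx)).symm
  | succ n ih =>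
    intro hn
    have hn' : n < N := hn
    obtain ⟨hUtn, heq⟩ := ih hn'.le
    have hfn := hf (n + 1) ⟨by omega, hn⟩
    have hUh := (hU.mem (n + 1) hn).memH10
    have hUhn := (hU.mem n hn'.le).memH10.memLp hAB
    have hsub := hU.sub_mem n hn'
    have hlt : ∀ i < G.last, G.node i < G.node (i + 1) := G.node_lt
    have hlast : G.node G.last = B := G.node_last
    have hUt0 : ∀ i ≤ G.last, Ut (n + 1) (G.node i) = 0 := by
      intro i hi
      rcases Nat.eq_zero_or_pos i with rfl | hpos
      · exact (hsub 0 (Nat.mul_pos G.deg_pos G.elems_pos)).2.2.1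
      · have := (hsub (i - 1) (by omega)).2.2.2
        rwa [Nat.sub_add_cancel hpos] at this
    have hUt : MemH10 A B (Ut (n + 1)) := by
      have := memH10_glue (x := G.node) (n := G.last) (fun k hk => (hlt k hk).le)
        (fun k hk => ⟨(hsub k hk).1, (hsub k hk).2.1⟩) (hUt0 0 (Nat.zero_le _))
        (hUt0 G.last le_rfl)
      rwa [G.node_first, hlast] at this
    refine ⟨hUt.memLp hAB, ?_⟩
    set w : ℝ → ℝ := fun x => Uh (n + 1) x + Ut (n + 1) x with hw
    have hwH : MemH10 A B w := hUh.add hUt hAB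
    have hwd := MemH10.deriv_add_ae hUh.1 hUt.1 hAB
    set old : ℝ → ℝ := fun x => Uh n x + Ut n x with hold
    have holdL : MemLp old 2 (volume.restrict (Ioo A B)) := hUhn.add hUtn
    have hmono : ∀ i < G.last, ∀ {g : ℝ → ℝ}, MemLp g 2 (volume.restrict (Ioo A B)) →
        MemLp g 2 (volume.restrict (Ioo (G.node i) (G.node (i + 1)))) := by
      intro i hi g hg
      refine hg.mono_measure (Measure.restrict_mono (Ioo_subset_Ioo ?_ ?_) le_rfl)
      · have := G.node_le_node (Nat.zero_le i) hi.le
        rwa [G.node_first] at this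
      · have := G.node_le_node (show i + 1 ≤ G.last from hi) le_rfl
        rwa [hlast] at this
    -- the equation for test functions in the finite element space
    have hfe : ∀ v, G.MemXh v → stepForm A B a μ τ (f (n + 1)) old w v = 0 := by
      intro v hv
      have h1 := hU.eqn n hn' v hv
      rw [G.bForm_pcw_const, G.bForm_pcw_const, bForm_const, bForm_const] at h1
      have hvH := hv.memH10
      have hv2 := hvH.memLp hAB
      rw [← inner_toL2 hAB (hUh.memLp hAB) hv2, ← inner_toL2 hAB hUh.2.1 hv2,
        ← inner_toL2 hAB hUh.2.1 hvH.2.1, ← inner_toL2 hAB (hUt.memLp hAB) hv2,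
        ← inner_toL2 hAB hUt.2.1 hv2, ← inner_toL2 hAB hUt.2.1 hvH.2.1,
        ← inner_toL2 hAB hUhn hv2, ← inner_toL2 hAB hUtn hv2] at h1
      rw [stepForm, bForm_const, ← inner_toL2 hAB (hwH.memLp hAB) hv2,
        ← inner_toL2 hAB hwH.2.1 hv2, ← inner_toL2 hAB hwH.2.1 hvH.2.1,
        ← inner_toL2 hAB holdL hv2, toL2_congr hwd, toL2_add hUh.2.1 hUt.2.1,
        toL2_add (hUh.memLp hAB) (hUt.memLp hAB), toL2_add hUhn hUtn]
      simp only [inner_add_left]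
      linarith
    -- the equation for test functions supported between two nodes
    have hloc : ∀ i < G.last, ∀ v, MemH10 (G.node i) (G.node (i + 1)) v →
        stepForm (G.node i) (G.node (i + 1)) a μ τ (f (n + 1)) old w v = 0 := by
      intro i hi v hv
      have hle := (hlt i hi).le
      have h1 := subgrid_equation (hlt i hi) hμ hτ (hmono i hi hfn) (hmono i hi holdL)
        (hmono i hi (hUh.memLp hAB)) (hmono i hi hUh.2.1) (hsub i hi) (hU.sub_series n hn' i hi) hv
      have hv2 := hv.memLp hle
      have hUi := hmono i hi (hUh.memLp hAB)
      have hUi' := hmono i hi hUh.2.1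
      have hTi := hmono i hi (hUt.memLp hAB)
      have hTi' := hmono i hi hUt.2.1
      have hwi' := hmono i hi hwH.2.1
      have hwdi : deriv w =ᵐ[volume.restrict (Ioo (G.node i) (G.node (i + 1)))]
          fun x => deriv (Uh (n + 1)) x + deriv (Ut (n + 1)) x := by
        refine ae_mono (Measure.restrict_mono (Ioo_subset_Ioo ?_ ?_) le_rfl) hwd
        · have := G.node_le_node (Nat.zero_le i) hi.le
          rwa [G.node_first] at this
        · have := G.node_le_node (show i + 1 ≤ G.last from hi) le_rfl
          rwa [hlast] at this
      rw [residual, bForm_const, bForm_const, ← inner_toL2 hle hUi hv2,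
        ← inner_toL2 hle hUi' hv2, ← inner_toL2 hle hUi' hv.2.1, ← inner_toL2 hle hTi hv2,
        ← inner_toL2 hle hTi' hv2, ← inner_toL2 hle hTi' hv.2.1] at h1
      rw [stepForm, bForm_const, ← inner_toL2 hle (hmono i hi (hwH.memLp hAB)) hv2,
        ← inner_toL2 hle hwi' hv2, ← inner_toL2 hle hwi' hv.2.1, toL2_congr hwdi,
        toL2_add hUi' hTi', toL2_add hUi hTi]
      simp only [inner_add_left]
      linarith
    have hall : ∀ v, MemH10 A B v → stepForm A B a μ τ (f (n + 1)) old w v = 0 := by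
      intro v hv
      -- `v - vh` vanishes at every node, so it restricts to an admissible test function on each
      -- interval between nodes; `vh` is a test function of the discrete equation.
      obtain ⟨vh, hvh, hnode⟩ := G.exists_interpolant hv.2.2.1 hv.2.2.2
      have hvhH := hvh.memH10
      have hr := hv.sub hvhH hAB
      have h1 : stepForm A B a μ τ (f (n + 1)) old w (fun x => v x - vh x) = 0 := by
        have hr' : ∀ i < G.last, MemH10 (G.node i) (G.node (i + 1)) (fun x => v x - vh x) := by
          intro i hi
          refine ⟨hr.1.mono ?_, hmono i hi hr.2.1, ?_, ?_⟩
          · rw [uIcc_of_le (hlt i hi).le, uIcc_of_le hAB]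
            refine Icc_subset_Icc ?_ ?_
            · have := G.node_le_node (Nat.zero_le i) hi.le
              rwa [G.node_first] at this
            · have := G.node_le_node (show i + 1 ≤ G.last from hi) le_rfl
              rwa [hlast] at this
          · exact sub_eq_zero.2 (hnode i hi.le).symm
          · exact sub_eq_zero.2 (hnode (i + 1) hi).symm
        have hI := fun i (hi : i < G.last) => stepForm_eq_integral (a := a) (μ := μ) (τ := τ)
          (hlt i hi).le (hmono i hi hfn) (hmono i hi holdL) (hmono i hi (hwH.memLp hAB))
          (hmono i hi hwH.2.1) (hmono i hi (hr.memLp hAB)) (hmono i hi hr.2.1)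
        rw [(stepForm_eq_integral hAB hfn holdL (hwH.memLp hAB) hwH.2.1 (hr.memLp hAB) hr.2.1).2]
        have hs := intervalIntegral.sum_integral_adjacent_intervals (a := G.node) (n := G.last)
          (μ := volume) (fun i hi => (hI i hi).1)
        rw [G.node_first, hlast] at hs
        rw [← hs]
        refine Finset.sum_eq_zero fun i hi => ?_
        have hi := Finset.mem_range.1 hi
        rw [← (hI i hi).2]
        exact hloc i hi _ (hr' i hi)
      rw [stepForm_sub_right hAB hfn holdL (hwH.memLp hAB) hwH.2.1 hv hvhH, hfe vh hvh,
        sub_zero] at h1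
      exact h1
    -- The two steps start from `old` and `u n`, which agree on `[A, B]` by the induction
    -- hypothesis.
    refine eq_of_stepForm_eq_zero hAB hμ hτ hwH (hu.mem n hn') hall fun v hv => ?_
    rw [← stepForm_of_isEulerSolution hAB hτ hf hu₀ hu hn' hv, stepForm, stepForm]
    congr 1
    rw [ip_eq_setIntegral hAB, ip_eq_setIntegral hAB]
    exact setIntegral_congr_fun measurableSet_Ioo fun x hx =>
      congrArg (· * v x) (heq x (Ioo_subset_Icc_self hx))

/-- At the Lagrange nodes the resolved scales agree with the implicit Euler solution. -/
theorem resolved_eq_at_nodes {A B a μ τ : ℝ} {N : ℕ} (G : Grid A B) {f : ℕ → ℝ → ℝ} {u₀ : ℝ → ℝ}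
    {u Uh Ut : ℕ → ℝ → ℝ} (hμ : 0 < μ) (hτ : 0 < τ)
    (hf : ∀ n ∈ Icc 1 N, MemLp (f n) 2 (volume.restrict (Ioo A B)))
    (hu₀ : MemLp u₀ 2 (volume.restrict (Ioo A B)))
    (hu : IsEulerSolution A B μ τ N (fun _ _ => a) f u₀ u)
    (hU : IsSpectralVMS G μ τ N (fun _ _ => a) f u₀ Uh Ut) :
    (∀ n ≤ N, ∀ i, 0 < i → i < G.last → Uh n (G.node i) = u n (G.node i)) ∧
      (∀ n ∈ Set.Icc 1 N, Uh n A = u n A ∧ Uh n B = u n B) := by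
  have hlast : G.node G.last = B := G.node_last
  refine ⟨fun n hn i hpos hi => ?_, fun n hn => ?_⟩
  · have hmem : G.node i ∈ Icc A B := by
      have h1 := G.node_le_node hpos.le hi.le
      have h2 := G.node_le_node hi.le le_rfl
      rw [G.node_first] at h1
      rw [hlast] at h2
      exact ⟨h1, h2⟩
    rcases n with _ | n
    -- At time `0` agreement comes from interpolation alone, and only at interior nodes: `u₀` need
    -- not vanish at the ends.
    · rw [hU.init i hpos hi, hu.init _ hmem]
    · have h := (nodal_exactness G hμ hτ hf hu₀ hu hU (n + 1) hn).2 _ hmem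
      rwa [(hU.sub_mem n hn i hi).2.2.1, add_zero] at h
  · obtain ⟨n, rfl⟩ : ∃ m, n = m + 1 := ⟨n - 1, by have := hn.1; omega⟩
    have h1 := hU.mem (n + 1) hn.2
    have h2 := hu.mem n hn.2
    exact ⟨h1.2.1.trans h2.2.2.1.symm, h1.2.2.1.trans h2.2.2.2.symm⟩

end SpectralVMS

end

/-! ### The two statements assembled. -/

theorem corollary1
    -- the space-time domain and the data of the evolution problem
    (A B T : ℝ) (hAB : A < B) (hT : 0 < T)
    (a f : ℝ → ℝ → ℝ) (u₀ : ℝ → ℝ) (L : ℝ≥0)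
    (ha : MemLp (Function.uncurry a) ∞ (SpectralVMS.cylinder T A B))
    (haL : ∀ᵐ t ∂(volume.restrict (Ioo 0 T)), LipschitzOnWith L (a t) (Ioo A B))
    (hf : MemLp (Function.uncurry f) 2 (SpectralVMS.cylinder T A B))
    (hu₀ : MemLp u₀ 2 (volume.restrict (Ioo A B))) :
    -- the error estimate
    (SpectralVMS.MemH10 A B u₀ →
      ∀ ε D S μmax : ℝ, 0 < ε → ε < 1 → 0 < D → 0 < S → 0 < μmax →
      ∃ C : ℝ, 0 < C ∧
        ∀ (μ : ℝ) (N : ℕ) (G : SpectralVMS.Grid A B) (c : ℕ → ℕ → ℝ) (aN fN u U : ℕ → ℝ → ℝ),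
          0 < μ → μ ≤ μmax → 1 ≤ N →
          -- the time step restriction
          T / N * (eLpNorm (Function.uncurry a) ∞ (SpectralVMS.cylinder T A B)).toReal ^ 2
            ≤ (1 - ε) * μ →
          -- `aN n` and `fN n` are stable approximations of `a` and `f` at time `t_n`
          (∀ n ∈ Set.Icc 1 N, LipschitzOnWith L (aN n) (Ioo A B) ∧
            SpectralVMS.normLinf A B (aN n)
              ≤ (eLpNorm (Function.uncurry a) ∞ (SpectralVMS.cylinder T A B)).toReal) →
          (∀ n ∈ Set.Icc 1 N, MemLp (fN n) 2 (volume.restrict (Ioo A B))) →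
          SpectralVMS.seqL2 N (T / N) (fun n => SpectralVMS.normL2 A B (fN n))
            ≤ S * (eLpNorm (Function.uncurry f) 2 (SpectralVMS.cylinder T A B)).toReal →
          -- the elementwise constant velocity is bounded by `D` times the norm of `a`
          (∀ n ∈ Set.Icc 1 N, SpectralVMS.normLinf A B (G.pcw (c n))
              ≤ D * (eLpNorm (Function.uncurry a) ∞ (SpectralVMS.cylinder T A B)).toReal) →
          SpectralVMS.IsEulerSolution A B μ (T / N) N aN fN u₀ u →
          SpectralVMS.IsEulerSolution A B μ (T / N) N (fun n => G.pcw (c n)) fN u₀ U →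
          μ * SpectralVMS.seqLinf N (fun n => SpectralVMS.normLinf A B (fun x => u n x - U n x))
            ≤ C * SpectralVMS.seqL2 N (T / N)
                (fun n => SpectralVMS.normLinf A B (fun x => G.pcw (c n) x - aN n x))) ∧
    -- nodal exactness for a constant velocity
    (∀ a₀ : ℝ, (∀ᵐ p ∂(SpectralVMS.cylinder T A B), a p.1 p.2 = a₀) →
      ∀ (μ : ℝ) (N : ℕ) (G : SpectralVMS.Grid A B) (fN u Uh Ut : ℕ → ℝ → ℝ),
        0 < μ → 1 ≤ N →
        (∀ n ∈ Set.Icc 1 N, MemLp (fN n) 2 (volume.restrict (Ioo A B))) →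
        SpectralVMS.IsEulerSolution A B μ (T / N) N (fun _ _ => a₀) fN u₀ u →
        SpectralVMS.IsSpectralVMS G μ (T / N) N (fun _ _ => a₀) fN u₀ Uh Ut →
        (∀ n ≤ N, ∀ i, 0 < i → i < G.last → Uh n (G.node i) = u n (G.node i)) ∧
        (∀ n ∈ Set.Icc 1 N, Uh n A = u n A ∧ Uh n B = u n B)) := by
  refine ⟨fun hu₀' ε D S μmax hε _ hD _ hμmax => ?_, ?_⟩
  · obtain ⟨C, hC, h⟩ := SpectralVMS.error_estimate
      (M := (eLpNorm (Function.uncurry a) ∞ (SpectralVMS.cylinder T A B)).toReal)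
      (F := S * (eLpNorm (Function.uncurry f) 2 (SpectralVMS.cylinder T A B)).toReal)
      hAB hT L ENNReal.toReal_nonneg hD.le hμmax hu₀'
    exact ⟨C, hC, fun μ N G c aN fN u U hμ hμm hN hstep =>
      h μ N G c aN fN u U hμ hμm hN (hstep.trans (by nlinarith))⟩
  · intro a₀ _ μ N G fN u Uh Ut hμ hN hfN hu hU
    exact SpectralVMS.resolved_eq_at_nodes G hμ (div_pos hT (by exact_mod_cast hN)) hfN hu₀ hu hU
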